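/- All graphs are finite and simple. For graphs $G$ and $H$, the planar Ramsey number $PR(G,H)$ is the smallest integer $N$ such that every planar graph $F$ on $N$ vertices contains a copy of $G$ as a (not necessarily induced) subgraph, or the complement of $F$ contains a copy of $H$ as a (not necessarily induced) subgraph. Let $C_k$ be the cycle of length $k$, and let the wheel $W_n=\{x\}+C_n$ be the graph on $n+1$ vertices obtained from $C_n$ by adding a new vertex $x$ adjacent to every vertex of $C_n$. Then \[ PR(C_4,W_n)\ \ge\ \begin{cases} n+4, & \text{if } 7\le n\le 25 \text{ or } n\in\{27,28,29,30,31,33,34,36,37,39\};\\[2pt] n+5, & \text{if } n\in\{26,32,35,38\} \text{ or } n\ge 40.\end{cases} \] -/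

import Mathlib

/-- A drawing of the graph `G` in the Euclidean plane without crossings: distinct vertices are
distinct points, every edge is a simple arc joining its two end vertices, no arc passes through
a vertex in its interior, and arcs of different edges do not meet in their interiors. -/
structure PlaneDrawing {V : Type*} (G : SimpleGraph V) where
  point : V → EuclideanSpace ℝ (Fin 2)
  arc : G.edgeSet → C(unitInterval, EuclideanSpace ℝ (Fin 2))
  point_injective : Function.Injective point
  arc_injective : ∀ e, Function.Injective (arc e)
  arc_endpoints : ∀ e, s(arc e 0, arc e 1) = Sym2.map point (e : Sym2 V)
  arc_avoids_points : ∀ e, ∀ t : unitInterval, 0 < t → t < 1 → ∀ v, arc e t ≠ point v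
  arcs_disjoint : ∀ e f, e ≠ f → ∀ s t : unitInterval, 0 < s → s < 1 → 0 < t → t < 1 →
    arc e s ≠ arc f t

/-- A graph is planar if it can be drawn in the plane without crossings. -/
def IsPlanarGraph {V : Type*} (G : SimpleGraph V) : Prop :=
  Nonempty (PlaneDrawing G)

/-- The graph `{x} + G`: the graph `G` together with one new vertex `none`, the hub, which is
adjacent to every vertex of `G`. -/
def coneGraph {V : Type*} (G : SimpleGraph V) : SimpleGraph (Option V) where
  Adj
    | none, none => False
    | none, some _ => True
    | some _, none => True
    | some u, some v => G.Adj u v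
  symm := ⟨by
    rintro (_ | u) (_ | v) h
    · exact h
    · trivial
    · trivial
    · exact SimpleGraph.Adj.symm h⟩
  loopless := ⟨by
    rintro (_ | u) h
    · exact h
    · exact G.irrefl h⟩

/-- The wheel `W_n = {x} + C_n` with `n` spokes; it has `n + 1` vertices. -/
def wheelGraph (n : ℕ) : SimpleGraph (Option (Fin n)) :=
  coneGraph (SimpleGraph.cycleGraph n)

/-- The planar Ramsey number `PR(G, H)`: the smallest `N` such that every planar graph on `N`
vertices contains a copy of `G` (as a not necessarily induced subgraph) or its complement
contains a copy of `H`. -/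
noncomputable def planarRamsey {V W : Type*} (G : SimpleGraph V) (H : SimpleGraph W) : ℕ :=
  sInf {N : ℕ | ∀ F : SimpleGraph (Fin N), IsPlanarGraph F → G.IsContained F ∨ H.IsContained Fᶜ}

open SimpleGraph

/-! ### Finiteness of the planar Ramsey number -/

/-! Suppose a planar graph on `n + d` vertices has no four-cycle and all its degrees are at least
`d`. In its complement every degree is at most `n - 1`, while the hub of `W_n` has degree `n`, so
the complement contains no `W_n`. Such a graph therefore witnesses `n + d < PR(C_4, W_n)`. This is
`ExistsQuadFree.lt_planarRamsey`, and it reduces the theorem to constructing graphs: minimum degree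
3 on `n + 3` vertices for `n ≥ 7`, and minimum degree 4 on `n + 4` vertices, that is, on 30, 36, 39,
42 or at least 44 vertices.

The admissible orders for a fixed degree are closed under addition, because two drawings can be
placed side by side (`ExistsQuadFree.add`). Hence finitely many graphs suffice. For degree 3, the
orders 10 to 19 together with repeated addition of 10 give everything from 10 on. For degree 4, the
orders 44 to 73 together with repeated addition of 30 give everything from 44 on; the orders 30, 36,
39, 42 are separate.

Each basic graph is an explicit straight-line drawing with natural coordinates. Planarity thus
becomes a finite set of orientation tests on triples of points. `isStraightDrawing_graph` shows that
these tests exclude crossings, and `existsQuadFree_of_check` turns a passed test into a graph.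

Since `planarRamsey` is an infimum in `ℕ`, and the infimum of the empty set is `0`, a lower bound
also needs the defining set to be nonempty. Ramsey's theorem supplies this in
`planarRamsey_set_nonempty`. -/

theorem exists_isNClique_or_compl {V : Type*} [DecidableEq V] (G : SimpleGraph V) (k s t : ℕ)
    (hk : s + t ≤ k) (A : Finset V) (hA : 2 ^ k ≤ A.card) :
    (∃ S ⊆ A, G.IsNClique s S) ∨ (∃ S ⊆ A, Gᶜ.IsNClique t S) := by
  classical
  induction k generalizing s t A with
  | zero =>
    obtain rfl : s = 0 := by omega
    exact .inl ⟨∅, by simp, by simp [isNClique_iff]⟩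
  | succ k ih =>
    rcases s with _ | s
    · exact .inl ⟨∅, by simp, by simp [isNClique_iff]⟩
    rcases t with _ | t
    · exact .inr ⟨∅, by simp, by simp [isNClique_iff]⟩
    have hpos : 0 < 2 ^ k := by positivity
    rw [pow_succ] at hA
    obtain ⟨v, hv⟩ : A.Nonempty := Finset.card_pos.mp (by omega)
    -- Neighbours and non-neighbours of `v` together number at least `2 ^ (k + 1) - 1`, so one of
    -- the two classes has at least `2 ^ k` elements; `v` then extends a clique found there, or an
    -- independent set.
    have hcard : ((A.erase v).filter (G.Adj v)).card
        + ((A.erase v).filter (fun w => ¬ G.Adj v w)).card = A.card - 1 := by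
      rw [Finset.card_filter_add_card_filter_not, Finset.card_erase_of_mem hv]
    rcases le_or_gt (2 ^ k) ((A.erase v).filter (G.Adj v)).card with h | h
    · rcases ih s (t + 1) (by omega) _ h with ⟨S, hS, hc⟩ | ⟨S, hS, hc⟩
      · refine .inl ⟨insert v S, ?_, hc.insert fun w hw => ?_⟩
        · exact Finset.insert_subset hv (hS.trans <| (Finset.filter_subset _ _).trans
            (Finset.erase_subset _ _))
        · exact (Finset.mem_filter.mp (hS hw)).2
      · exact .inr ⟨S, hS.trans <| (Finset.filter_subset _ _).trans (Finset.erase_subset _ _), hc⟩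
    · have h' : 2 ^ k ≤ ((A.erase v).filter (fun w => ¬ G.Adj v w)).card := by omega
      rcases ih (s + 1) t (by omega) _ h' with ⟨S, hS, hc⟩ | ⟨S, hS, hc⟩
      · exact .inl ⟨S, hS.trans <| (Finset.filter_subset _ _).trans (Finset.erase_subset _ _), hc⟩
      · refine .inr ⟨insert v S, ?_, hc.insert fun w hw => ?_⟩
        · exact Finset.insert_subset hv (hS.trans <| (Finset.filter_subset _ _).trans
            (Finset.erase_subset _ _))
        · have := Finset.mem_filter.mp (hS hw)
          rw [compl_adj]
          exact ⟨(Finset.ne_of_mem_erase this.1).symm, this.2⟩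

theorem isContained_of_isNClique {V W : Type*} [Fintype W] {G : SimpleGraph V} (H : SimpleGraph W)
    {S : Finset V} (hS : G.IsNClique (Fintype.card W) S) : H.IsContained G := by
  obtain ⟨f⟩ := (not_cliqueFree_iff_top_isContained _).mp fun h : G.CliqueFree (Fintype.card W) => h S hS
  let e := Fintype.equivFin W
  exact ⟨⟨⟨fun w => f (e w), fun {a b} hab => f.toHom.map_adj (by simpa using hab.ne)⟩,
    fun a b hab => e.injective (f.injective hab)⟩⟩

/-- Without this, `planarRamsey` could be the default value `sInf ∅ = 0`. Ordinary Ramsey numbers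
already bound it: a clique of the right size contains every graph of that order, so planarity plays
no role. -/
theorem planarRamsey_set_nonempty {V W : Type*} [Fintype V] [Fintype W]
    (G : SimpleGraph V) (H : SimpleGraph W) :
    {N : ℕ | ∀ F : SimpleGraph (Fin N), IsPlanarGraph F →
      G.IsContained F ∨ H.IsContained Fᶜ}.Nonempty := by
  refine ⟨2 ^ (Fintype.card V + Fintype.card W), fun F _ => ?_⟩
  rcases exists_isNClique_or_compl F _ (Fintype.card V) (Fintype.card W) le_rfl Finset.univ
    (by simp) with ⟨S, -, h⟩ | ⟨S, -, h⟩
  · exact .inl (isContained_of_isNClique G h)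
  · exact .inr (isContained_of_isNClique H h)

/-! ### Straight-line drawings -/

/-- The map `p` draws `G` in the plane with straight edges and without crossings. -/
structure IsStraightDrawing {V : Type*} (G : SimpleGraph V)
    (p : V → EuclideanSpace ℝ (Fin 2)) : Prop where
  injective : Function.Injective p
  avoids : ∀ a b v, G.Adj a b → v ≠ a → v ≠ b → p v ∉ openSegment ℝ (p a) (p b)
  disjoint : ∀ a b c d, G.Adj a b → G.Adj c d → s(a, b) ≠ s(c, d) →
    Disjoint (openSegment ℝ (p a) (p b)) (openSegment ℝ (p c) (p d))

/-- Each edge is parametrised affinely between its ends, in the order chosen by `Sym2.out`. Interior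
times land in the open segment, so the conditions on open segments are the conditions on arcs. -/
theorem IsStraightDrawing.isPlanarGraph {V : Type*} {G : SimpleGraph V}
    {p : V → EuclideanSpace ℝ (Fin 2)} (h : IsStraightDrawing G p) : IsPlanarGraph G := by
  have hmk : ∀ e : G.edgeSet, s((e : Sym2 V).out.1, (e : Sym2 V).out.2) = (e : Sym2 V) :=
    fun e => Quot.out_eq _
  have hadj : ∀ e : G.edgeSet, G.Adj (e : Sym2 V).out.1 (e : Sym2 V).out.2 := fun e => by
    rw [← mem_edgeSet, hmk]; exact e.2
  have hopen : ∀ (x y : EuclideanSpace ℝ (Fin 2)) (t : unitInterval), 0 < t → t < 1 →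
      AffineMap.lineMap x y (t : ℝ) ∈ openSegment ℝ x y := fun x y t h0 h1 => by
    rw [openSegment_eq_image_lineMap]
    exact ⟨t, ⟨h0, h1⟩, rfl⟩
  exact ⟨{
    point := p
    arc := fun e => ⟨fun t => AffineMap.lineMap (p (e : Sym2 V).out.1) (p (e : Sym2 V).out.2) (t : ℝ),
      AffineMap.lineMap_continuous.comp continuous_subtype_val⟩
    point_injective := h.injective
    arc_injective := fun e s t hst =>
      Subtype.ext (AffineMap.lineMap_injective ℝ (h.injective.ne (hadj e).ne) hst)
    arc_endpoints := fun e => by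
      conv_rhs => rw [← hmk e]
      simp
    arc_avoids_points := fun e t h0 h1 v hv => by
      have ho := hopen (p (e : Sym2 V).out.1) (p (e : Sym2 V).out.2) t h0 h1
      change AffineMap.lineMap (p (e : Sym2 V).out.1) (p (e : Sym2 V).out.2) (t : ℝ) = p v at hv
      rw [hv] at ho
      -- An end of a segment belongs to the open segment only when the segment is degenerate; this
      -- settles the case where `v` is an end of the edge.
      have hne := h.injective.ne (hadj e).ne
      refine h.avoids _ _ v (hadj e) ?_ ?_ ho
      · rintro rfl
        exact hne (left_mem_openSegment_iff.mp ho)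
      · rintro rfl
        exact hne (right_mem_openSegment_iff.mp ho)
    arcs_disjoint := fun e f hef s t hs0 hs1 ht0 ht1 hst => by
      refine Set.disjoint_left.mp (h.disjoint _ _ _ _ (hadj e) (hadj f) ?_)
        (hopen (p (e : Sym2 V).out.1) (p (e : Sym2 V).out.2) s hs0 hs1) ?_
      · rw [hmk, hmk]
        exact fun h => hef (Subtype.ext h)
      · have := hopen (p (f : Sym2 V).out.1) (p (f : Sym2 V).out.2) t ht0 ht1
        rwa [show AffineMap.lineMap (p (e : Sym2 V).out.1) (p (e : Sym2 V).out.2) (s : ℝ)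
          = AffineMap.lineMap (p (f : Sym2 V).out.1) (p (f : Sym2 V).out.2) (t : ℝ) from hst] }⟩

/-- Induced subgraphs inherit drawings; this is how a large example yields one on any smaller number
of vertices. -/
theorem IsStraightDrawing.comap {V W : Type*} {G : SimpleGraph V}
    {p : V → EuclideanSpace ℝ (Fin 2)} (h : IsStraightDrawing G p) {f : W → V}
    (hf : Function.Injective f) : IsStraightDrawing (G.comap f) (p ∘ f) where
  injective := h.injective.comp hf
  avoids a b v hab ha hb := h.avoids _ _ _ hab (hf.ne ha) (hf.ne hb)
  disjoint a b c d hab hcd hne := h.disjoint _ _ _ _ hab hcd fun he => hne <| by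
    have := Sym2.map.injective hf (a₁ := s(a, b)) (a₂ := s(c, d)) (by simpa using he)
    exact this

theorem openSegment_add_right (x y c : EuclideanSpace ℝ (Fin 2)) :
    openSegment ℝ (x + c) (y + c) = (· + c) '' openSegment ℝ x y := by
  simp only [add_comm _ c]
  exact (openSegment_translate_image ℝ c x y).symm

theorem IsStraightDrawing.translate {V : Type*} {G : SimpleGraph V}
    {p : V → EuclideanSpace ℝ (Fin 2)} (h : IsStraightDrawing G p)
    (c : EuclideanSpace ℝ (Fin 2)) : IsStraightDrawing G (fun v => p v + c) where
  injective a b hab := h.injective (add_right_cancel hab)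
  avoids a b v hab ha hb hm := by
    rw [openSegment_add_right] at hm
    obtain ⟨x, hx, hxv⟩ := hm
    exact h.avoids a b v hab ha hb (add_right_cancel hxv ▸ hx)
  disjoint a b c' d hab hcd hne := by
    rw [openSegment_add_right, openSegment_add_right,
      Set.disjoint_image_iff (add_left_injective c)]
    exact h.disjoint a b c' d hab hcd hne

/-- Two drawings on the two sides of a vertical line give a drawing of the disjoint union. -/
theorem IsStraightDrawing.sum {V W : Type*} {G : SimpleGraph V} {H : SimpleGraph W}
    {p : V → EuclideanSpace ℝ (Fin 2)} {q : W → EuclideanSpace ℝ (Fin 2)}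
    (hG : IsStraightDrawing G p) (hH : IsStraightDrawing H q) (B : ℝ)
    (hp : ∀ v, p v 0 < B) (hq : ∀ w, B < q w 0) :
    IsStraightDrawing (G ⊕g H) (Sum.elim p q) := by
  -- The first coordinate is linear, so both open half-planes are convex and every edge stays on the
  -- side of its ends.
  have lin : IsLinearMap ℝ fun x : EuclideanSpace ℝ (Fin 2) => x 0 := ⟨by simp, by simp⟩
  have hP : ∀ a b, ∀ x ∈ openSegment ℝ (p a) (p b), x 0 < B := fun a b x hx =>
    (convex_halfSpace_lt lin B).openSegment_subset (hp a) (hp b) hx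
  have hQ : ∀ a b, ∀ x ∈ openSegment ℝ (q a) (q b), B < x 0 := fun a b x hx =>
    (convex_halfSpace_gt lin B).openSegment_subset (hq a) (hq b) hx
  refine ⟨?_, ?_, ?_⟩
  · refine hG.injective.sumElim hH.injective fun a b hab => ?_
    have h1 := hp a
    have h2 := hq b
    rw [hab] at h1
    linarith
  · rintro (a | a) (b | b) (v | v) hab ha hb hm
    -- Adjacency between the two summands of `⊕g` reduces to `false = true`, which removes every
    -- case with a mixed edge.
    all_goals first
      | exact absurd hab Bool.false_ne_true
      | skip
    · exact hG.avoids a b v (by simpa using hab) (by simpa using ha) (by simpa using hb) hm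
    · exact absurd (hP _ _ _ hm) (hq v).not_gt
    · exact absurd (hQ _ _ _ hm) (hp v).not_gt
    · exact hH.avoids a b v (by simpa using hab) (by simpa using ha) (by simpa using hb) hm
  · rintro (a | a) (b | b) (c | c) (d | d) hab hcd hne
    all_goals first
      | exact absurd hab Bool.false_ne_true
      | exact absurd hcd Bool.false_ne_true
      | skip
    · exact hG.disjoint a b c d (by simpa using hab) (by simpa using hcd) (by simpa using hne)
    · exact Set.disjoint_left.mpr fun x h1 h2 => absurd (hP _ _ _ h1) (hQ _ _ _ h2).not_gt
    · exact Set.disjoint_left.mpr fun x h1 h2 => absurd (hP _ _ _ h2) (hQ _ _ _ h1).not_gt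
    · exact hH.disjoint a b c d (by simpa using hab) (by simpa using hcd) (by simpa using hne)

/-! ### Plane graphs without four-cycles and with a given minimum degree -/

/-- There is a graph on `N` vertices with a straight-line drawing, without cycles of length four,
all of whose vertices have at least `d` neighbours. -/
def ExistsQuadFree (d N : ℕ) : Prop :=
  ∃ (V : Type) (_ : Fintype V) (G : SimpleGraph V) (p : V → EuclideanSpace ℝ (Fin 2)),
    Fintype.card V = N ∧ IsStraightDrawing G p ∧
    (∀ a b c e, G.Adj a b → G.Adj b c → G.Adj c e → G.Adj e a → a = c ∨ b = e) ∧
    ∀ v, ∃ s : Finset V, d ≤ s.card ∧ ∀ w ∈ s, G.Adj v w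

/-- A disjoint union creates no cycle and changes no degree; only the drawing needs care, and a
horizontal shift separates the two pieces. -/
theorem ExistsQuadFree.add {d M N : ℕ} (hM : ExistsQuadFree d M) (hN : ExistsQuadFree d N) :
    ExistsQuadFree d (M + N) := by
  obtain ⟨V, _, G, p, hV, hp, hG, hdG⟩ := hM
  obtain ⟨W, _, H, q, hW, hq, hH, hdH⟩ := hN
  obtain ⟨B, hB⟩ := (Set.finite_range fun v => p v 0).bddAbove
  obtain ⟨A, hA⟩ := (Set.finite_range fun w => q w 0).bddBelow
  -- With `B` above all first coordinates of `p` and `A` below those of `q`, the shift by `B + 2 -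
  -- A` moves `q` to the right of `B + 2`, so the vertical line at `B + 1` separates.
  refine ⟨V ⊕ W, inferInstance, G ⊕g H, _, by simp [hV, hW],
    hp.sum (hq.translate (EuclideanSpace.single 0 (B + 2 - A))) (B + 1) (fun v => ?_)
      (fun w => ?_), ?_, ?_⟩
  · linarith [hB ⟨v, rfl⟩]
  · have := hA ⟨w, rfl⟩
    simp only [PiLp.add_apply, PiLp.single_apply, if_true] at this ⊢
    linarith
  -- A closed walk that meets both summands would use a mixed edge, so only the two pure cases
  -- survive.
  · rintro (a | a) (b | b) (c | c) (e | e) h1 h2 h3 h4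
    all_goals first
      | exact absurd h1 Bool.false_ne_true
      | exact absurd h2 Bool.false_ne_true
      | exact absurd h3 Bool.false_ne_true
      | exact absurd h4 Bool.false_ne_true
      | skip
    · simpa using hG a b c e h1 h2 h3 h4
    · simpa using hH a b c e h1 h2 h3 h4
  · rintro (v | w)
    · obtain ⟨s, hs, h⟩ := hdG v
      exact ⟨s.map .inl, by simpa using hs, by simpa using h⟩
    · obtain ⟨s, hs, h⟩ := hdH w
      exact ⟨s.map .inr, by simpa using hs, by simpa using h⟩

/-! ### From minimum degree to a lower bound for the Ramsey number -/

theorem not_isContained_cycleGraph_four {V : Type*} {G : SimpleGraph V}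
    (hG : ∀ a b c e, G.Adj a b → G.Adj b c → G.Adj c e → G.Adj e a → a = c ∨ b = e) :
    ¬ (cycleGraph 4).IsContained G := by
  rintro ⟨f⟩
  have h : ∀ i j : Fin 4, (cycleGraph 4).Adj i j → G.Adj (f i) (f j) :=
    fun i j hij => f.toHom.map_adj hij
  rcases hG _ _ _ _ (h 0 1 (by decide)) (h 1 2 (by decide)) (h 2 3 (by decide))
    (h 3 0 (by decide)) with h | h
  · exact absurd (f.injective h) (by decide)
  · exact absurd (f.injective h) (by decide)

/-- The `d` neighbours of the hub's image avoid the whole copy of the wheel: a rim vertex is a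
non-neighbour of the hub, and the hub is not its own neighbour. That requires `d + (n + 1)`
vertices, one too many. The rim edges play no role. -/
theorem not_isContained_wheelGraph_compl {V : Type*} [Fintype V] {G : SimpleGraph V} {n d : ℕ}
    (hV : Fintype.card V ≤ n + d) (hd : ∀ v, ∃ s : Finset V, d ≤ s.card ∧ ∀ w ∈ s, G.Adj v w) :
    ¬ (wheelGraph n).IsContained Gᶜ := by
  classical
  rintro ⟨f⟩
  obtain ⟨s, hs, hadj⟩ := hd (f none)
  have hf : ∀ i : Fin n, Gᶜ.Adj (f none) (f (some i)) := fun i =>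
    f.toHom.map_adj (show (wheelGraph n).Adj none (some i) from trivial)
  have hdisj : Disjoint s (Finset.univ.image f) := by
    refine Finset.disjoint_left.mpr fun w hw hw' => ?_
    obtain ⟨i, -, rfl⟩ := Finset.mem_image.mp hw'
    rcases i with _ | i
    · exact G.irrefl (hadj _ hw)
    · exact ((compl_adj _ _ _).mp (hf i)).2 (hadj _ hw)
  have := Finset.card_le_univ (s ∪ Finset.univ.image f)
  rw [Finset.card_union_of_disjoint hdisj,
    Finset.card_image_of_injective _ (show Function.Injective f from f.injective)] at this
  simp at this
  omega

/-- The Ramsey property is only known at the minimal `N` itself, and `N` may be smaller than `n +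
d`. The graph is therefore cut down to `N` vertices. Degrees may drop, but a copy of `C_4`, or of
the wheel in the complement, still lifts back to the full graph, where it is excluded. -/
theorem ExistsQuadFree.lt_planarRamsey {d n : ℕ} (h : ExistsQuadFree d (n + d)) :
    n + d < planarRamsey (cycleGraph 4) (wheelGraph n) := by
  obtain ⟨V, _, G, p, hV, hp, hG, hd⟩ := h
  by_contra! hle
  have hmem := Nat.sInf_mem (planarRamsey_set_nonempty (cycleGraph 4) (wheelGraph n))
  let g : Fin (planarRamsey (cycleGraph 4) (wheelGraph n)) ↪ V :=
    (Fin.castLEEmb (hle.trans hV.ge)).trans (Fintype.equivFin V).symm.toEmbedding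
  rcases hmem (G.comap g) (hp.comap g.injective).isPlanarGraph with h | h
  · exact not_isContained_cycleGraph_four hG (h.trans ⟨(Embedding.comap g G).toCopy⟩)
  -- An induced subgraph keeps non-adjacency as well, so its complement embeds in `Gᶜ`.
  · refine not_isContained_wheelGraph_compl hV.le hd (h.trans ⟨⟨⟨g, fun {a b} hab => ?_⟩, g.injective⟩⟩)
    rw [compl_adj] at hab ⊢
    exact ⟨g.injective.ne hab.1, hab.2⟩

/-! ### A decision procedure for drawings with natural coordinates -/

namespace GridDrawing

/-- `a`, `b`, `c` make a left turn. -/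
def left (a b c : ℕ × ℕ) : Bool :=
  Nat.blt (a.2 * b.1 + b.2 * c.1 + c.2 * a.1) (a.1 * b.2 + b.1 * c.2 + c.1 * a.2)

/-- Equality of points, in a form that evaluates fast. -/
def same (a b : ℕ × ℕ) : Bool := Nat.beq a.1 b.1 && Nat.beq a.2 b.2

/-- The points `c`, `d` are weakly on one side of the line `ab`, and not both on the line. -/
def sided (a b c d : ℕ × ℕ) : Bool :=
  (left a b c || left a b d) != (left b a c || left b a d)

/-- A graph drawn on the grid: each vertex together with the list of its neighbours. -/
abbrev Table := List ((ℕ × ℕ) × List (ℕ × ℕ))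

/-- Every neighbour is an entry, and has the vertex as neighbour. -/
def symmetric (D : Table) : Bool :=
  D.all fun e => e.2.all fun b => D.any fun f => same b f.1 && f.2.any (same e.1)

/-- Every vertex has at least `d` neighbours, all different from each other and the vertex. -/
def degrees (d : ℕ) (D : Table) : Bool :=
  D.all fun e => Nat.ble d e.2.length && Nat.blt (e.2.countP (same e.1)) 1 &&
    e.2.all fun b => Nat.blt (e.2.countP (same b)) 2

/-- Different vertices have at most one common neighbour. -/
def quadFree (D : Table) : Bool :=
  D.all fun e => D.all fun f => Nat.blt f.1.1 e.1.1 || same e.1 f.1 ||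
    Nat.blt (e.2.countP fun b => f.2.any (same b)) 2

/-- No vertex lies on an edge, and no two edges cross. -/
def crossFree (D : Table) : Bool :=
  D.all fun e => e.2.all fun b => Nat.blt b.1 e.1.1 ||
    D.all fun f => Nat.blt f.1.1 e.1.1 || Nat.blt b.1 f.1.1 ||
      (same e.1 f.1 || same b f.1 || left e.1 b f.1 || left b e.1 f.1) &&
      f.2.all fun c => Nat.blt c.1 f.1.1 || same e.1 f.1 && same b c || same e.1 c && same b f.1 ||
        sided e.1 b f.1 c || sided f.1 c e.1 b

/-- The entries are different points. -/
def distinct (D : Table) : Bool :=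
  D.all fun e => Nat.blt (D.countP fun f => same e.1 f.1) 2

/-- All conditions on a drawing without four-cycles and with minimum degree `d`. -/
def check (d N : ℕ) (D : Table) : Bool :=
  Nat.beq D.length N && distinct D && symmetric D && degrees d D && quadFree D && crossFree D

/-! ### Soundness of the tests: orientation and segments -/

theorem same_iff {a b : ℕ × ℕ} : same a b = true ↔ a = b := by
  simp [same, Prod.ext_iff]

/-- Twice the signed area of the triangle `abz`. -/
def area (a b z : EuclideanSpace ℝ (Fin 2)) : ℝ :=
  (b 0 - a 0) * (z 1 - a 1) - (b 1 - a 1) * (z 0 - a 0)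

/-- A grid point as a point of the plane. -/
noncomputable def toPlane (a : ℕ × ℕ) : EuclideanSpace ℝ (Fin 2) := !₂[(a.1 : ℝ), (a.2 : ℝ)]

@[simp] theorem toPlane_zero (a : ℕ × ℕ) : toPlane a 0 = a.1 := rfl

@[simp] theorem toPlane_one (a : ℕ × ℕ) : toPlane a 1 = a.2 := rfl

theorem toPlane_injective : Function.Injective toPlane := fun a b h => by
  have h0 := congrArg (fun x => x 0) h
  have h1 := congrArg (fun x => x 1) h
  simp only [toPlane_zero, toPlane_one, Nat.cast_inj] at h0 h1
  exact Prod.ext h0 h1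

/-- `left` compares the positive and the negative terms of the determinant separately, which avoids
truncated subtraction in `ℕ`; the difference of the two sides is the signed area. -/
theorem left_iff {a b c : ℕ × ℕ} :
    left a b c = true ↔ 0 < area (toPlane a) (toPlane b) (toPlane c) := by
  simp only [left, Nat.blt_eq, area, toPlane_zero, toPlane_one]
  rw [← Nat.cast_lt (α := ℝ), ← sub_pos]
  push_cast
  ring_nf

theorem area_swap (a b z : EuclideanSpace ℝ (Fin 2)) : area b a z = - area a b z := by
  simp only [area]
  ring

theorem area_segment {a b c d : EuclideanSpace ℝ (Fin 2)} {s t : ℝ} (h : s + t = 1) :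
    area a b (s • c + t • d) = s * area a b c + t * area a b d := by
  obtain rfl : s = 1 - t := by linarith
  simp only [area, PiLp.add_apply, PiLp.smul_apply, smul_eq_mul]
  ring

theorem area_eq_zero_of_mem {a b z : EuclideanSpace ℝ (Fin 2)} (h : z ∈ openSegment ℝ a b) :
    area a b z = 0 := by
  obtain ⟨s, t, -, -, hst, rfl⟩ := h
  rw [area_segment hst]
  simp only [area]
  ring

/-- Signed area over `ab` is affine in the third point and vanishes on `ab`. Inside `cd` it is a
combination, with positive weights, of two values of weakly equal sign that are not both zero, hence
nonzero. One value may vanish, so edges with a common end are covered. -/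
theorem disjoint_openSegment_of_area {a b c d : EuclideanSpace ℝ (Fin 2)}
    (h : (0 ≤ area a b c ∧ 0 ≤ area a b d ∧ 0 < area a b c + area a b d) ∨
      (area a b c ≤ 0 ∧ area a b d ≤ 0 ∧ area a b c + area a b d < 0)) :
    Disjoint (openSegment ℝ a b) (openSegment ℝ c d) := by
  refine Set.disjoint_left.mpr fun z hz hz' => ?_
  have h0 := area_eq_zero_of_mem hz
  obtain ⟨s, t, hs, ht, hst, rfl⟩ := hz'
  rw [area_segment hst] at h0
  rcases h with ⟨h1, h2, h3⟩ | ⟨h1, h2, h3⟩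
  · have := mul_nonneg hs.le h1
    have := mul_nonneg ht.le h2
    have h4 : area a b c = 0 := (mul_eq_zero.mp (by linarith : s * area a b c = 0)).resolve_left hs.ne'
    have h5 : area a b d = 0 := (mul_eq_zero.mp (by linarith : t * area a b d = 0)).resolve_left ht.ne'
    linarith
  · have := mul_nonpos_of_nonneg_of_nonpos hs.le h1
    have := mul_nonpos_of_nonneg_of_nonpos ht.le h2
    have h4 : area a b c = 0 := (mul_eq_zero.mp (by linarith : s * area a b c = 0)).resolve_left hs.ne'
    have h5 : area a b d = 0 := (mul_eq_zero.mp (by linarith : t * area a b d = 0)).resolve_left ht.ne'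
    linarith

/-- Reversing `ab` changes the sign of the area. The two sides of `!=` in `sided` say whether the
left and the right open half-plane contain one of `c`, `d`; they differ exactly when one half-plane
is met and the other is not. -/
theorem disjoint_of_sided {a b c d : ℕ × ℕ} (h : sided a b c d = true) :
    Disjoint (openSegment ℝ (toPlane a) (toPlane b)) (openSegment ℝ (toPlane c) (toPlane d)) := by
  refine disjoint_openSegment_of_area ?_
  have h1 := @left_iff a b c
  have h2 := @left_iff a b d
  have h3 := @left_iff b a c
  have h4 := @left_iff b a d
  rw [area_swap, neg_pos] at h3 h4
  rw [sided, bne_iff_ne, ne_eq, Bool.eq_iff_iff, Bool.or_eq_true, Bool.or_eq_true, h1, h2, h3, h4]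
    at h
  by_cases hl : 0 < area (toPlane a) (toPlane b) (toPlane c) ∨
      0 < area (toPlane a) (toPlane b) (toPlane d)
  · have hr : ¬ (area (toPlane a) (toPlane b) (toPlane c) < 0 ∨
      area (toPlane a) (toPlane b) (toPlane d) < 0) := fun hr => h (iff_of_true hl hr)
    push Not at hr
    refine .inl ⟨hr.1, hr.2, ?_⟩
    rcases hl with hl | hl <;> linarith [hr.1, hr.2]
  · have hr : area (toPlane a) (toPlane b) (toPlane c) < 0 ∨
      area (toPlane a) (toPlane b) (toPlane d) < 0 := by
      by_contra hr
      exact h (iff_of_false hl hr)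
    push Not at hl
    refine .inr ⟨hl.1, hl.2, ?_⟩
    rcases hr with hr | hr <;> linarith [hl.1, hl.2]

/-- This justifies skipping all pairs whose ranges of first coordinates do not meet. -/
theorem bounds_of_mem {a b : ℕ × ℕ} (hab : a.1 ≤ b.1) {z : EuclideanSpace ℝ (Fin 2)}
    (hz : z ∈ openSegment ℝ (toPlane a) (toPlane b)) : (a.1 : ℝ) ≤ z 0 ∧ z 0 ≤ b.1 := by
  obtain ⟨s, t, hs, ht, hst, rfl⟩ := hz
  have hab' : (a.1 : ℝ) ≤ b.1 := by exact_mod_cast hab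
  obtain rfl : s = 1 - t := by linarith
  simp only [PiLp.add_apply, PiLp.smul_apply, smul_eq_mul, toPlane_zero]
  constructor <;> nlinarith

/-! ### From tables to drawn graphs -/

/-- The adjacency relation given by a table. -/
def Rel (D : Table) (a b : ℕ × ℕ) : Prop := ∃ e ∈ D, e.1 = a ∧ b ∈ e.2

theorem Rel.symm {D : Table} (hD : symmetric D = true) {a b : ℕ × ℕ} (h : Rel D a b) :
    Rel D b a := by
  obtain ⟨e, he, rfl, hb⟩ := h
  simp only [symmetric, List.all_eq_true, List.any_eq_true, Bool.and_eq_true, same_iff] at hD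
  obtain ⟨f, hf, rfl, x, hx, rfl⟩ := hD e he b hb
  exact ⟨f, hf, rfl, hx⟩

theorem Rel.ne {d : ℕ} {D : Table} (hD : degrees d D = true) {a b : ℕ × ℕ} (h : Rel D a b) :
    a ≠ b := by
  obtain ⟨e, he, rfl, hb⟩ := h
  rintro rfl
  simp only [degrees, List.all_eq_true, Bool.and_eq_true, Nat.blt_eq] at hD
  have := (hD e he).1.2
  rw [Nat.lt_one_iff, List.countP_eq_zero] at this
  exact this _ hb (same_iff.mpr rfl)

/-- The graph given by a table. -/
def graph (d : ℕ) (D : Table) (hs : symmetric D = true) (hd : degrees d D = true) :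
    SimpleGraph {a // a ∈ (D.map Prod.fst).toFinset} where
  Adj a b := Rel D a b
  symm := ⟨fun _ _ h => h.symm hs⟩
  loopless := ⟨fun _ h => h.ne hd rfl⟩

theorem countP_same (l : List (ℕ × ℕ)) (b : ℕ × ℕ) : l.countP (same b) = l.count b := by
  refine List.countP_congr fun x _ => ?_
  rw [same_iff, beq_iff_eq, eq_comm]

theorem nodup_map_fst {D : Table} (hD : distinct D = true) : (D.map Prod.fst).Nodup := by
  rw [List.nodup_iff_count_le_one]
  intro a
  by_cases ha : a ∈ D.map Prod.fst
  · obtain ⟨e, he, rfl⟩ := List.mem_map.mp ha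
    simp only [distinct, List.all_eq_true, Nat.blt_eq] at hD
    have := hD e he
    rw [← countP_same, List.countP_map]
    exact Nat.lt_succ_iff.mp this
  · rw [List.count_eq_zero_of_not_mem ha]
    exact Nat.zero_le _

/-- A four-cycle is a pair of different vertices with two common neighbours. `quadFree` skips pairs
in which the second vertex lies further left, whence the hypothesis `a.1 ≤ c.1`; the other order
follows by exchanging `a` and `c`. -/
theorem eq_of_common_neighbours_aux {D : Table} (hD : quadFree D = true) {a c x y : ℕ × ℕ}
    (hle : a.1 ≤ c.1) (hac : a ≠ c) (hax : Rel D a x) (hay : Rel D a y) (hcx : Rel D c x)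
    (hcy : Rel D c y) (hdis : (D.map Prod.fst).Nodup) : x = y := by
  obtain ⟨e, he, rfl, hx⟩ := hax
  obtain ⟨e', he', h', hy⟩ := hay
  -- Since no point has two entries, both neighbours of `a` are read from the same list, and
  -- likewise for `c` below.
  obtain rfl := List.inj_on_of_nodup_map hdis he' he h'
  obtain ⟨f, hf, rfl, hx'⟩ := hcx
  obtain ⟨f', hf', h'', hy'⟩ := hcy
  obtain rfl := List.inj_on_of_nodup_map hdis hf' hf h''
  simp only [quadFree, List.all_eq_true, Bool.or_eq_true, Nat.blt_eq, same_iff] at hD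
  have h := (hD e' he' f' hf').resolve_left (by rintro (h | h) <;> [omega; exact hac h])
  by_contra hne
  -- Two different common neighbours make the filtered list at least two long, against the count
  -- below 2.
  have hsub : List.Subperm [x, y] (e'.2.filter fun b => f'.2.any (same b)) := by
    refine List.subperm_of_subset (by simpa using hne) ?_
    intro z hz
    have hz : z = x ∨ z = y := by simpa using hz
    rw [List.mem_filter, List.any_eq_true]
    rcases hz with rfl | rfl
    · exact ⟨hx, _, hx', same_iff.mpr rfl⟩
    · exact ⟨hy, _, hy', same_iff.mpr rfl⟩
  have := hsub.length_le
  rw [← List.countP_eq_length_filter] at this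
  simp at this
  omega

/-- `crossFree` looks at each edge only from its left end to its right end, and at a pair of edges
only when the second starts inside the range of first coordinates of the first. Symmetry of the
relation reduces every pair to this position or to disjoint ranges. The tests are sufficient rather
than necessary: a vertex in the range must avoid the whole line through the edge, unless it is an
end. -/
theorem isStraightDrawing_graph {d : ℕ} {D : Table} (hs : symmetric D = true)
    (hd : degrees d D = true) (hc : crossFree D = true) :
    IsStraightDrawing (graph d D hs hd) (fun a => toPlane a.1) := by
  simp only [crossFree, List.all_eq_true, Bool.or_eq_true, Bool.and_eq_true, Nat.blt_eq,
    same_iff] at hc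
  -- A vertex inside the open segment has its first coordinate in the tested range and zero area
  -- over the edge, but the test makes the area nonzero in one orientation.
  have havoid : ∀ a b v, Rel D a b → a.1 ≤ b.1 → (∃ e ∈ D, e.1 = v) → v ≠ a → v ≠ b →
      toPlane v ∉ openSegment ℝ (toPlane a) (toPlane b) := by
    rintro _ b _ ⟨e, he, rfl, hb⟩ hle ⟨f, hf, rfl⟩ h1 h2 hm
    obtain ⟨h3, h4⟩ := bounds_of_mem hle hm
    have h0 := area_eq_zero_of_mem hm
    have h0' : area (toPlane b) (toPlane e.1) (toPlane f.1) = 0 := by rw [area_swap, h0, neg_zero]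
    rw [toPlane_zero, Nat.cast_le] at h3 h4
    have := ((hc e he b hb).resolve_left (by omega) f hf).resolve_left (by omega)
    rcases this.1 with ((h | h) | h) | h
    · exact h1 h.symm
    · exact h2 h.symm
    · exact (left_iff.mp h).ne' h0
    · exact (left_iff.mp h).ne' h0'
  -- Either the second edge starts strictly to the right of the first, or the line through one edge
  -- has the other edge on one side.
  have hdisj : ∀ a b u v, Rel D a b → Rel D u v → a.1 ≤ b.1 → u.1 ≤ v.1 → a.1 ≤ u.1 →
      s(a, b) ≠ s(u, v) →
      Disjoint (openSegment ℝ (toPlane a) (toPlane b)) (openSegment ℝ (toPlane u) (toPlane v)) := by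
    rintro _ b _ v ⟨e, he, rfl, hb⟩ ⟨f, hf, rfl, hv⟩ hle hle' hef hne
    rcases (hc e he b hb).resolve_left (by omega) f hf with (h | h) | h
    · omega
    · refine Set.disjoint_left.mpr fun z hz hz' => ?_
      have h1 := (bounds_of_mem hle hz).2
      have h2 := (bounds_of_mem hle' hz').1
      have h3 : (b.1 : ℝ) < f.1.1 := by exact_mod_cast h
      linarith
    · rcases h.2 v hv with (((h | ⟨h, h'⟩) | ⟨h, h'⟩) | h) | h
      · omega
      · exact absurd (by rw [h, h']) hne
      · exact absurd (by rw [h, h', Sym2.eq_swap]) hne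
      · exact disjoint_of_sided h
      · exact (disjoint_of_sided h).symm
  have hdisj' : ∀ a b u v, Rel D a b → Rel D u v → a.1 ≤ b.1 → u.1 ≤ v.1 →
      s(a, b) ≠ s(u, v) →
      Disjoint (openSegment ℝ (toPlane a) (toPlane b)) (openSegment ℝ (toPlane u) (toPlane v)) := by
    -- Disjointness is symmetric, so the edge that starts further left may be taken first.
    intro a b u v hab huv h1 h2 hne
    rcases le_total a.1 u.1 with h | h
    · exact hdisj a b u v hab huv h1 h2 h hne
    · exact (hdisj u v a b huv hab h2 h1 h hne.symm).symm
  refine ⟨toPlane_injective.comp Subtype.val_injective, ?_, ?_⟩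
  · rintro ⟨a, ha⟩ ⟨b, hb⟩ ⟨v, hv⟩ (hab : Rel D a b) hva hvb
    have hv' : ∃ e ∈ D, e.1 = v := by simpa using hv
    simp only [ne_eq, Subtype.mk.injEq] at hva hvb
    rcases le_total a.1 b.1 with h | h
    · exact havoid a b v hab h hv' hva hvb
    · rw [openSegment_symm]
      exact havoid b a v (hab.symm hs) h hv' hvb hva
  · rintro ⟨a, ha⟩ ⟨b, hb⟩ ⟨u, hu⟩ ⟨v, hv⟩ (hab : Rel D a b) (huv : Rel D u v) hne
    have hne' : s(a, b) ≠ s(u, v) := fun h => hne <| by simpa using h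
    rcases le_total a.1 b.1 with h | h <;> rcases le_total u.1 v.1 with h' | h'
    · exact hdisj' a b u v hab huv h h' hne'
    · rw [openSegment_symm ℝ (toPlane u)]
      exact hdisj' a b v u hab (huv.symm hs) h h' (by rwa [Sym2.eq_swap (a := v)])
    · rw [openSegment_symm ℝ (toPlane a)]
      exact hdisj' b a u v (hab.symm hs) huv h h' (by rwa [Sym2.eq_swap (a := b)])
    · rw [openSegment_symm ℝ (toPlane a), openSegment_symm ℝ (toPlane u)]
      exact hdisj' b a v u (hab.symm hs) (huv.symm hs) h h'
        (by rwa [Sym2.eq_swap (a := v), Sym2.eq_swap (a := b)])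

/-- The hypothesis is a closed Boolean computation on natural numbers, so for an explicit table it
can be decided by evaluation. The vertices are the listed points themselves, and `distinct` makes
their number the length of the table. -/
theorem existsQuadFree_of_check {d N : ℕ} {D : Table} (h : check d N D = true) :
    ExistsQuadFree d N := by
  simp only [check, Bool.and_eq_true] at h
  obtain ⟨⟨⟨⟨⟨hN, hdis⟩, hs⟩, hd⟩, hq⟩, hc⟩ := h
  have hnodup := nodup_map_fst hdis
  refine ⟨_, inferInstance, graph d D hs hd, _, ?_, isStraightDrawing_graph hs hd hc, ?_, ?_⟩
  · rw [Fintype.card_coe, List.toFinset_card_of_nodup hnodup, List.length_map, Nat.eq_of_beq_eq_true hN]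
  · rintro ⟨a, ha⟩ ⟨b, hb⟩ ⟨c, hc⟩ ⟨e, he⟩ (h1 : Rel D a b) (h2 : Rel D b c) (h3 : Rel D c e)
      (h4 : Rel D e a)
    simp only [Subtype.mk.injEq]
    by_contra! hne
    -- The opposite corners `a` and `c` have both `b` and `e` as neighbours.
    rcases le_total a.1 c.1 with h | h
    · exact hne.2 (eq_of_common_neighbours_aux hq h hne.1 h1 (h4.symm hs) (h2.symm hs) h3 hnodup)
    · exact hne.2 (eq_of_common_neighbours_aux hq h hne.1.symm (h2.symm hs) h3 h1 (h4.symm hs)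
        hnodup)
  · rintro ⟨v, hv⟩
    obtain ⟨e, he, rfl⟩ : ∃ e ∈ D, e.1 = v := by simpa using hv
    -- By symmetry every listed neighbour has an entry of its own, so restricting to the vertex type
    -- loses no neighbour.
    have hmem : ∀ b ∈ e.2, b ∈ (D.map Prod.fst).toFinset := fun b hb => by
      obtain ⟨f, hf, rfl, -⟩ := Rel.symm hs ⟨e, he, rfl, hb⟩
      exact List.mem_toFinset.mpr (List.mem_map_of_mem hf)
    simp only [degrees, List.all_eq_true, Bool.and_eq_true, Nat.blt_eq, Nat.ble_eq,
      countP_same] at hd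
    obtain ⟨⟨hlen, -⟩, hcount⟩ := hd e he
    have hnd : e.2.Nodup := by
      rw [List.nodup_iff_count_le_one]
      intro b
      by_cases hb : b ∈ e.2
      · exact Nat.lt_succ_iff.mp (hcount b hb)
      · rw [List.count_eq_zero_of_not_mem hb]
        exact Nat.zero_le _
    refine ⟨e.2.toFinset.subtype _, ?_, fun w hw => ?_⟩
    · rw [Finset.card_subtype, Finset.filter_true_of_mem fun b hb => hmem b (by simpa using hb),
        List.toFinset_card_of_nodup hnd]
      exact hlen
    · exact ⟨e, he, rfl, by simpa using hw⟩

end GridDrawing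

/-! ### Small plane graphs without four-cycles -/

/-! ### Minimum degree three: orders 10 to 19 -/

/-- This graph is also the block added repeatedly to reach all orders from 20 on. -/
theorem existsQuadFree_three_10 : ExistsQuadFree 3 10 :=
  GridDrawing.existsQuadFree_of_check (D := [
    ((0, 14), [(2, 2), (3, 8), (7, 14), (11, 19)]), ((2, 2), [(0, 14), (3, 8), (13, 0)]),
    ((3, 8), [(0, 14), (2, 2), (8, 8)]), ((7, 14), [(0, 14), (9, 10), (11, 19)]),
    ((8, 8), [(3, 8), (9, 10), (12, 7)]), ((9, 10), [(7, 14), (8, 8), (12, 7)]),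
    ((11, 19), [(0, 14), (7, 14), (19, 11)]), ((12, 7), [(8, 8), (9, 10), (13, 0), (19, 11)]),
    ((13, 0), [(2, 2), (12, 7), (19, 11)]), ((19, 11), [(11, 19), (12, 7), (13, 0)])])
    (by decide +kernel)

/-- No graph of odd order is cubic; here the vertex `(12, 14)` has degree four. -/
theorem existsQuadFree_three_11 : ExistsQuadFree 3 11 :=
  GridDrawing.existsQuadFree_of_check (D := [
    ((0, 6), [(1, 16), (3, 11), (8, 0)]), ((1, 16), [(0, 6), (3, 11), (10, 20)]),
    ((3, 11), [(0, 6), (1, 16), (9, 12)]), ((8, 0), [(0, 6), (12, 5), (17, 4)]),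
    ((9, 12), [(3, 11), (11, 10), (12, 14)]), ((10, 20), [(1, 16), (12, 14), (18, 14)]),
    ((11, 10), [(9, 12), (12, 5), (12, 14)]), ((12, 5), [(8, 0), (11, 10), (17, 4)]),
    ((12, 14), [(9, 12), (10, 20), (11, 10), (18, 14)]), ((17, 4), [(8, 0), (12, 5), (18, 14)]),
    ((18, 14), [(10, 20), (12, 14), (17, 4)])])
    (by decide +kernel)

theorem existsQuadFree_three_12 : ExistsQuadFree 3 12 :=
  GridDrawing.existsQuadFree_of_check (D := [
    ((0, 8), [(4, 11), (4, 17), (6, 0)]), ((4, 11), [(0, 8), (4, 17), (9, 10)]),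
    ((4, 17), [(0, 8), (4, 11), (14, 18)]), ((6, 0), [(0, 8), (11, 3), (16, 1)]),
    ((9, 10), [(4, 11), (10, 7), (11, 10)]), ((10, 7), [(9, 10), (11, 3), (11, 10)]),
    ((11, 3), [(6, 0), (10, 7), (16, 1)]), ((11, 10), [(9, 10), (10, 7), (15, 13)]),
    ((14, 18), [(4, 17), (15, 13), (20, 10)]), ((15, 13), [(11, 10), (14, 18), (20, 10)]),
    ((16, 1), [(6, 0), (11, 3), (20, 10)]), ((20, 10), [(14, 18), (15, 13), (16, 1)])])
    (by decide +kernel)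

theorem existsQuadFree_three_13 : ExistsQuadFree 3 13 :=
  GridDrawing.existsQuadFree_of_check (D := [
    ((0, 8), [(3, 16), (4, 10), (5, 1)]), ((3, 16), [(0, 8), (4, 10), (11, 19)]),
    ((4, 10), [(0, 8), (3, 16), (8, 7)]), ((5, 1), [(0, 8), (9, 2), (13, 0)]),
    ((8, 7), [(4, 10), (9, 2), (12, 9)]), ((9, 2), [(5, 1), (8, 7), (13, 0)]),
    ((11, 19), [(3, 16), (14, 14), (18, 14)]), ((12, 9), [(8, 7), (14, 14), (15, 5)]),
    ((13, 0), [(5, 1), (9, 2), (15, 5), (19, 6)]), ((14, 14), [(11, 19), (12, 9), (18, 14)]),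
    ((15, 5), [(12, 9), (13, 0), (19, 6)]), ((18, 14), [(11, 19), (14, 14), (19, 6)]),
    ((19, 6), [(13, 0), (15, 5), (18, 14)])])
    (by decide +kernel)

theorem existsQuadFree_three_14 : ExistsQuadFree 3 14 :=
  GridDrawing.existsQuadFree_of_check (D := [
    ((0, 8), [(3, 16), (4, 10), (5, 1)]), ((3, 16), [(0, 8), (4, 10), (11, 19)]),
    ((4, 10), [(0, 8), (3, 16), (9, 7)]), ((5, 1), [(0, 8), (9, 2), (13, 0)]),
    ((9, 2), [(5, 1), (9, 7), (13, 0)]), ((9, 7), [(4, 10), (9, 2), (12, 7), (12, 10)]),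
    ((11, 19), [(3, 16), (14, 14), (18, 14)]), ((12, 7), [(9, 7), (12, 10), (15, 4)]),
    ((12, 10), [(9, 7), (12, 7), (14, 14)]), ((13, 0), [(5, 1), (9, 2), (15, 4), (19, 6)]),
    ((14, 14), [(11, 19), (12, 10), (18, 14)]), ((15, 4), [(12, 7), (13, 0), (19, 6)]),
    ((18, 14), [(11, 19), (14, 14), (19, 6)]), ((19, 6), [(13, 0), (15, 4), (18, 14)])])
    (by decide +kernel)

theorem existsQuadFree_three_15 : ExistsQuadFree 3 15 :=
  GridDrawing.existsQuadFree_of_check (D := [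
    ((0, 8), [(3, 11), (3, 16), (5, 1)]), ((3, 11), [(0, 8), (3, 16), (7, 10)]),
    ((3, 16), [(0, 8), (3, 11), (11, 19)]), ((5, 1), [(0, 8), (9, 2), (13, 0)]),
    ((7, 10), [(3, 11), (9, 7), (10, 11)]), ((9, 2), [(5, 1), (9, 7), (13, 0)]),
    ((9, 7), [(7, 10), (9, 2), (10, 11)]), ((10, 11), [(7, 10), (9, 7), (11, 14), (14, 11)]),
    ((11, 14), [(10, 11), (11, 19), (14, 11)]), ((11, 19), [(3, 16), (11, 14), (18, 14)]),
    ((13, 0), [(5, 1), (9, 2), (19, 6)]), ((14, 11), [(10, 11), (11, 14), (17, 10)]),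
    ((17, 10), [(14, 11), (18, 14), (19, 6)]), ((18, 14), [(11, 19), (17, 10), (19, 6)]),
    ((19, 6), [(13, 0), (17, 10), (18, 14)])])
    (by decide +kernel)

theorem existsQuadFree_three_16 : ExistsQuadFree 3 16 :=
  GridDrawing.existsQuadFree_of_check (D := [
    ((0, 11), [(2, 4), (4, 13), (4, 18)]), ((2, 4), [(0, 11), (6, 4), (9, 0)]),
    ((4, 13), [(0, 11), (4, 18), (7, 9)]), ((4, 18), [(0, 11), (4, 13), (11, 20)]),
    ((6, 4), [(2, 4), (7, 9), (9, 0)]), ((7, 9), [(4, 13), (6, 4), (11, 10)]),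
    ((9, 0), [(2, 4), (6, 4), (16, 2)]), ((11, 10), [(7, 9), (13, 10), (13, 12)]),
    ((11, 20), [(4, 18), (14, 16), (18, 16)]), ((13, 10), [(11, 10), (13, 12), (17, 7)]),
    ((13, 12), [(11, 10), (13, 10), (14, 16)]), ((14, 16), [(11, 20), (13, 12), (18, 16)]),
    ((16, 2), [(9, 0), (17, 7), (20, 9)]), ((17, 7), [(13, 10), (16, 2), (20, 9)]),
    ((18, 16), [(11, 20), (14, 16), (20, 9)]), ((20, 9), [(16, 2), (17, 7), (18, 16)])])
    (by decide +kernel)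

theorem existsQuadFree_three_17 : ExistsQuadFree 3 17 :=
  GridDrawing.existsQuadFree_of_check (D := [
    ((0, 11), [(2, 4), (4, 12), (4, 18)]), ((2, 4), [(0, 11), (6, 4), (9, 0)]),
    ((4, 12), [(0, 11), (4, 18), (5, 9), (7, 11)]), ((4, 18), [(0, 11), (4, 12), (11, 20)]),
    ((5, 9), [(4, 12), (6, 4), (7, 11)]), ((6, 4), [(2, 4), (5, 9), (9, 0)]),
    ((7, 11), [(4, 12), (5, 9), (11, 11)]), ((9, 0), [(2, 4), (6, 4), (16, 2)]),
    ((11, 11), [(7, 11), (13, 10), (13, 13)]), ((11, 20), [(4, 18), (14, 16), (18, 16)]),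
    ((13, 10), [(11, 11), (13, 13), (17, 7)]), ((13, 13), [(11, 11), (13, 10), (14, 16)]),
    ((14, 16), [(11, 20), (13, 13), (18, 16)]), ((16, 2), [(9, 0), (17, 7), (20, 9)]),
    ((17, 7), [(13, 10), (16, 2), (20, 9)]), ((18, 16), [(11, 20), (14, 16), (20, 9)]),
    ((20, 9), [(16, 2), (17, 7), (18, 16)])])
    (by decide +kernel)

theorem existsQuadFree_three_18 : ExistsQuadFree 3 18 :=
  GridDrawing.existsQuadFree_of_check (D := [
    ((0, 11), [(2, 4), (3, 13), (4, 18)]), ((2, 4), [(0, 11), (6, 4), (9, 0)]),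
    ((3, 13), [(0, 11), (4, 18), (6, 10)]), ((4, 18), [(0, 11), (3, 13), (11, 20)]),
    ((6, 4), [(2, 4), (7, 8), (9, 0)]), ((6, 10), [(3, 13), (7, 8), (8, 9)]),
    ((7, 8), [(6, 4), (6, 10), (8, 9)]), ((8, 9), [(6, 10), (7, 8), (12, 11)]),
    ((9, 0), [(2, 4), (6, 4), (16, 2)]), ((11, 20), [(4, 18), (14, 16), (18, 16)]),
    ((12, 11), [(8, 9), (13, 12), (14, 10)]), ((13, 12), [(12, 11), (14, 10), (14, 16)]),
    ((14, 10), [(12, 11), (13, 12), (17, 7)]), ((14, 16), [(11, 20), (13, 12), (18, 16)]),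
    ((16, 2), [(9, 0), (17, 7), (20, 9)]), ((17, 7), [(14, 10), (16, 2), (20, 9)]),
    ((18, 16), [(11, 20), (14, 16), (20, 9)]), ((20, 9), [(16, 2), (17, 7), (18, 16)])])
    (by decide +kernel)

theorem existsQuadFree_three_19 : ExistsQuadFree 3 19 :=
  GridDrawing.existsQuadFree_of_check (D := [
    ((0, 9), [(2, 16), (3, 6), (4, 2)]), ((2, 16), [(0, 9), (7, 16), (9, 20)]),
    ((3, 6), [(0, 9), (4, 2), (6, 8)]), ((4, 2), [(0, 9), (3, 6), (11, 0)]),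
    ((6, 8), [(3, 6), (8, 10), (9, 9)]), ((7, 16), [(2, 16), (9, 13), (9, 20)]),
    ((8, 10), [(6, 8), (9, 9), (9, 13)]), ((9, 9), [(6, 8), (8, 10), (11, 9)]),
    ((9, 13), [(7, 16), (8, 10), (12, 11)]), ((9, 20), [(2, 16), (7, 16), (16, 18)]),
    ((11, 0), [(4, 2), (14, 4), (18, 4)]), ((11, 9), [(9, 9), (12, 11), (13, 8)]),
    ((12, 11), [(9, 13), (11, 9), (13, 8), (16, 13)]), ((13, 8), [(11, 9), (12, 11), (14, 4)]),
    ((14, 4), [(11, 0), (13, 8), (18, 4)]), ((16, 13), [(12, 11), (16, 18), (20, 11)]),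
    ((16, 18), [(9, 20), (16, 13), (20, 11)]), ((18, 4), [(11, 0), (14, 4), (20, 11)]),
    ((20, 11), [(16, 13), (16, 18), (18, 4)])])
    (by decide +kernel)

/-! ### Minimum degree four: orders 30, 36, 39, 42 and the window 44 to 73 -/

/-- This is the icosidodecahedron, the line graph of the dodecahedron, with 20 triangles and 12
pentagons. It is extremal. Without four-cycles each edge bounds at most one triangle and all other
faces have length at least 5, so there are at most `8E/15` faces. Euler's formula and `E ≥ 2V` then
force `V ≥ 30`. -/
theorem existsQuadFree_four_30 : ExistsQuadFree 4 30 :=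
  GridDrawing.existsQuadFree_of_check (D := [
    ((0, 33), [(4, 4), (4, 19), (14, 38), (26, 47)]),
    ((4, 4), [(0, 33), (4, 19), (19, 4), (33, 0)]),
    ((4, 19), [(0, 33), (4, 4), (10, 23), (11, 17)]),
    ((10, 23), [(4, 19), (11, 17), (14, 31), (15, 26)]),
    ((11, 17), [(4, 19), (10, 23), (16, 17), (17, 11)]),
    ((14, 31), [(10, 23), (14, 38), (15, 26), (20, 34)]),
    ((14, 38), [(0, 33), (14, 31), (20, 34), (26, 47)]),
    ((15, 26), [(10, 23), (14, 31), (18, 21), (20, 26)]),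
    ((16, 17), [(11, 17), (17, 11), (18, 21), (21, 18)]),
    ((17, 11), [(11, 17), (16, 17), (19, 4), (23, 10)]),
    ((18, 21), [(15, 26), (16, 17), (20, 26), (21, 18)]),
    ((19, 4), [(4, 4), (17, 11), (23, 10), (33, 0)]),
    ((20, 26), [(15, 26), (18, 21), (23, 30), (25, 25)]),
    ((20, 34), [(14, 31), (14, 38), (23, 30), (28, 32)]),
    ((21, 18), [(16, 17), (18, 21), (25, 15), (26, 20)]),
    ((23, 10), [(17, 11), (19, 4), (25, 15), (31, 14)]),
    ((23, 30), [(20, 26), (20, 34), (25, 25), (28, 32)]),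
    ((25, 15), [(21, 18), (23, 10), (26, 20), (31, 14)]),
    ((25, 25), [(20, 26), (23, 30), (26, 20), (30, 23)]),
    ((26, 20), [(21, 18), (25, 15), (25, 25), (30, 23)]),
    ((26, 47), [(0, 33), (14, 38), (35, 35), (47, 26)]),
    ((28, 32), [(20, 34), (23, 30), (32, 28), (35, 35)]),
    ((30, 23), [(25, 25), (26, 20), (32, 28), (34, 20)]),
    ((31, 14), [(23, 10), (25, 15), (34, 20), (38, 14)]),
    ((32, 28), [(28, 32), (30, 23), (34, 20), (35, 35)]),
    ((33, 0), [(4, 4), (19, 4), (38, 14), (47, 26)]),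
    ((34, 20), [(30, 23), (31, 14), (32, 28), (38, 14)]),
    ((35, 35), [(26, 47), (28, 32), (32, 28), (47, 26)]),
    ((38, 14), [(31, 14), (33, 0), (34, 20), (47, 26)]),
    ((47, 26), [(26, 47), (33, 0), (35, 35), (38, 14)])])
    (by decide +kernel)

/-- In general, the line graph of a plane cubic graph of girth at least 5 is planar, 4-regular and
free of four-cycles, its triangles being the stars of the cubic graph. A cubic graph on `m` vertices
gives order `3m/2`. Here the 72 edges split into 24 triangles, so `m = 24`. -/
theorem existsQuadFree_four_36 : ExistsQuadFree 4 36 :=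
  GridDrawing.existsQuadFree_of_check (D := [
    ((0, 25), [(5, 44), (5, 65), (17, 15), (32, 0)]),
    ((5, 44), [(0, 25), (5, 65), (15, 38), (16, 48)]),
    ((5, 65), [(0, 25), (5, 44), (25, 70), (42, 80)]),
    ((15, 38), [(5, 44), (16, 48), (19, 26), (23, 34)]),
    ((16, 48), [(5, 44), (15, 38), (24, 58), (25, 49)]),
    ((17, 15), [(0, 25), (19, 26), (28, 19), (32, 0)]),
    ((19, 26), [(15, 38), (17, 15), (23, 34), (28, 19)]),
    ((23, 34), [(15, 38), (19, 26), (28, 41), (32, 33)]),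
    ((24, 58), [(16, 48), (25, 49), (25, 70), (34, 62)]),
    ((25, 49), [(16, 48), (24, 58), (28, 41), (34, 48)]),
    ((25, 70), [(5, 65), (24, 58), (34, 62), (42, 80)]),
    ((28, 19), [(17, 15), (19, 26), (35, 25), (40, 18)]),
    ((28, 41), [(23, 34), (25, 49), (32, 33), (34, 48)]),
    ((32, 0), [(0, 25), (17, 15), (49, 10), (69, 15)]),
    ((32, 33), [(23, 34), (28, 41), (35, 25), (40, 32)]),
    ((34, 48), [(25, 49), (28, 41), (39, 55), (42, 47)]),
    ((34, 62), [(24, 58), (25, 70), (39, 55), (46, 61)]),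
    ((35, 25), [(28, 19), (32, 33), (40, 18), (40, 32)]),
    ((39, 55), [(34, 48), (34, 62), (42, 47), (46, 61)]),
    ((40, 18), [(28, 19), (35, 25), (49, 10), (50, 22)]),
    ((40, 32), [(32, 33), (35, 25), (46, 39), (49, 31)]),
    ((42, 47), [(34, 48), (39, 55), (46, 39), (51, 46)]),
    ((42, 80), [(5, 65), (25, 70), (57, 65), (74, 55)]),
    ((46, 39), [(40, 32), (42, 47), (49, 31), (51, 46)]),
    ((46, 61), [(34, 62), (39, 55), (55, 54), (57, 65)]),
    ((49, 10), [(32, 0), (40, 18), (50, 22), (69, 15)]),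
    ((49, 31), [(40, 32), (46, 39), (50, 22), (58, 32)]),
    ((50, 22), [(40, 18), (49, 10), (49, 31), (58, 32)]),
    ((51, 46), [(42, 47), (46, 39), (55, 54), (59, 42)]),
    ((55, 54), [(46, 61), (51, 46), (57, 65), (59, 42)]),
    ((57, 65), [(42, 80), (46, 61), (55, 54), (74, 55)]),
    ((58, 32), [(49, 31), (50, 22), (59, 42), (69, 36)]),
    ((59, 42), [(51, 46), (55, 54), (58, 32), (69, 36)]),
    ((69, 15), [(32, 0), (49, 10), (69, 36), (74, 55)]),
    ((69, 36), [(58, 32), (59, 42), (69, 15), (74, 55)]),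
    ((74, 55), [(42, 80), (57, 65), (69, 15), (69, 36)])])
    (by decide +kernel)

/-- The edges split into 26 triangles: a line graph of a cubic graph on 26 vertices. -/
theorem existsQuadFree_four_39 : ExistsQuadFree 4 39 :=
  GridDrawing.existsQuadFree_of_check (D := [
    ((0, 24), [(9, 37), (11, 15), (12, 52), (19, 0)]),
    ((9, 37), [(0, 24), (12, 52), (15, 32), (18, 38)]),
    ((11, 15), [(0, 24), (16, 22), (19, 0), (19, 17)]),
    ((12, 52), [(0, 24), (9, 37), (27, 51), (41, 56)]),
    ((15, 32), [(9, 37), (16, 22), (18, 38), (19, 28)]),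
    ((16, 22), [(11, 15), (15, 32), (19, 17), (19, 28)]),
    ((18, 38), [(9, 37), (15, 32), (24, 37), (25, 44)]),
    ((19, 0), [(0, 24), (11, 15), (31, 6), (48, 4)]),
    ((19, 17), [(11, 15), (16, 22), (24, 20), (28, 14)]),
    ((19, 28), [(15, 32), (16, 22), (23, 25), (23, 31)]),
    ((23, 25), [(19, 28), (23, 31), (24, 20), (28, 24)]),
    ((23, 31), [(19, 28), (23, 25), (24, 37), (28, 33)]),
    ((24, 20), [(19, 17), (23, 25), (28, 14), (28, 24)]),
    ((24, 37), [(18, 38), (23, 31), (25, 44), (28, 33)]),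
    ((25, 44), [(18, 38), (24, 37), (27, 51), (32, 45)]),
    ((27, 51), [(12, 52), (25, 44), (32, 45), (41, 56)]),
    ((28, 14), [(19, 17), (24, 20), (31, 6), (35, 13)]),
    ((28, 24), [(23, 25), (24, 20), (30, 29), (33, 24)]),
    ((28, 33), [(23, 31), (24, 37), (30, 29), (33, 34)]),
    ((30, 29), [(28, 24), (28, 33), (33, 24), (33, 34)]),
    ((31, 6), [(19, 0), (28, 14), (35, 13), (48, 4)]),
    ((32, 45), [(25, 44), (27, 51), (35, 39), (40, 42)]),
    ((33, 24), [(28, 24), (30, 29), (37, 19), (38, 26)]),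
    ((33, 34), [(28, 33), (30, 29), (35, 39), (37, 32)]),
    ((35, 13), [(28, 14), (31, 6), (37, 19), (42, 18)]),
    ((35, 39), [(32, 45), (33, 34), (37, 32), (40, 42)]),
    ((37, 19), [(33, 24), (35, 13), (38, 26), (42, 18)]),
    ((37, 32), [(33, 34), (35, 39), (38, 26), (42, 29)]),
    ((38, 26), [(33, 24), (37, 19), (37, 32), (42, 29)]),
    ((40, 42), [(32, 45), (35, 39), (45, 34), (48, 42)]),
    ((41, 56), [(12, 52), (27, 51), (48, 42), (60, 32)]),
    ((42, 18), [(35, 13), (37, 19), (46, 25), (50, 18)]),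
    ((42, 29), [(37, 32), (38, 26), (45, 34), (46, 25)]),
    ((45, 34), [(40, 42), (42, 29), (46, 25), (48, 42)]),
    ((46, 25), [(42, 18), (42, 29), (45, 34), (50, 18)]),
    ((48, 4), [(19, 0), (31, 6), (50, 18), (60, 32)]),
    ((48, 42), [(40, 42), (41, 56), (45, 34), (60, 32)]),
    ((50, 18), [(42, 18), (46, 25), (48, 4), (60, 32)]),
    ((60, 32), [(41, 56), (48, 4), (48, 42), (50, 18)])])
    (by decide +kernel)

/-- The edges split into 28 triangles: a line graph of a cubic graph on 28 vertices. -/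
theorem existsQuadFree_four_42 : ExistsQuadFree 4 42 :=
  GridDrawing.existsQuadFree_of_check (D := [
    ((0, 49), [(11, 128), (15, 88), (37, 31), (63, 0)]),
    ((11, 128), [(0, 49), (15, 88), (51, 135), (85, 158)]),
    ((15, 88), [(0, 49), (11, 128), (33, 82), (35, 97)]),
    ((33, 82), [(15, 88), (35, 97), (44, 66), (47, 79)]),
    ((35, 97), [(15, 88), (33, 82), (50, 114), (51, 100)]),
    ((37, 31), [(0, 49), (46, 47), (58, 38), (63, 0)]),
    ((44, 66), [(33, 82), (46, 47), (47, 79), (54, 59)]),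
    ((46, 47), [(37, 31), (44, 66), (54, 59), (58, 38)]),
    ((47, 79), [(33, 82), (44, 66), (57, 89), (60, 78)]),
    ((50, 114), [(35, 97), (51, 100), (51, 135), (67, 120)]),
    ((51, 100), [(35, 97), (50, 114), (57, 89), (67, 98)]),
    ((51, 135), [(11, 128), (50, 114), (67, 120), (85, 158)]),
    ((54, 59), [(44, 66), (46, 47), (64, 67), (67, 57)]),
    ((57, 89), [(47, 79), (51, 100), (60, 78), (67, 98)]),
    ((58, 38), [(37, 31), (46, 47), (72, 46), (81, 36)]),
    ((60, 78), [(47, 79), (57, 89), (64, 67), (74, 74)]),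
    ((63, 0), [(0, 49), (37, 31), (97, 23), (137, 30)]),
    ((64, 67), [(54, 59), (60, 78), (67, 57), (74, 74)]),
    ((67, 57), [(54, 59), (64, 67), (72, 46), (80, 57)]),
    ((67, 98), [(51, 100), (57, 89), (77, 109), (82, 95)]),
    ((67, 120), [(50, 114), (51, 135), (77, 109), (91, 117)]),
    ((72, 46), [(58, 38), (67, 57), (80, 57), (81, 36)]),
    ((74, 74), [(60, 78), (64, 67), (84, 68), (85, 82)]),
    ((77, 109), [(67, 98), (67, 120), (82, 95), (91, 117)]),
    ((80, 57), [(67, 57), (72, 46), (84, 68), (95, 59)]),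
    ((81, 36), [(58, 38), (72, 46), (97, 23), (98, 44)]),
    ((82, 95), [(67, 98), (77, 109), (85, 82), (97, 91)]),
    ((84, 68), [(74, 74), (80, 57), (85, 82), (95, 59)]),
    ((85, 82), [(74, 74), (82, 95), (84, 68), (97, 91)]),
    ((85, 158), [(11, 128), (51, 135), (110, 126), (148, 109)]),
    ((91, 117), [(67, 120), (77, 109), (105, 105), (110, 126)]),
    ((95, 59), [(80, 57), (84, 68), (98, 44), (111, 64)]),
    ((97, 23), [(63, 0), (81, 36), (98, 44), (137, 30)]),
    ((97, 91), [(82, 95), (85, 82), (105, 105), (113, 83)]),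
    ((98, 44), [(81, 36), (95, 59), (97, 23), (111, 64)]),
    ((105, 105), [(91, 117), (97, 91), (110, 126), (113, 83)]),
    ((110, 126), [(85, 158), (91, 117), (105, 105), (148, 109)]),
    ((111, 64), [(95, 59), (98, 44), (113, 83), (132, 71)]),
    ((113, 83), [(97, 91), (105, 105), (111, 64), (132, 71)]),
    ((132, 71), [(111, 64), (113, 83), (137, 30), (148, 109)]),
    ((137, 30), [(63, 0), (97, 23), (132, 71), (148, 109)]),
    ((148, 109), [(85, 158), (110, 126), (132, 71), (137, 30)])])
    (by decide +kernel)

/-- The line graph of a cubic graph has order divisible by 3, so 44 needs another shape; `(30, 44)`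
and `(73, 66)` have degree six. From here on all orders are needed, and below 60 none is a sum of
smaller ones, since every graph of this kind has at least 30 vertices. -/
theorem existsQuadFree_four_44 : ExistsQuadFree 4 44 :=
  GridDrawing.existsQuadFree_of_check (D := [
    ((0, 82), [(10, 12), (14, 48), (34, 92), (63, 113)]),
    ((10, 12), [(0, 82), (14, 48), (46, 13), (80, 0)]),
    ((14, 48), [(0, 82), (10, 12), (27, 58), (30, 44)]),
    ((27, 58), [(14, 48), (30, 44), (35, 75), (36, 65)]),
    ((30, 44), [(14, 48), (27, 58), (39, 53), (41, 49), (43, 30), (43, 40)]),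
    ((34, 92), [(0, 82), (35, 75), (47, 81), (63, 113)]),
    ((35, 75), [(27, 58), (34, 92), (36, 65), (47, 81)]),
    ((36, 65), [(27, 58), (35, 75), (41, 61), (46, 68)]),
    ((39, 53), [(30, 44), (41, 49), (41, 61), (46, 58)]),
    ((41, 49), [(30, 44), (39, 53), (48, 49), (49, 53)]),
    ((41, 61), [(36, 65), (39, 53), (46, 58), (46, 68)]),
    ((43, 30), [(30, 44), (43, 40), (46, 13), (56, 27)]),
    ((43, 40), [(30, 44), (43, 30), (50, 44), (54, 41)]),
    ((46, 13), [(10, 12), (43, 30), (56, 27), (80, 0)]),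
    ((46, 58), [(39, 53), (41, 61), (51, 58), (54, 61)]),
    ((46, 68), [(36, 65), (41, 61), (54, 74), (55, 68)]),
    ((47, 81), [(34, 92), (35, 75), (54, 74), (66, 77)]),
    ((48, 49), [(41, 49), (49, 53), (50, 44), (55, 50)]),
    ((49, 53), [(41, 49), (48, 49), (51, 58), (56, 57)]),
    ((50, 44), [(43, 40), (48, 49), (54, 41), (55, 50)]),
    ((51, 58), [(46, 58), (49, 53), (54, 61), (56, 57)]),
    ((54, 41), [(43, 40), (50, 44), (62, 36), (62, 45)]),
    ((54, 61), [(46, 58), (51, 58), (55, 68), (63, 65)]),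
    ((54, 74), [(46, 68), (47, 81), (55, 68), (66, 77)]),
    ((55, 50), [(48, 49), (50, 44), (60, 55), (63, 51)]),
    ((55, 68), [(46, 68), (54, 61), (54, 74), (63, 65)]),
    ((56, 27), [(43, 30), (46, 13), (62, 36), (73, 35)]),
    ((56, 57), [(49, 53), (51, 58), (60, 55), (65, 61)]),
    ((60, 55), [(55, 50), (56, 57), (63, 51), (65, 61)]),
    ((62, 36), [(54, 41), (56, 27), (62, 45), (73, 35)]),
    ((62, 45), [(54, 41), (62, 36), (63, 51), (71, 54)]),
    ((63, 51), [(55, 50), (60, 55), (62, 45), (71, 54)]),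
    ((63, 65), [(54, 61), (55, 68), (65, 61), (73, 66)]),
    ((63, 113), [(0, 82), (34, 92), (83, 82), (112, 63)]),
    ((65, 61), [(56, 57), (60, 55), (63, 65), (73, 66)]),
    ((66, 77), [(47, 81), (54, 74), (73, 66), (83, 82)]),
    ((71, 54), [(62, 45), (63, 51), (73, 66), (79, 47)]),
    ((73, 35), [(56, 27), (62, 36), (79, 47), (90, 35)]),
    ((73, 66), [(63, 65), (65, 61), (66, 77), (71, 54), (79, 47), (83, 82)]),
    ((79, 47), [(71, 54), (73, 35), (73, 66), (90, 35)]),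
    ((80, 0), [(10, 12), (46, 13), (90, 35), (112, 63)]),
    ((83, 82), [(63, 113), (66, 77), (73, 66), (112, 63)]),
    ((90, 35), [(73, 35), (79, 47), (80, 0), (112, 63)]),
    ((112, 63), [(63, 113), (80, 0), (83, 82), (90, 35)])])
    (by decide +kernel)

/-- Again the line graph of a cubic graph, now on 30 vertices. -/
theorem existsQuadFree_four_45 : ExistsQuadFree 4 45 :=
  GridDrawing.existsQuadFree_of_check (D := [
    ((0, 66), [(7, 37), (10, 9), (27, 77), (51, 92)]),
    ((7, 37), [(0, 66), (10, 9), (15, 45), (17, 35)]),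
    ((10, 9), [(0, 66), (7, 37), (41, 8), (67, 0)]),
    ((15, 45), [(7, 37), (17, 35), (21, 48), (22, 55)]),
    ((17, 35), [(7, 37), (15, 45), (24, 33), (29, 27)]),
    ((21, 48), [(15, 45), (22, 55), (24, 41), (27, 48)]),
    ((22, 55), [(15, 45), (21, 48), (28, 66), (30, 59)]),
    ((24, 33), [(17, 35), (24, 41), (29, 27), (29, 36)]),
    ((24, 41), [(21, 48), (24, 33), (27, 48), (29, 36)]),
    ((27, 48), [(21, 48), (24, 41), (32, 53), (33, 46)]),
    ((27, 77), [(0, 66), (28, 66), (41, 70), (51, 92)]),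
    ((28, 66), [(22, 55), (27, 77), (30, 59), (41, 70)]),
    ((29, 27), [(17, 35), (24, 33), (37, 26), (38, 18)]),
    ((29, 36), [(24, 33), (24, 41), (34, 38), (35, 33)]),
    ((30, 59), [(22, 55), (28, 66), (32, 53), (37, 55)]),
    ((32, 53), [(27, 48), (30, 59), (33, 46), (37, 55)]),
    ((33, 46), [(27, 48), (32, 53), (34, 38), (38, 44)]),
    ((34, 38), [(29, 36), (33, 46), (35, 33), (38, 44)]),
    ((35, 33), [(29, 36), (34, 38), (37, 26), (41, 33)]),
    ((37, 26), [(29, 27), (35, 33), (38, 18), (41, 33)]),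
    ((37, 55), [(30, 59), (32, 53), (42, 48), (45, 55)]),
    ((38, 18), [(29, 27), (37, 26), (41, 8), (50, 19)]),
    ((38, 44), [(33, 46), (34, 38), (42, 48), (43, 40)]),
    ((41, 8), [(10, 9), (38, 18), (50, 19), (67, 0)]),
    ((41, 33), [(35, 33), (37, 26), (43, 40), (49, 36)]),
    ((41, 70), [(27, 77), (28, 66), (49, 62), (56, 67)]),
    ((42, 48), [(37, 55), (38, 44), (43, 40), (45, 55)]),
    ((43, 40), [(38, 44), (41, 33), (42, 48), (49, 36)]),
    ((45, 55), [(37, 55), (42, 48), (49, 62), (54, 52)]),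
    ((49, 36), [(41, 33), (43, 40), (53, 30), (55, 42)]),
    ((49, 62), [(41, 70), (45, 55), (54, 52), (56, 67)]),
    ((50, 19), [(38, 18), (41, 8), (53, 30), (62, 26)]),
    ((51, 92), [(0, 66), (27, 77), (71, 69), (92, 52)]),
    ((53, 30), [(49, 36), (50, 19), (55, 42), (62, 26)]),
    ((54, 52), [(45, 55), (49, 62), (55, 42), (63, 48)]),
    ((55, 42), [(49, 36), (53, 30), (54, 52), (63, 48)]),
    ((56, 67), [(41, 70), (49, 62), (66, 57), (71, 69)]),
    ((62, 26), [(50, 19), (53, 30), (70, 39), (77, 27)]),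
    ((63, 48), [(54, 52), (55, 42), (66, 57), (70, 39)]),
    ((66, 57), [(56, 67), (63, 48), (70, 39), (71, 69)]),
    ((67, 0), [(10, 9), (41, 8), (77, 27), (92, 52)]),
    ((70, 39), [(62, 26), (63, 48), (66, 57), (77, 27)]),
    ((71, 69), [(51, 92), (56, 67), (66, 57), (92, 52)]),
    ((77, 27), [(62, 26), (67, 0), (70, 39), (92, 52)]),
    ((92, 52), [(51, 92), (67, 0), (71, 69), (77, 27)])])
    (by decide +kernel)

theorem existsQuadFree_four_46 : ExistsQuadFree 4 46 :=
  GridDrawing.existsQuadFree_of_check (D := [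
    ((0, 49), [(11, 128), (15, 87), (38, 33), (63, 0)]),
    ((11, 128), [(0, 49), (15, 87), (50, 135), (85, 158)]),
    ((15, 87), [(0, 49), (11, 128), (34, 76), (34, 94)]),
    ((34, 76), [(15, 87), (34, 94), (43, 54), (50, 70)]),
    ((34, 94), [(15, 87), (34, 76), (47, 113), (49, 97)]),
    ((38, 33), [(0, 49), (43, 54), (58, 43), (63, 0)]),
    ((43, 54), [(34, 76), (38, 33), (50, 70), (58, 43)]),
    ((47, 113), [(34, 94), (49, 97), (50, 135), (60, 120)]),
    ((49, 97), [(34, 94), (47, 113), (57, 83), (60, 96)]),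
    ((50, 70), [(34, 76), (43, 54), (57, 83), (68, 72)]),
    ((50, 135), [(11, 128), (47, 113), (60, 120), (85, 158)]),
    ((57, 83), [(49, 97), (50, 70), (60, 96), (68, 72)]),
    ((58, 43), [(38, 33), (43, 54), (71, 54), (81, 39)]),
    ((60, 96), [(49, 97), (57, 83), (66, 108), (70, 97)]),
    ((60, 120), [(47, 113), (50, 135), (66, 108), (77, 115)]),
    ((63, 0), [(0, 49), (38, 33), (96, 24), (137, 30)]),
    ((66, 108), [(60, 96), (60, 120), (70, 97), (77, 115)]),
    ((68, 72), [(50, 70), (57, 83), (71, 54), (74, 85), (80, 80), (82, 63)]),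
    ((70, 97), [(60, 96), (66, 108), (74, 85), (79, 97)]),
    ((71, 54), [(58, 43), (68, 72), (81, 39), (82, 63)]),
    ((74, 85), [(68, 72), (70, 97), (79, 97), (80, 80)]),
    ((77, 115), [(60, 120), (66, 108), (86, 108), (96, 117)]),
    ((79, 97), [(70, 97), (74, 85), (86, 108), (89, 98)]),
    ((80, 80), [(68, 72), (74, 85), (90, 89), (92, 79)]),
    ((81, 39), [(58, 43), (71, 54), (96, 24), (98, 44)]),
    ((82, 63), [(68, 72), (71, 54), (94, 70), (97, 59)]),
    ((85, 158), [(11, 128), (50, 135), (111, 127), (148, 109)]),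
    ((86, 108), [(77, 115), (79, 97), (89, 98), (96, 117)]),
    ((89, 98), [(79, 97), (86, 108), (90, 89), (99, 98)]),
    ((90, 89), [(80, 80), (89, 98), (92, 79), (99, 98)]),
    ((92, 79), [(80, 80), (90, 89), (94, 70), (104, 79)]),
    ((94, 70), [(82, 63), (92, 79), (97, 59), (104, 79)]),
    ((96, 24), [(63, 0), (81, 39), (98, 44), (137, 30)]),
    ((96, 117), [(77, 115), (86, 108), (105, 110), (111, 127)]),
    ((97, 59), [(82, 63), (94, 70), (98, 44), (113, 61)]),
    ((98, 44), [(81, 39), (96, 24), (97, 59), (113, 61)]),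
    ((99, 98), [(89, 98), (90, 89), (105, 110), (108, 91)]),
    ((104, 79), [(92, 79), (94, 70), (108, 91), (117, 76)]),
    ((105, 110), [(96, 117), (99, 98), (108, 91), (111, 127)]),
    ((108, 91), [(99, 98), (104, 79), (105, 110), (117, 76)]),
    ((111, 127), [(85, 158), (96, 117), (105, 110), (148, 109)]),
    ((113, 61), [(97, 59), (98, 44), (117, 76), (134, 70)]),
    ((117, 76), [(104, 79), (108, 91), (113, 61), (134, 70)]),
    ((134, 70), [(113, 61), (117, 76), (137, 30), (148, 109)]),
    ((137, 30), [(63, 0), (96, 24), (134, 70), (148, 109)]),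
    ((148, 109), [(85, 158), (111, 127), (134, 70), (137, 30)])])
    (by decide +kernel)

theorem existsQuadFree_four_47 : ExistsQuadFree 4 47 :=
  GridDrawing.existsQuadFree_of_check (D := [
    ((0, 107), [(12, 61), (16, 14), (45, 124), (84, 150)]),
    ((12, 61), [(0, 107), (16, 14), (31, 76), (35, 53)]),
    ((16, 14), [(0, 107), (12, 61), (63, 12), (109, 0)]),
    ((31, 76), [(12, 61), (35, 53), (42, 85), (43, 101)]),
    ((35, 53), [(12, 61), (31, 76), (51, 48), (54, 34)]),
    ((42, 85), [(31, 76), (43, 101), (51, 74), (52, 87)]),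
    ((43, 101), [(31, 76), (42, 85), (45, 124), (64, 110)]),
    ((45, 124), [(0, 107), (43, 101), (64, 110), (84, 150)]),
    ((51, 48), [(35, 53), (54, 34), (55, 60), (67, 51)]),
    ((51, 74), [(42, 85), (52, 87), (55, 60), (58, 68)]),
    ((52, 87), [(42, 85), (51, 74), (60, 87), (60, 98)]),
    ((54, 34), [(35, 53), (51, 48), (63, 12), (77, 31)]),
    ((55, 60), [(51, 48), (51, 74), (58, 68), (67, 51)]),
    ((58, 68), [(51, 74), (55, 60), (63, 75), (68, 65)]),
    ((60, 87), [(52, 87), (60, 98), (63, 75), (66, 82)]),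
    ((60, 98), [(52, 87), (60, 87), (64, 110), (67, 98)]),
    ((63, 12), [(16, 14), (54, 34), (77, 31), (109, 0)]),
    ((63, 75), [(58, 68), (60, 87), (66, 82), (68, 65)]),
    ((64, 110), [(43, 101), (45, 124), (60, 98), (67, 98), (79, 100), (91, 107)]),
    ((66, 82), [(60, 87), (63, 75), (69, 87), (72, 76)]),
    ((67, 51), [(51, 48), (55, 60), (75, 56), (84, 48)]),
    ((67, 98), [(60, 98), (64, 110), (69, 87), (74, 88)]),
    ((68, 65), [(58, 68), (63, 75), (73, 66), (75, 56)]),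
    ((69, 87), [(66, 82), (67, 98), (72, 76), (74, 88)]),
    ((72, 76), [(66, 82), (69, 87), (73, 66), (78, 69)]),
    ((73, 66), [(68, 65), (72, 76), (75, 56), (78, 69)]),
    ((74, 88), [(67, 98), (69, 87), (79, 76), (81, 88)]),
    ((75, 56), [(67, 51), (68, 65), (73, 66), (84, 48)]),
    ((77, 31), [(54, 34), (63, 12), (84, 48), (101, 44)]),
    ((78, 69), [(72, 76), (73, 66), (79, 76), (83, 62)]),
    ((79, 76), [(74, 88), (78, 69), (81, 88), (83, 62)]),
    ((79, 100), [(64, 110), (81, 88), (88, 83), (91, 107)]),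
    ((81, 88), [(74, 88), (79, 76), (79, 100), (88, 83)]),
    ((83, 62), [(78, 69), (79, 76), (84, 48), (90, 65)]),
    ((84, 48), [(67, 51), (75, 56), (77, 31), (83, 62), (90, 65), (101, 44)]),
    ((84, 150), [(0, 107), (45, 124), (114, 114), (151, 84)]),
    ((88, 83), [(79, 100), (81, 88), (90, 65), (102, 76)]),
    ((90, 65), [(83, 62), (84, 48), (88, 83), (102, 76)]),
    ((91, 107), [(64, 110), (79, 100), (108, 91), (114, 114)]),
    ((101, 44), [(77, 31), (84, 48), (112, 64), (126, 44)]),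
    ((102, 76), [(88, 83), (90, 65), (108, 91), (112, 64)]),
    ((108, 91), [(91, 107), (102, 76), (112, 64), (114, 114)]),
    ((109, 0), [(16, 14), (63, 12), (126, 44), (151, 84)]),
    ((112, 64), [(101, 44), (102, 76), (108, 91), (126, 44)]),
    ((114, 114), [(84, 150), (91, 107), (108, 91), (151, 84)]),
    ((126, 44), [(101, 44), (109, 0), (112, 64), (151, 84)]),
    ((151, 84), [(84, 150), (109, 0), (114, 114), (126, 44)])])
    (by decide +kernel)

theorem existsQuadFree_four_48 : ExistsQuadFree 4 48 :=
  GridDrawing.existsQuadFree_of_check (D := [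
    ((0, 36), [(9, 96), (11, 65), (28, 23), (48, 0)]),
    ((9, 96), [(0, 36), (11, 65), (39, 101), (64, 118)]),
    ((11, 65), [(0, 36), (9, 96), (24, 53), (26, 65)]),
    ((24, 53), [(11, 65), (26, 65), (31, 37), (35, 46)]),
    ((26, 65), [(11, 65), (24, 53), (37, 66), (37, 75)]),
    ((28, 23), [(0, 36), (31, 37), (42, 29), (48, 0)]),
    ((31, 37), [(24, 53), (28, 23), (35, 46), (42, 29)]),
    ((35, 46), [(24, 53), (31, 37), (43, 50), (45, 42)]),
    ((37, 66), [(26, 65), (37, 75), (44, 58), (47, 64)]),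
    ((37, 75), [(26, 65), (37, 66), (43, 88), (47, 78)]),
    ((39, 101), [(9, 96), (43, 88), (53, 92), (64, 118)]),
    ((42, 29), [(28, 23), (31, 37), (50, 33), (59, 26)]),
    ((43, 50), [(35, 46), (44, 58), (45, 42), (50, 52)]),
    ((43, 88), [(37, 75), (39, 101), (47, 78), (53, 92)]),
    ((44, 58), [(37, 66), (43, 50), (47, 64), (50, 52)]),
    ((45, 42), [(35, 46), (43, 50), (50, 33), (55, 40)]),
    ((47, 64), [(37, 66), (44, 58), (52, 71), (56, 63)]),
    ((47, 78), [(37, 75), (43, 88), (52, 71), (57, 77)]),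
    ((48, 0), [(0, 36), (28, 23), (73, 17), (103, 22)]),
    ((50, 33), [(42, 29), (45, 42), (55, 40), (59, 26)]),
    ((50, 52), [(43, 50), (44, 58), (57, 47), (58, 55)]),
    ((52, 71), [(47, 64), (47, 78), (56, 63), (57, 77)]),
    ((53, 92), [(39, 101), (43, 88), (62, 84), (70, 89)]),
    ((55, 40), [(45, 42), (50, 33), (57, 47), (65, 40)]),
    ((56, 63), [(47, 64), (52, 71), (58, 55), (65, 59)]),
    ((57, 47), [(50, 52), (55, 40), (58, 55), (65, 40)]),
    ((57, 77), [(47, 78), (52, 71), (62, 84), (67, 74)]),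
    ((58, 55), [(50, 52), (56, 63), (57, 47), (65, 59)]),
    ((59, 26), [(42, 29), (50, 33), (69, 31), (73, 17)]),
    ((62, 84), [(53, 92), (57, 77), (67, 74), (70, 89)]),
    ((64, 118), [(9, 96), (39, 101), (84, 95), (112, 82)]),
    ((65, 40), [(55, 40), (57, 47), (69, 31), (74, 44)]),
    ((65, 59), [(56, 63), (58, 55), (71, 65), (75, 55)]),
    ((67, 74), [(57, 77), (62, 84), (71, 65), (78, 71)]),
    ((69, 31), [(59, 26), (65, 40), (73, 17), (74, 44)]),
    ((70, 89), [(53, 92), (62, 84), (81, 80), (84, 95)]),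
    ((71, 65), [(65, 59), (67, 74), (75, 55), (78, 71)]),
    ((73, 17), [(48, 0), (59, 26), (69, 31), (103, 22)]),
    ((74, 44), [(65, 40), (69, 31), (75, 55), (86, 53)]),
    ((75, 55), [(65, 59), (71, 65), (74, 44), (86, 53)]),
    ((78, 71), [(67, 74), (71, 65), (81, 80), (88, 64)]),
    ((81, 80), [(70, 89), (78, 71), (84, 95), (88, 64)]),
    ((84, 95), [(64, 118), (70, 89), (81, 80), (112, 82)]),
    ((86, 53), [(74, 44), (75, 55), (88, 64), (101, 53)]),
    ((88, 64), [(78, 71), (81, 80), (86, 53), (101, 53)]),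
    ((101, 53), [(86, 53), (88, 64), (103, 22), (112, 82)]),
    ((103, 22), [(48, 0), (73, 17), (101, 53), (112, 82)]),
    ((112, 82), [(64, 118), (84, 95), (101, 53), (103, 22)])])
    (by decide +kernel)

theorem existsQuadFree_four_49 : ExistsQuadFree 4 49 :=
  GridDrawing.existsQuadFree_of_check (D := [
    ((0, 49), [(11, 128), (14, 87), (37, 30), (63, 0)]),
    ((11, 128), [(0, 49), (14, 87), (52, 135), (85, 158)]),
    ((14, 87), [(0, 49), (11, 128), (30, 78), (33, 90)]),
    ((30, 78), [(14, 87), (33, 90), (41, 63), (44, 73)]),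
    ((33, 90), [(14, 87), (30, 78), (48, 89), (49, 101)]),
    ((37, 30), [(0, 49), (44, 45), (56, 36), (63, 0)]),
    ((41, 63), [(30, 78), (44, 45), (44, 73), (51, 55)]),
    ((44, 45), [(37, 30), (41, 63), (51, 55), (56, 36)]),
    ((44, 73), [(30, 78), (41, 63), (53, 80), (56, 71)]),
    ((48, 89), [(33, 90), (49, 101), (53, 80), (63, 84)]),
    ((49, 101), [(33, 90), (48, 89), (57, 117), (62, 104)]),
    ((51, 55), [(41, 63), (44, 45), (60, 62), (63, 53)]),
    ((52, 135), [(11, 128), (57, 117), (70, 123), (85, 158)]),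
    ((53, 80), [(44, 73), (48, 89), (56, 71), (63, 84)]),
    ((56, 36), [(37, 30), (44, 45), (68, 43), (79, 34)]),
    ((56, 71), [(44, 73), (53, 80), (60, 62), (68, 70)]),
    ((57, 117), [(49, 101), (52, 135), (62, 104), (70, 123)]),
    ((60, 62), [(51, 55), (56, 71), (63, 53), (68, 70)]),
    ((62, 104), [(49, 101), (57, 117), (70, 92), (75, 101)]),
    ((63, 0), [(0, 49), (37, 30), (97, 23), (137, 30)]),
    ((63, 53), [(51, 55), (60, 62), (68, 43), (74, 53)]),
    ((63, 84), [(48, 89), (53, 80), (70, 92), (78, 78)]),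
    ((68, 43), [(56, 36), (63, 53), (74, 53), (79, 34)]),
    ((68, 70), [(56, 71), (60, 62), (77, 64), (78, 78)]),
    ((70, 92), [(62, 104), (63, 84), (75, 101), (78, 78)]),
    ((70, 123), [(52, 135), (57, 117), (81, 111), (93, 119)]),
    ((74, 53), [(63, 53), (68, 43), (77, 64), (86, 54)]),
    ((75, 101), [(62, 104), (70, 92), (81, 111), (87, 98)]),
    ((77, 64), [(68, 70), (74, 53), (78, 78), (86, 54)]),
    ((78, 78), [(63, 84), (68, 70), (70, 92), (77, 64), (90, 86), (95, 73)]),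
    ((79, 34), [(56, 36), (68, 43), (92, 41), (97, 23)]),
    ((81, 111), [(70, 123), (75, 101), (87, 98), (93, 119)]),
    ((85, 158), [(11, 128), (52, 135), (111, 127), (148, 109)]),
    ((86, 54), [(74, 53), (77, 64), (92, 41), (98, 59)]),
    ((87, 98), [(75, 101), (81, 111), (90, 86), (101, 94)]),
    ((90, 86), [(78, 78), (87, 98), (95, 73), (101, 94)]),
    ((92, 41), [(79, 34), (86, 54), (97, 23), (98, 59)]),
    ((93, 119), [(70, 123), (81, 111), (107, 107), (111, 127)]),
    ((95, 73), [(78, 78), (90, 86), (98, 59), (112, 71)]),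
    ((97, 23), [(63, 0), (79, 34), (92, 41), (137, 30)]),
    ((98, 59), [(86, 54), (92, 41), (95, 73), (112, 71)]),
    ((101, 94), [(87, 98), (90, 86), (107, 107), (115, 86)]),
    ((107, 107), [(93, 119), (101, 94), (111, 127), (115, 86)]),
    ((111, 127), [(85, 158), (93, 119), (107, 107), (148, 109)]),
    ((112, 71), [(95, 73), (98, 59), (115, 86), (133, 72)]),
    ((115, 86), [(101, 94), (107, 107), (112, 71), (133, 72)]),
    ((133, 72), [(112, 71), (115, 86), (137, 30), (148, 109)]),
    ((137, 30), [(63, 0), (97, 23), (133, 72), (148, 109)]),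
    ((148, 109), [(85, 158), (111, 127), (133, 72), (137, 30)])])
    (by decide +kernel)

theorem existsQuadFree_four_50 : ExistsQuadFree 4 50 :=
  GridDrawing.existsQuadFree_of_check (D := [
    ((0, 49), [(10, 88), (11, 128), (34, 27), (63, 0)]),
    ((10, 88), [(0, 49), (11, 128), (25, 81), (33, 97)]),
    ((11, 128), [(0, 49), (10, 88), (50, 138), (85, 158)]),
    ((25, 81), [(10, 88), (33, 97), (35, 62), (38, 75)]),
    ((33, 97), [(10, 88), (25, 81), (48, 116), (53, 97)]),
    ((34, 27), [(0, 49), (39, 43), (56, 32), (63, 0)]),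
    ((35, 62), [(25, 81), (38, 75), (39, 43), (45, 53)]),
    ((38, 75), [(25, 81), (35, 62), (49, 71), (49, 83)]),
    ((39, 43), [(34, 27), (35, 62), (45, 53), (56, 32)]),
    ((45, 53), [(35, 62), (39, 43), (53, 59), (59, 48)]),
    ((48, 116), [(33, 97), (50, 138), (53, 97), (68, 125)]),
    ((49, 71), [(38, 75), (49, 83), (53, 59), (60, 64)]),
    ((49, 83), [(38, 75), (49, 71), (53, 97), (61, 82)]),
    ((50, 138), [(11, 128), (48, 116), (68, 125), (85, 158)]),
    ((53, 59), [(45, 53), (49, 71), (59, 48), (60, 64)]),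
    ((53, 97), [(33, 97), (48, 116), (49, 83), (61, 82), (71, 88), (71, 100)]),
    ((56, 32), [(34, 27), (39, 43), (68, 38), (81, 32)]),
    ((59, 48), [(45, 53), (53, 59), (68, 38), (72, 48)]),
    ((60, 64), [(49, 71), (53, 59), (66, 70), (72, 58)]),
    ((61, 82), [(49, 83), (53, 97), (66, 70), (73, 70)]),
    ((63, 0), [(0, 49), (34, 27), (98, 20), (137, 30)]),
    ((66, 70), [(60, 64), (61, 82), (72, 58), (73, 70)]),
    ((68, 38), [(56, 32), (59, 48), (72, 48), (81, 32)]),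
    ((68, 125), [(48, 116), (50, 138), (80, 112), (93, 122)]),
    ((71, 88), [(53, 97), (71, 100), (79, 73), (86, 76)]),
    ((71, 100), [(53, 97), (71, 88), (80, 112), (87, 97)]),
    ((72, 48), [(59, 48), (68, 38), (72, 58), (84, 50)]),
    ((72, 58), [(60, 64), (66, 70), (72, 48), (84, 50)]),
    ((73, 70), [(61, 82), (66, 70), (79, 73), (86, 58)]),
    ((79, 73), [(71, 88), (73, 70), (86, 58), (86, 76)]),
    ((80, 112), [(68, 125), (71, 100), (87, 97), (93, 122)]),
    ((81, 32), [(56, 32), (68, 38), (98, 20), (98, 44)]),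
    ((84, 50), [(72, 48), (72, 58), (86, 58), (98, 44)]),
    ((85, 158), [(11, 128), (50, 138), (113, 130), (149, 109)]),
    ((86, 58), [(73, 70), (79, 73), (84, 50), (98, 44)]),
    ((86, 76), [(71, 88), (79, 73), (96, 81), (99, 63)]),
    ((87, 97), [(71, 100), (80, 112), (96, 81), (104, 93)]),
    ((93, 122), [(68, 125), (80, 112), (111, 109), (113, 130)]),
    ((96, 81), [(86, 76), (87, 97), (99, 63), (104, 93)]),
    ((98, 20), [(63, 0), (81, 32), (98, 44), (137, 30)]),
    ((98, 44), [(81, 32), (84, 50), (86, 58), (98, 20), (99, 63), (115, 62)]),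
    ((99, 63), [(86, 76), (96, 81), (98, 44), (115, 62)]),
    ((104, 93), [(87, 97), (96, 81), (111, 109), (120, 84)]),
    ((111, 109), [(93, 122), (104, 93), (113, 130), (120, 84)]),
    ((113, 130), [(85, 158), (93, 122), (111, 109), (149, 109)]),
    ((115, 62), [(98, 44), (99, 63), (120, 84), (137, 70)]),
    ((120, 84), [(104, 93), (111, 109), (115, 62), (137, 70)]),
    ((137, 30), [(63, 0), (98, 20), (137, 70), (149, 109)]),
    ((137, 70), [(115, 62), (120, 84), (137, 30), (149, 109)]),
    ((149, 109), [(85, 158), (113, 130), (137, 30), (137, 70)])])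
    (by decide +kernel)

theorem existsQuadFree_four_51 : ExistsQuadFree 4 51 :=
  GridDrawing.existsQuadFree_of_check (D := [
    ((0, 49), [(11, 128), (14, 88), (36, 30), (63, 0)]),
    ((11, 128), [(0, 49), (14, 88), (51, 135), (85, 158)]),
    ((14, 88), [(0, 49), (11, 128), (31, 81), (35, 97)]),
    ((31, 81), [(14, 88), (35, 97), (39, 65), (43, 75)]),
    ((35, 97), [(14, 88), (31, 81), (50, 114), (52, 100)]),
    ((36, 30), [(0, 49), (41, 46), (51, 38), (63, 0)]),
    ((39, 65), [(31, 81), (41, 46), (43, 75), (46, 56)]),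
    ((41, 46), [(36, 30), (39, 65), (46, 56), (51, 38)]),
    ((43, 75), [(31, 81), (39, 65), (53, 71), (55, 80)]),
    ((46, 56), [(39, 65), (41, 46), (54, 62), (56, 54)]),
    ((50, 114), [(35, 97), (51, 135), (52, 100), (68, 121)]),
    ((51, 38), [(36, 30), (41, 46), (60, 46), (70, 41)]),
    ((51, 135), [(11, 128), (50, 114), (68, 121), (85, 158)]),
    ((52, 100), [(35, 97), (50, 114), (60, 91), (69, 99)]),
    ((53, 71), [(43, 75), (54, 62), (55, 80), (61, 67)]),
    ((54, 62), [(46, 56), (53, 71), (56, 54), (61, 67)]),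
    ((55, 80), [(43, 75), (53, 71), (60, 91), (66, 80)]),
    ((56, 54), [(46, 56), (54, 62), (60, 46), (65, 54)]),
    ((60, 46), [(51, 38), (56, 54), (65, 54), (70, 41)]),
    ((60, 91), [(52, 100), (55, 80), (66, 80), (69, 99)]),
    ((61, 67), [(53, 71), (54, 62), (68, 62), (69, 72)]),
    ((63, 0), [(0, 49), (36, 30), (98, 23), (137, 30)]),
    ((65, 54), [(56, 54), (60, 46), (68, 62), (75, 55)]),
    ((66, 80), [(55, 80), (60, 91), (69, 72), (78, 77)]),
    ((68, 62), [(61, 67), (65, 54), (69, 72), (75, 55)]),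
    ((68, 121), [(50, 114), (51, 135), (78, 109), (91, 117)]),
    ((69, 72), [(61, 67), (66, 80), (68, 62), (78, 77)]),
    ((69, 99), [(52, 100), (60, 91), (78, 109), (84, 96)]),
    ((70, 41), [(51, 38), (60, 46), (80, 46), (87, 36)]),
    ((75, 55), [(65, 54), (68, 62), (80, 46), (86, 58)]),
    ((78, 77), [(66, 80), (69, 72), (88, 84), (89, 69)]),
    ((78, 109), [(68, 121), (69, 99), (84, 96), (91, 117)]),
    ((80, 46), [(70, 41), (75, 55), (86, 58), (87, 36)]),
    ((84, 96), [(69, 99), (78, 109), (88, 84), (99, 92)]),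
    ((85, 158), [(11, 128), (51, 135), (111, 126), (148, 109)]),
    ((86, 58), [(75, 55), (80, 46), (89, 69), (99, 59)]),
    ((87, 36), [(70, 41), (80, 46), (98, 23), (101, 45)]),
    ((88, 84), [(78, 77), (84, 96), (89, 69), (99, 92)]),
    ((89, 69), [(78, 77), (86, 58), (88, 84), (99, 59)]),
    ((91, 117), [(68, 121), (78, 109), (106, 105), (111, 126)]),
    ((98, 23), [(63, 0), (87, 36), (101, 45), (137, 30)]),
    ((99, 59), [(86, 58), (89, 69), (101, 45), (113, 64)]),
    ((99, 92), [(84, 96), (88, 84), (106, 105), (114, 83)]),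
    ((101, 45), [(87, 36), (98, 23), (99, 59), (113, 64)]),
    ((106, 105), [(91, 117), (99, 92), (111, 126), (114, 83)]),
    ((111, 126), [(85, 158), (91, 117), (106, 105), (148, 109)]),
    ((113, 64), [(99, 59), (101, 45), (114, 83), (133, 71)]),
    ((114, 83), [(99, 92), (106, 105), (113, 64), (133, 71)]),
    ((133, 71), [(113, 64), (114, 83), (137, 30), (148, 109)]),
    ((137, 30), [(63, 0), (98, 23), (133, 71), (148, 109)]),
    ((148, 109), [(85, 158), (111, 126), (133, 71), (137, 30)])])
    (by decide +kernel)

theorem existsQuadFree_four_52 : ExistsQuadFree 4 52 :=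
  GridDrawing.existsQuadFree_of_check (D := [
    ((0, 49), [(11, 128), (19, 87), (39, 33), (63, 0)]),
    ((11, 128), [(0, 49), (19, 87), (54, 130), (85, 158)]),
    ((19, 87), [(0, 49), (11, 128), (37, 80), (42, 92)]),
    ((37, 80), [(19, 87), (42, 92), (45, 65), (48, 75)]),
    ((39, 33), [(0, 49), (47, 48), (57, 41), (63, 0)]),
    ((42, 92), [(19, 87), (37, 80), (56, 108), (60, 91)]),
    ((45, 65), [(37, 80), (47, 48), (48, 75), (52, 58)]),
    ((47, 48), [(39, 33), (45, 65), (52, 58), (57, 41)]),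
    ((48, 75), [(37, 80), (45, 65), (55, 72), (56, 80)]),
    ((52, 58), [(45, 65), (47, 48), (57, 63), (61, 56)]),
    ((54, 130), [(11, 128), (56, 108), (70, 115), (85, 158)]),
    ((55, 72), [(48, 75), (56, 80), (57, 63), (61, 68)]),
    ((56, 80), [(48, 75), (55, 72), (60, 91), (63, 80)]),
    ((56, 108), [(42, 92), (54, 130), (60, 91), (70, 115)]),
    ((57, 41), [(39, 33), (47, 48), (66, 47), (77, 39)]),
    ((57, 63), [(52, 58), (55, 72), (61, 56), (61, 68)]),
    ((60, 91), [(42, 92), (56, 80), (56, 108), (63, 80), (73, 87), (74, 95)]),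
    ((61, 56), [(52, 58), (57, 63), (66, 47), (67, 57)]),
    ((61, 68), [(55, 72), (57, 63), (65, 72), (67, 65)]),
    ((63, 0), [(0, 49), (39, 33), (94, 26), (137, 30)]),
    ((63, 80), [(56, 80), (60, 91), (65, 72), (71, 75)]),
    ((65, 72), [(61, 68), (63, 80), (67, 65), (71, 75)]),
    ((66, 47), [(57, 41), (61, 56), (67, 57), (77, 39)]),
    ((67, 57), [(61, 56), (66, 47), (67, 65), (74, 62)]),
    ((67, 65), [(61, 68), (65, 72), (67, 57), (74, 62)]),
    ((70, 115), [(54, 130), (56, 108), (80, 105), (91, 113)]),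
    ((71, 75), [(63, 80), (65, 72), (76, 78), (77, 68)]),
    ((73, 87), [(60, 91), (74, 95), (76, 78), (84, 82)]),
    ((74, 62), [(67, 57), (67, 65), (77, 68), (84, 59)]),
    ((74, 95), [(60, 91), (73, 87), (80, 105), (86, 95)]),
    ((76, 78), [(71, 75), (73, 87), (77, 68), (84, 82)]),
    ((77, 39), [(57, 41), (66, 47), (88, 46), (94, 26)]),
    ((77, 68), [(71, 75), (74, 62), (76, 78), (84, 59)]),
    ((80, 105), [(70, 115), (74, 95), (86, 95), (91, 113)]),
    ((84, 59), [(74, 62), (77, 68), (88, 46), (95, 63)]),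
    ((84, 82), [(73, 87), (76, 78), (91, 86), (95, 76)]),
    ((85, 158), [(11, 128), (54, 130), (109, 124), (148, 109)]),
    ((86, 95), [(74, 95), (80, 105), (91, 86), (99, 93)]),
    ((88, 46), [(77, 39), (84, 59), (94, 26), (95, 63)]),
    ((91, 86), [(84, 82), (86, 95), (95, 76), (99, 93)]),
    ((91, 113), [(70, 115), (80, 105), (103, 105), (109, 124)]),
    ((94, 26), [(63, 0), (77, 39), (88, 46), (137, 30)]),
    ((95, 63), [(84, 59), (88, 46), (95, 76), (109, 74)]),
    ((95, 76), [(84, 82), (91, 86), (95, 63), (109, 74)]),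
    ((99, 93), [(86, 95), (91, 86), (103, 105), (111, 86)]),
    ((103, 105), [(91, 113), (99, 93), (109, 124), (111, 86)]),
    ((109, 74), [(95, 63), (95, 76), (111, 86), (129, 73)]),
    ((109, 124), [(85, 158), (91, 113), (103, 105), (148, 109)]),
    ((111, 86), [(99, 93), (103, 105), (109, 74), (129, 73)]),
    ((129, 73), [(109, 74), (111, 86), (137, 30), (148, 109)]),
    ((137, 30), [(63, 0), (94, 26), (129, 73), (148, 109)]),
    ((148, 109), [(85, 158), (109, 124), (129, 73), (137, 30)])])
    (by decide +kernel)

theorem existsQuadFree_four_53 : ExistsQuadFree 4 53 :=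
  GridDrawing.existsQuadFree_of_check (D := [
    ((0, 61), [(14, 160), (25, 106), (48, 43), (79, 0)]),
    ((14, 160), [(0, 61), (25, 106), (69, 164), (107, 198)]),
    ((25, 106), [(0, 61), (14, 160), (46, 90), (53, 105)]),
    ((46, 90), [(25, 106), (53, 67), (53, 105), (60, 80)]),
    ((48, 43), [(0, 61), (53, 67), (65, 57), (79, 0)]),
    ((53, 67), [(46, 90), (48, 43), (60, 80), (65, 57)]),
    ((53, 105), [(25, 106), (46, 90), (72, 118), (76, 101)]),
    ((60, 80), [(46, 90), (53, 67), (71, 77), (71, 87)]),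
    ((65, 57), [(48, 43), (53, 67), (75, 66), (85, 59)]),
    ((69, 164), [(14, 160), (77, 140), (90, 148), (107, 198)]),
    ((71, 77), [(60, 80), (71, 87), (75, 66), (81, 73)]),
    ((71, 87), [(60, 80), (71, 77), (76, 101), (81, 89)]),
    ((72, 118), [(53, 105), (76, 101), (77, 140), (84, 126)]),
    ((75, 66), [(65, 57), (71, 77), (81, 73), (85, 59)]),
    ((76, 101), [(53, 105), (71, 87), (72, 118), (81, 89), (90, 106), (93, 97)]),
    ((77, 140), [(69, 164), (72, 118), (84, 126), (90, 148)]),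
    ((79, 0), [(0, 61), (48, 43), (120, 34), (172, 38)]),
    ((81, 73), [(71, 77), (75, 66), (86, 80), (91, 72)]),
    ((81, 89), [(71, 87), (76, 101), (86, 80), (92, 85)]),
    ((84, 126), [(72, 118), (77, 140), (93, 116), (97, 126)]),
    ((85, 59), [(65, 57), (75, 66), (96, 63), (106, 52)]),
    ((86, 80), [(81, 73), (81, 89), (91, 72), (92, 85)]),
    ((90, 106), [(76, 101), (93, 97), (93, 116), (103, 108)]),
    ((90, 148), [(69, 164), (77, 140), (103, 136), (115, 144)]),
    ((91, 72), [(81, 73), (86, 80), (96, 63), (101, 73)]),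
    ((92, 85), [(81, 89), (86, 80), (100, 89), (102, 80)]),
    ((93, 97), [(76, 101), (90, 106), (100, 89), (109, 93)]),
    ((93, 116), [(84, 126), (90, 106), (97, 126), (103, 108)]),
    ((96, 63), [(85, 59), (91, 72), (101, 73), (106, 52)]),
    ((97, 126), [(84, 126), (93, 116), (103, 136), (109, 123)]),
    ((100, 89), [(92, 85), (93, 97), (102, 80), (109, 93)]),
    ((101, 73), [(91, 72), (96, 63), (102, 80), (114, 76)]),
    ((102, 80), [(92, 85), (100, 89), (101, 73), (114, 76)]),
    ((103, 108), [(90, 106), (93, 116), (112, 112), (114, 100)]),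
    ((103, 136), [(90, 148), (97, 126), (109, 123), (115, 144)]),
    ((106, 52), [(85, 59), (96, 63), (118, 62), (120, 34)]),
    ((107, 198), [(14, 160), (69, 164), (137, 155), (186, 137)]),
    ((109, 93), [(93, 97), (100, 89), (114, 100), (128, 87)]),
    ((109, 123), [(97, 126), (103, 136), (112, 112), (123, 118)]),
    ((112, 112), [(103, 108), (109, 123), (114, 100), (123, 118)]),
    ((114, 76), [(101, 73), (102, 80), (118, 62), (128, 87)]),
    ((114, 100), [(103, 108), (109, 93), (112, 112), (128, 87)]),
    ((115, 144), [(90, 148), (103, 136), (129, 132), (137, 155)]),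
    ((118, 62), [(106, 52), (114, 76), (120, 34), (128, 87)]),
    ((120, 34), [(79, 0), (106, 52), (118, 62), (172, 38)]),
    ((123, 118), [(109, 123), (112, 112), (129, 132), (136, 106)]),
    ((128, 87), [(109, 93), (114, 76), (114, 100), (118, 62), (136, 106), (159, 91)]),
    ((129, 132), [(115, 144), (123, 118), (136, 106), (137, 155)]),
    ((136, 106), [(123, 118), (128, 87), (129, 132), (159, 91)]),
    ((137, 155), [(107, 198), (115, 144), (129, 132), (186, 137)]),
    ((159, 91), [(128, 87), (136, 106), (172, 38), (186, 137)]),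
    ((172, 38), [(79, 0), (120, 34), (159, 91), (186, 137)]),
    ((186, 137), [(107, 198), (137, 155), (159, 91), (172, 38)])])
    (by decide +kernel)

theorem existsQuadFree_four_54 : ExistsQuadFree 4 54 :=
  GridDrawing.existsQuadFree_of_check (D := [
    ((0, 79), [(26, 123), (35, 44), (38, 172), (61, 0)]),
    ((26, 123), [(0, 79), (38, 100), (38, 172), (48, 119)]),
    ((35, 44), [(0, 79), (41, 70), (54, 51), (61, 0)]),
    ((38, 100), [(26, 123), (41, 70), (48, 84), (48, 119)]),
    ((38, 172), [(0, 79), (26, 123), (88, 171), (137, 186)]),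
    ((41, 70), [(35, 44), (38, 100), (48, 84), (54, 51)]),
    ((48, 84), [(38, 100), (41, 70), (61, 73), (62, 86)]),
    ((48, 119), [(26, 123), (38, 100), (65, 114), (71, 130)]),
    ((54, 51), [(35, 44), (41, 70), (66, 57), (78, 46)]),
    ((61, 0), [(0, 79), (35, 44), (110, 15), (160, 14)]),
    ((61, 73), [(48, 84), (62, 86), (66, 57), (73, 66)]),
    ((62, 86), [(48, 84), (61, 73), (69, 99), (73, 86)]),
    ((65, 114), [(48, 119), (69, 99), (71, 130), (79, 103)]),
    ((66, 57), [(54, 51), (61, 73), (73, 66), (78, 46)]),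
    ((69, 99), [(62, 86), (65, 114), (73, 86), (79, 103)]),
    ((71, 130), [(48, 119), (65, 114), (87, 148), (91, 130)]),
    ((73, 66), [(61, 73), (66, 57), (80, 74), (86, 62)]),
    ((73, 86), [(62, 86), (69, 99), (80, 74), (86, 82)]),
    ((78, 46), [(54, 51), (66, 57), (93, 49), (101, 35)]),
    ((79, 103), [(65, 114), (69, 99), (90, 91), (95, 102)]),
    ((80, 74), [(73, 66), (73, 86), (86, 62), (86, 82)]),
    ((86, 62), [(73, 66), (80, 74), (93, 49), (98, 63)]),
    ((86, 82), [(73, 86), (80, 74), (90, 91), (97, 77)]),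
    ((87, 148), [(71, 130), (88, 171), (91, 130), (108, 151)]),
    ((88, 171), [(38, 172), (87, 148), (108, 151), (137, 186)]),
    ((90, 91), [(79, 103), (86, 82), (95, 102), (97, 77)]),
    ((91, 130), [(71, 130), (87, 148), (100, 114), (108, 124)]),
    ((93, 49), [(78, 46), (86, 62), (98, 63), (101, 35)]),
    ((95, 102), [(79, 103), (90, 91), (100, 114), (110, 98)]),
    ((97, 77), [(86, 82), (90, 91), (98, 63), (111, 70)]),
    ((98, 63), [(86, 62), (93, 49), (97, 77), (111, 70)]),
    ((100, 114), [(91, 130), (95, 102), (108, 124), (110, 98)]),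
    ((101, 35), [(78, 46), (93, 49), (110, 15), (122, 41)]),
    ((108, 124), [(91, 130), (100, 114), (119, 134), (124, 115)]),
    ((108, 151), [(87, 148), (88, 171), (119, 134), (136, 138)]),
    ((110, 15), [(61, 0), (101, 35), (122, 41), (160, 14)]),
    ((110, 98), [(95, 102), (100, 114), (119, 81), (125, 98)]),
    ((111, 70), [(97, 77), (98, 63), (119, 81), (126, 62)]),
    ((119, 81), [(110, 98), (111, 70), (125, 98), (126, 62)]),
    ((119, 134), [(108, 124), (108, 151), (124, 115), (136, 138)]),
    ((122, 41), [(101, 35), (110, 15), (126, 62), (145, 61)]),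
    ((124, 115), [(108, 124), (119, 134), (125, 98), (141, 102)]),
    ((125, 98), [(110, 98), (119, 81), (124, 115), (141, 102)]),
    ((126, 62), [(111, 70), (119, 81), (122, 41), (145, 61)]),
    ((136, 138), [(108, 151), (119, 134), (151, 116), (162, 141)]),
    ((137, 186), [(38, 172), (88, 171), (162, 141), (198, 107)]),
    ((141, 102), [(124, 115), (125, 98), (151, 116), (154, 86)]),
    ((145, 61), [(122, 41), (126, 62), (154, 86), (171, 63)]),
    ((151, 116), [(136, 138), (141, 102), (154, 86), (162, 141)]),
    ((154, 86), [(141, 102), (145, 61), (151, 116), (171, 63)]),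
    ((160, 14), [(61, 0), (110, 15), (171, 63), (198, 107)]),
    ((162, 141), [(136, 138), (137, 186), (151, 116), (198, 107)]),
    ((171, 63), [(145, 61), (154, 86), (160, 14), (198, 107)]),
    ((198, 107), [(137, 186), (160, 14), (162, 141), (171, 63)])])
    (by decide +kernel)

theorem existsQuadFree_four_55 : ExistsQuadFree 4 55 :=
  GridDrawing.existsQuadFree_of_check (D := [
    ((0, 63), [(26, 94), (30, 137), (32, 39), (49, 0)]),
    ((26, 94), [(0, 63), (30, 137), (38, 77), (46, 88)]),
    ((30, 137), [(0, 63), (26, 94), (73, 129), (109, 148)]),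
    ((32, 39), [(0, 63), (40, 57), (47, 47), (49, 0)]),
    ((38, 77), [(26, 94), (40, 57), (46, 66), (46, 88)]),
    ((40, 57), [(32, 39), (38, 77), (46, 66), (47, 47)]),
    ((46, 66), [(38, 77), (40, 57), (54, 60), (56, 67)]),
    ((46, 88), [(26, 94), (38, 77), (59, 84), (63, 94)]),
    ((47, 47), [(32, 39), (40, 57), (55, 52), (62, 45)]),
    ((49, 0), [(0, 63), (32, 39), (86, 19), (128, 11)]),
    ((54, 60), [(46, 66), (55, 52), (56, 67), (60, 57)]),
    ((55, 52), [(47, 47), (54, 60), (60, 57), (62, 45)]),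
    ((56, 67), [(46, 66), (54, 60), (61, 74), (62, 67)]),
    ((59, 84), [(46, 88), (61, 74), (63, 94), (69, 78)]),
    ((60, 57), [(54, 60), (55, 52), (65, 61), (67, 55)]),
    ((61, 74), [(56, 67), (59, 84), (62, 67), (69, 78)]),
    ((62, 45), [(47, 47), (55, 52), (70, 47), (77, 36)]),
    ((62, 67), [(56, 67), (61, 74), (65, 61), (69, 66)]),
    ((63, 94), [(46, 88), (59, 84), (74, 108), (76, 93)]),
    ((65, 61), [(60, 57), (62, 67), (67, 55), (69, 66)]),
    ((67, 55), [(60, 57), (65, 61), (70, 47), (73, 56)]),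
    ((69, 66), [(62, 67), (65, 61), (73, 72), (74, 63)]),
    ((69, 78), [(59, 84), (61, 74), (73, 72), (80, 78)]),
    ((70, 47), [(62, 45), (67, 55), (73, 56), (77, 36)]),
    ((73, 56), [(67, 55), (70, 47), (74, 63), (80, 60)]),
    ((73, 72), [(69, 66), (69, 78), (74, 63), (80, 78)]),
    ((73, 129), [(30, 137), (74, 108), (86, 111), (109, 148)]),
    ((74, 63), [(69, 66), (73, 56), (73, 72), (80, 60)]),
    ((74, 108), [(63, 94), (73, 129), (76, 93), (86, 111)]),
    ((76, 93), [(63, 94), (74, 108), (80, 78), (87, 89)]),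
    ((77, 36), [(62, 45), (70, 47), (86, 19), (88, 39)]),
    ((80, 60), [(73, 56), (74, 63), (85, 66), (88, 54)]),
    ((80, 78), [(69, 78), (73, 72), (76, 93), (85, 66), (87, 89), (91, 72)]),
    ((85, 66), [(80, 60), (80, 78), (88, 54), (91, 72)]),
    ((86, 19), [(49, 0), (77, 36), (88, 39), (128, 11)]),
    ((86, 111), [(73, 129), (74, 108), (94, 98), (105, 103)]),
    ((87, 89), [(76, 93), (80, 78), (94, 98), (97, 86)]),
    ((88, 39), [(77, 36), (86, 19), (88, 54), (98, 54)]),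
    ((88, 54), [(80, 60), (85, 66), (88, 39), (98, 54)]),
    ((91, 72), [(80, 78), (85, 66), (99, 76), (101, 65)]),
    ((94, 98), [(86, 111), (87, 89), (97, 86), (105, 103)]),
    ((97, 86), [(87, 89), (94, 98), (99, 76), (108, 81)]),
    ((98, 54), [(88, 39), (88, 54), (101, 65), (113, 60)]),
    ((99, 76), [(91, 72), (97, 86), (101, 65), (108, 81)]),
    ((101, 65), [(91, 72), (98, 54), (99, 76), (113, 60)]),
    ((105, 103), [(86, 111), (94, 98), (115, 92), (124, 109)]),
    ((108, 81), [(97, 86), (99, 76), (115, 92), (118, 72)]),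
    ((109, 148), [(30, 137), (73, 129), (124, 109), (158, 85)]),
    ((113, 60), [(98, 54), (101, 65), (118, 72), (132, 54)]),
    ((115, 92), [(105, 103), (108, 81), (118, 72), (124, 109)]),
    ((118, 72), [(108, 81), (113, 60), (115, 92), (132, 54)]),
    ((124, 109), [(105, 103), (109, 148), (115, 92), (158, 85)]),
    ((128, 11), [(49, 0), (86, 19), (132, 54), (158, 85)]),
    ((132, 54), [(113, 60), (118, 72), (128, 11), (158, 85)]),
    ((158, 85), [(109, 148), (124, 109), (128, 11), (132, 54)])])
    (by decide +kernel)

theorem existsQuadFree_four_56 : ExistsQuadFree 4 56 :=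
  GridDrawing.existsQuadFree_of_check (D := [
    ((0, 49), [(11, 128), (19, 87), (35, 29), (63, 0)]),
    ((11, 128), [(0, 49), (19, 87), (51, 135), (85, 158)]),
    ((19, 87), [(0, 49), (11, 128), (29, 68), (30, 77), (40, 97), (41, 84)]),
    ((29, 68), [(19, 87), (30, 77), (35, 47), (36, 57)]),
    ((30, 77), [(19, 87), (29, 68), (39, 69), (42, 74)]),
    ((35, 29), [(0, 49), (35, 47), (46, 38), (63, 0)]),
    ((35, 47), [(29, 68), (35, 29), (36, 57), (46, 38)]),
    ((36, 57), [(29, 68), (35, 47), (42, 61), (46, 53)]),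
    ((39, 69), [(30, 77), (42, 61), (42, 74), (47, 63)]),
    ((40, 97), [(19, 87), (41, 84), (53, 115), (57, 101)]),
    ((41, 84), [(19, 87), (40, 97), (51, 77), (64, 77)]),
    ((42, 61), [(36, 57), (39, 69), (46, 53), (47, 63)]),
    ((42, 74), [(30, 77), (39, 69), (51, 77), (52, 70)]),
    ((46, 38), [(35, 29), (35, 47), (53, 44), (64, 39)]),
    ((46, 53), [(36, 57), (42, 61), (53, 44), (54, 51)]),
    ((47, 63), [(39, 69), (42, 61), (53, 64), (54, 57)]),
    ((51, 77), [(41, 84), (42, 74), (52, 70), (64, 77)]),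
    ((51, 135), [(11, 128), (53, 115), (69, 122), (85, 158)]),
    ((52, 70), [(42, 74), (51, 77), (53, 64), (60, 64)]),
    ((53, 44), [(46, 38), (46, 53), (54, 51), (64, 39)]),
    ((53, 64), [(47, 63), (52, 70), (54, 57), (60, 64)]),
    ((53, 115), [(40, 97), (51, 135), (57, 101), (69, 122)]),
    ((54, 51), [(46, 53), (53, 44), (54, 57), (62, 51)]),
    ((54, 57), [(47, 63), (53, 64), (54, 51), (62, 51)]),
    ((57, 101), [(40, 97), (53, 115), (67, 89), (72, 100)]),
    ((60, 64), [(52, 70), (53, 64), (66, 56), (68, 65)]),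
    ((62, 51), [(54, 51), (54, 57), (66, 56), (71, 45)]),
    ((63, 0), [(0, 49), (35, 29), (97, 24), (137, 30)]),
    ((64, 39), [(46, 38), (53, 44), (71, 45), (82, 36)]),
    ((64, 77), [(41, 84), (51, 77), (67, 89), (68, 65), (79, 82), (80, 62)]),
    ((66, 56), [(60, 64), (62, 51), (68, 65), (71, 45)]),
    ((67, 89), [(57, 101), (64, 77), (72, 100), (79, 82)]),
    ((68, 65), [(60, 64), (64, 77), (66, 56), (80, 62)]),
    ((69, 122), [(51, 135), (53, 115), (80, 111), (92, 118)]),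
    ((71, 45), [(62, 51), (64, 39), (66, 56), (82, 36)]),
    ((72, 100), [(57, 101), (67, 89), (80, 111), (86, 99)]),
    ((79, 82), [(64, 77), (67, 89), (90, 87), (95, 76)]),
    ((80, 62), [(64, 77), (68, 65), (90, 45), (95, 63)]),
    ((80, 111), [(69, 122), (72, 100), (86, 99), (92, 118)]),
    ((82, 36), [(64, 39), (71, 45), (90, 45), (97, 24)]),
    ((85, 158), [(11, 128), (51, 135), (111, 127), (148, 109)]),
    ((86, 99), [(72, 100), (80, 111), (90, 87), (101, 95)]),
    ((90, 45), [(80, 62), (82, 36), (95, 63), (97, 24)]),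
    ((90, 87), [(79, 82), (86, 99), (95, 76), (101, 95)]),
    ((92, 118), [(69, 122), (80, 111), (106, 107), (111, 127)]),
    ((95, 63), [(80, 62), (90, 45), (95, 76), (112, 73)]),
    ((95, 76), [(79, 82), (90, 87), (95, 63), (112, 73)]),
    ((97, 24), [(63, 0), (82, 36), (90, 45), (137, 30)]),
    ((101, 95), [(86, 99), (90, 87), (106, 107), (115, 86)]),
    ((106, 107), [(92, 118), (101, 95), (111, 127), (115, 86)]),
    ((111, 127), [(85, 158), (92, 118), (106, 107), (148, 109)]),
    ((112, 73), [(95, 63), (95, 76), (115, 86), (133, 71)]),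
    ((115, 86), [(101, 95), (106, 107), (112, 73), (133, 71)]),
    ((133, 71), [(112, 73), (115, 86), (137, 30), (148, 109)]),
    ((137, 30), [(63, 0), (97, 24), (133, 71), (148, 109)]),
    ((148, 109), [(85, 158), (111, 127), (133, 71), (137, 30)])])
    (by decide +kernel)

theorem existsQuadFree_four_57 : ExistsQuadFree 4 57 :=
  GridDrawing.existsQuadFree_of_check (D := [
    ((0, 38), [(14, 60), (19, 84), (20, 19), (30, 0)]),
    ((14, 60), [(0, 38), (19, 84), (20, 47), (24, 58)]),
    ((19, 84), [(0, 38), (14, 60), (42, 84), (68, 90)]),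
    ((20, 19), [(0, 38), (23, 33), (30, 0), (30, 22)]),
    ((20, 47), [(14, 60), (23, 33), (24, 58), (27, 40)]),
    ((23, 33), [(20, 19), (20, 47), (27, 40), (30, 22)]),
    ((24, 58), [(14, 60), (20, 47), (32, 54), (34, 63)]),
    ((27, 40), [(20, 47), (23, 33), (33, 44), (35, 35)]),
    ((30, 0), [(0, 38), (20, 19), (56, 6), (79, 6)]),
    ((30, 22), [(20, 19), (23, 33), (38, 26), (44, 17)]),
    ((32, 54), [(24, 58), (33, 44), (34, 63), (39, 50)]),
    ((33, 44), [(27, 40), (32, 54), (35, 35), (39, 50)]),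
    ((34, 63), [(24, 58), (32, 54), (40, 74), (41, 64)]),
    ((35, 35), [(27, 40), (33, 44), (38, 26), (44, 30)]),
    ((38, 26), [(30, 22), (35, 35), (44, 17), (44, 30)]),
    ((39, 50), [(32, 54), (33, 44), (42, 55), (46, 45)]),
    ((40, 74), [(34, 63), (41, 64), (42, 84), (50, 76)]),
    ((41, 64), [(34, 63), (40, 74), (42, 55), (47, 60)]),
    ((42, 55), [(39, 50), (41, 64), (46, 45), (47, 60)]),
    ((42, 84), [(19, 84), (40, 74), (50, 76), (68, 90)]),
    ((44, 17), [(30, 22), (38, 26), (55, 17), (56, 6)]),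
    ((44, 30), [(35, 35), (38, 26), (48, 36), (53, 27)]),
    ((46, 45), [(39, 50), (42, 55), (48, 36), (53, 42)]),
    ((47, 60), [(41, 64), (42, 55), (52, 55), (52, 62)]),
    ((48, 36), [(44, 30), (46, 45), (53, 27), (53, 42)]),
    ((50, 76), [(40, 74), (42, 84), (54, 69), (61, 70)]),
    ((52, 55), [(47, 60), (52, 62), (56, 47), (57, 53)]),
    ((52, 62), [(47, 60), (52, 55), (54, 69), (57, 63)]),
    ((53, 27), [(44, 30), (48, 36), (55, 17), (63, 27)]),
    ((53, 42), [(46, 45), (48, 36), (56, 47), (60, 41)]),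
    ((54, 69), [(50, 76), (52, 62), (57, 63), (61, 70)]),
    ((55, 17), [(44, 17), (53, 27), (56, 6), (63, 27)]),
    ((56, 6), [(30, 0), (44, 17), (55, 17), (79, 6)]),
    ((56, 47), [(52, 55), (53, 42), (57, 53), (60, 41)]),
    ((57, 53), [(52, 55), (56, 47), (60, 56), (63, 50)]),
    ((57, 63), [(52, 62), (54, 69), (60, 56), (63, 60)]),
    ((60, 41), [(53, 42), (56, 47), (65, 43), (67, 35)]),
    ((60, 56), [(57, 53), (57, 63), (63, 50), (63, 60)]),
    ((61, 70), [(50, 76), (54, 69), (67, 63), (72, 66)]),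
    ((63, 27), [(53, 27), (55, 17), (67, 35), (74, 31)]),
    ((63, 50), [(57, 53), (60, 56), (65, 43), (69, 49)]),
    ((63, 60), [(57, 63), (60, 56), (67, 63), (69, 55)]),
    ((65, 43), [(60, 41), (63, 50), (67, 35), (69, 49)]),
    ((67, 35), [(60, 41), (63, 27), (65, 43), (74, 31)]),
    ((67, 63), [(61, 70), (63, 60), (69, 55), (72, 66)]),
    ((68, 90), [(19, 84), (42, 84), (80, 70), (98, 52)]),
    ((69, 49), [(63, 50), (65, 43), (69, 55), (76, 49)]),
    ((69, 55), [(63, 60), (67, 63), (69, 49), (76, 49)]),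
    ((72, 66), [(61, 70), (67, 63), (78, 56), (80, 70)]),
    ((74, 31), [(63, 27), (67, 35), (80, 41), (83, 27)]),
    ((76, 49), [(69, 49), (69, 55), (78, 56), (80, 41)]),
    ((78, 56), [(72, 66), (76, 49), (80, 41), (80, 70)]),
    ((79, 6), [(30, 0), (56, 6), (83, 27), (98, 52)]),
    ((80, 41), [(74, 31), (76, 49), (78, 56), (83, 27)]),
    ((80, 70), [(68, 90), (72, 66), (78, 56), (98, 52)]),
    ((83, 27), [(74, 31), (79, 6), (80, 41), (98, 52)]),
    ((98, 52), [(68, 90), (79, 6), (80, 70), (83, 27)])])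
    (by decide +kernel)

theorem existsQuadFree_four_58 : ExistsQuadFree 4 58 :=
  GridDrawing.existsQuadFree_of_check (D := [
    ((0, 63), [(20, 99), (26, 34), (31, 137), (50, 0)]),
    ((20, 99), [(0, 63), (31, 85), (31, 137), (40, 95)]),
    ((26, 34), [(0, 63), (33, 48), (43, 36), (50, 0)]),
    ((31, 85), [(20, 99), (34, 66), (39, 75), (40, 95)]),
    ((31, 137), [(0, 63), (20, 99), (70, 136), (109, 148)]),
    ((33, 48), [(26, 34), (34, 66), (39, 55), (43, 36)]),
    ((34, 66), [(31, 85), (33, 48), (39, 55), (39, 75)]),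
    ((39, 55), [(33, 48), (34, 66), (46, 57), (48, 49)]),
    ((39, 75), [(31, 85), (34, 66), (46, 66), (51, 71)]),
    ((40, 95), [(20, 99), (31, 85), (56, 87), (59, 101)]),
    ((43, 36), [(26, 34), (33, 48), (52, 39), (61, 33)]),
    ((46, 57), [(39, 55), (46, 66), (48, 49), (53, 58)]),
    ((46, 66), [(39, 75), (46, 57), (51, 71), (53, 58)]),
    ((48, 49), [(39, 55), (46, 57), (52, 39), (56, 45)]),
    ((50, 0), [(0, 63), (26, 34), (88, 13), (128, 11)]),
    ((51, 71), [(39, 75), (46, 66), (60, 74), (62, 64)]),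
    ((52, 39), [(43, 36), (48, 49), (56, 45), (61, 33)]),
    ((53, 58), [(46, 57), (46, 66), (59, 50), (62, 56)]),
    ((56, 45), [(48, 49), (52, 39), (59, 50), (65, 43)]),
    ((56, 87), [(40, 95), (59, 101), (60, 74), (70, 72)]),
    ((59, 50), [(53, 58), (56, 45), (62, 56), (65, 43)]),
    ((59, 101), [(40, 95), (56, 87), (71, 116), (74, 100)]),
    ((60, 74), [(51, 71), (56, 87), (62, 64), (70, 72)]),
    ((61, 33), [(43, 36), (52, 39), (72, 35), (80, 27)]),
    ((62, 56), [(53, 58), (59, 50), (62, 64), (71, 53)]),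
    ((62, 64), [(51, 71), (60, 74), (62, 56), (71, 53)]),
    ((65, 43), [(56, 45), (59, 50), (72, 35), (74, 44)]),
    ((70, 72), [(56, 87), (60, 74), (82, 70), (83, 55)]),
    ((70, 136), [(31, 137), (71, 116), (87, 119), (109, 148)]),
    ((71, 53), [(62, 56), (62, 64), (74, 44), (82, 46)]),
    ((71, 116), [(59, 101), (70, 136), (74, 100), (87, 119)]),
    ((72, 35), [(61, 33), (65, 43), (74, 44), (80, 27)]),
    ((74, 44), [(65, 43), (71, 53), (72, 35), (82, 46)]),
    ((74, 100), [(59, 101), (71, 116), (83, 84), (88, 95)]),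
    ((80, 27), [(61, 33), (72, 35), (88, 13), (93, 37)]),
    ((82, 46), [(71, 53), (74, 44), (83, 55), (93, 37)]),
    ((82, 70), [(70, 72), (83, 55), (83, 84), (92, 70)]),
    ((83, 55), [(70, 72), (82, 46), (82, 70), (93, 37)]),
    ((83, 84), [(74, 100), (82, 70), (88, 95), (92, 70)]),
    ((87, 119), [(70, 136), (71, 116), (96, 105), (109, 110)]),
    ((88, 13), [(50, 0), (80, 27), (93, 37), (128, 11)]),
    ((88, 95), [(74, 100), (83, 84), (96, 105), (100, 88)]),
    ((92, 70), [(82, 70), (83, 84), (100, 55), (102, 72)]),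
    ((93, 37), [(80, 27), (82, 46), (83, 55), (88, 13), (100, 55), (114, 50)]),
    ((96, 105), [(87, 119), (88, 95), (100, 88), (109, 110)]),
    ((100, 55), [(92, 70), (93, 37), (102, 72), (114, 50)]),
    ((100, 88), [(88, 95), (96, 105), (102, 72), (114, 79)]),
    ((102, 72), [(92, 70), (100, 55), (100, 88), (114, 79)]),
    ((109, 110), [(87, 119), (96, 105), (121, 93), (129, 113)]),
    ((109, 148), [(31, 137), (70, 136), (129, 113), (158, 85)]),
    ((114, 50), [(93, 37), (100, 55), (124, 68), (136, 50)]),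
    ((114, 79), [(100, 88), (102, 72), (121, 93), (124, 68)]),
    ((121, 93), [(109, 110), (114, 79), (124, 68), (129, 113)]),
    ((124, 68), [(114, 50), (114, 79), (121, 93), (136, 50)]),
    ((128, 11), [(50, 0), (88, 13), (136, 50), (158, 85)]),
    ((129, 113), [(109, 110), (109, 148), (121, 93), (158, 85)]),
    ((136, 50), [(114, 50), (124, 68), (128, 11), (158, 85)]),
    ((158, 85), [(109, 148), (128, 11), (129, 113), (136, 50)])])
    (by decide +kernel)

theorem existsQuadFree_four_59 : ExistsQuadFree 4 59 :=
  GridDrawing.existsQuadFree_of_check (D := [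
    ((0, 38), [(13, 60), (18, 21), (19, 84), (30, 0)]),
    ((13, 60), [(0, 38), (19, 84), (21, 48), (24, 57)]),
    ((18, 21), [(0, 38), (23, 33), (30, 0), (32, 23)]),
    ((19, 84), [(0, 38), (13, 60), (43, 84), (68, 90)]),
    ((21, 48), [(13, 60), (23, 33), (24, 57), (28, 40)]),
    ((23, 33), [(18, 21), (21, 48), (28, 40), (32, 23)]),
    ((24, 57), [(13, 60), (21, 48), (33, 54), (35, 62)]),
    ((28, 40), [(21, 48), (23, 33), (35, 44), (38, 35)]),
    ((30, 0), [(0, 38), (18, 21), (54, 7), (79, 6)]),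
    ((32, 23), [(18, 21), (23, 33), (40, 26), (46, 18)]),
    ((33, 54), [(24, 57), (35, 44), (35, 62), (40, 49)]),
    ((35, 44), [(28, 40), (33, 54), (38, 35), (40, 49)]),
    ((35, 62), [(24, 57), (33, 54), (42, 72), (44, 62)]),
    ((38, 35), [(28, 40), (35, 44), (40, 26), (47, 31)]),
    ((40, 26), [(32, 23), (38, 35), (46, 18), (47, 31)]),
    ((40, 49), [(33, 54), (35, 44), (46, 54), (48, 45)]),
    ((42, 72), [(35, 62), (43, 84), (44, 62), (50, 75)]),
    ((43, 84), [(19, 84), (42, 72), (50, 75), (68, 90)]),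
    ((44, 62), [(35, 62), (42, 72), (46, 54), (52, 57)]),
    ((46, 18), [(32, 23), (40, 26), (54, 7), (58, 20)]),
    ((46, 54), [(40, 49), (44, 62), (48, 45), (52, 57)]),
    ((47, 31), [(38, 35), (40, 26), (52, 36), (58, 29)]),
    ((48, 45), [(40, 49), (46, 54), (52, 36), (55, 41)]),
    ((50, 75), [(42, 72), (43, 84), (53, 66), (60, 70)]),
    ((52, 36), [(47, 31), (48, 45), (55, 41), (58, 29)]),
    ((52, 57), [(44, 62), (46, 54), (53, 66), (56, 47), (57, 51), (57, 60)]),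
    ((53, 66), [(50, 75), (52, 57), (57, 60), (60, 70)]),
    ((54, 7), [(30, 0), (46, 18), (58, 20), (79, 6)]),
    ((55, 41), [(48, 45), (52, 36), (56, 47), (62, 38)]),
    ((56, 47), [(52, 57), (55, 41), (57, 51), (62, 38)]),
    ((57, 51), [(52, 57), (56, 47), (62, 51), (63, 45)]),
    ((57, 60), [(52, 57), (53, 66), (61, 56), (62, 61)]),
    ((58, 20), [(46, 18), (54, 7), (58, 29), (69, 30)]),
    ((58, 29), [(47, 31), (52, 36), (58, 20), (69, 30)]),
    ((60, 70), [(50, 75), (53, 66), (66, 65), (71, 68)]),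
    ((61, 56), [(57, 60), (62, 51), (62, 61), (66, 52)]),
    ((62, 38), [(55, 41), (56, 47), (67, 38), (69, 30)]),
    ((62, 51), [(57, 51), (61, 56), (63, 45), (66, 52)]),
    ((62, 61), [(57, 60), (61, 56), (66, 65), (68, 59)]),
    ((63, 45), [(57, 51), (62, 51), (67, 38), (68, 43)]),
    ((66, 52), [(61, 56), (62, 51), (69, 53), (70, 48)]),
    ((66, 65), [(60, 70), (62, 61), (68, 59), (71, 68)]),
    ((67, 38), [(62, 38), (63, 45), (68, 43), (69, 30)]),
    ((68, 43), [(63, 45), (67, 38), (70, 48), (74, 43)]),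
    ((68, 59), [(62, 61), (66, 65), (69, 53), (74, 56)]),
    ((68, 90), [(19, 84), (43, 84), (81, 70), (98, 52)]),
    ((69, 30), [(58, 20), (58, 29), (62, 38), (67, 38), (77, 37), (84, 30)]),
    ((69, 53), [(66, 52), (68, 59), (70, 48), (74, 56)]),
    ((70, 48), [(66, 52), (68, 43), (69, 53), (74, 43)]),
    ((71, 68), [(60, 70), (66, 65), (77, 61), (81, 70)]),
    ((74, 43), [(68, 43), (70, 48), (76, 49), (77, 37)]),
    ((74, 56), [(68, 59), (69, 53), (76, 49), (77, 61)]),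
    ((76, 49), [(74, 43), (74, 56), (77, 37), (77, 61)]),
    ((77, 37), [(69, 30), (74, 43), (76, 49), (84, 30)]),
    ((77, 61), [(71, 68), (74, 56), (76, 49), (81, 70)]),
    ((79, 6), [(30, 0), (54, 7), (84, 30), (98, 52)]),
    ((81, 70), [(68, 90), (71, 68), (77, 61), (98, 52)]),
    ((84, 30), [(69, 30), (77, 37), (79, 6), (98, 52)]),
    ((98, 52), [(68, 90), (79, 6), (81, 70), (84, 30)])])
    (by decide +kernel)

/-- Order 60 needs no table: two graphs of order 30 side by side provide it. -/
theorem existsQuadFree_four_61 : ExistsQuadFree 4 61 :=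
  GridDrawing.existsQuadFree_of_check (D := [
    ((0, 49), [(10, 88), (11, 128), (33, 26), (63, 0)]),
    ((10, 88), [(0, 49), (11, 128), (25, 81), (32, 98)]),
    ((11, 128), [(0, 49), (10, 88), (50, 138), (85, 158)]),
    ((25, 81), [(10, 88), (32, 63), (32, 98), (36, 77)]),
    ((32, 63), [(25, 81), (35, 43), (36, 77), (39, 53)]),
    ((32, 98), [(10, 88), (25, 81), (48, 116), (52, 99)]),
    ((33, 26), [(0, 49), (35, 43), (48, 32), (63, 0)]),
    ((35, 43), [(32, 63), (33, 26), (39, 53), (48, 32)]),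
    ((36, 77), [(25, 81), (32, 63), (46, 75), (47, 86)]),
    ((39, 53), [(32, 63), (35, 43), (48, 56), (50, 47)]),
    ((46, 75), [(36, 77), (47, 86), (50, 65), (56, 71)]),
    ((47, 86), [(36, 77), (46, 75), (52, 99), (59, 86)]),
    ((48, 32), [(33, 26), (35, 43), (56, 37), (67, 31)]),
    ((48, 56), [(39, 53), (50, 47), (50, 65), (56, 57)]),
    ((48, 116), [(32, 98), (50, 138), (52, 99), (68, 125)]),
    ((50, 47), [(39, 53), (48, 56), (56, 37), (60, 43)]),
    ((50, 65), [(46, 75), (48, 56), (56, 57), (56, 71)]),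
    ((50, 138), [(11, 128), (48, 116), (68, 125), (85, 158)]),
    ((52, 99), [(32, 98), (47, 86), (48, 116), (59, 86), (70, 91), (71, 102)]),
    ((56, 37), [(48, 32), (50, 47), (60, 43), (67, 31)]),
    ((56, 57), [(48, 56), (50, 65), (63, 50), (64, 57)]),
    ((56, 71), [(46, 75), (50, 65), (62, 75), (64, 65)]),
    ((59, 86), [(47, 86), (52, 99), (62, 75), (71, 76)]),
    ((60, 43), [(50, 47), (56, 37), (63, 50), (69, 43)]),
    ((62, 75), [(56, 71), (59, 86), (64, 65), (71, 76)]),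
    ((63, 0), [(0, 49), (33, 26), (99, 18), (137, 30)]),
    ((63, 50), [(56, 57), (60, 43), (64, 57), (69, 43)]),
    ((64, 57), [(56, 57), (63, 50), (64, 65), (72, 56)]),
    ((64, 65), [(56, 71), (62, 75), (64, 57), (72, 56)]),
    ((67, 31), [(48, 32), (56, 37), (77, 35), (86, 28)]),
    ((68, 125), [(48, 116), (50, 138), (80, 114), (93, 122)]),
    ((69, 43), [(60, 43), (63, 50), (76, 46), (77, 35)]),
    ((70, 91), [(52, 99), (71, 102), (78, 78), (87, 82)]),
    ((71, 76), [(59, 86), (62, 75), (78, 78), (82, 65)]),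
    ((71, 102), [(52, 99), (70, 91), (80, 114), (89, 100)]),
    ((72, 56), [(64, 57), (64, 65), (76, 46), (82, 55)]),
    ((76, 46), [(69, 43), (72, 56), (77, 35), (82, 55)]),
    ((77, 35), [(67, 31), (69, 43), (76, 46), (86, 28)]),
    ((78, 78), [(70, 91), (71, 76), (82, 65), (87, 82)]),
    ((80, 114), [(68, 125), (71, 102), (89, 100), (93, 122)]),
    ((82, 55), [(72, 56), (76, 46), (82, 65), (93, 52)]),
    ((82, 65), [(71, 76), (78, 78), (82, 55), (93, 52)]),
    ((85, 158), [(11, 128), (50, 138), (114, 130), (148, 109)]),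
    ((86, 28), [(67, 31), (77, 35), (98, 37), (99, 18)]),
    ((87, 82), [(70, 91), (78, 78), (97, 87), (103, 73)]),
    ((89, 100), [(71, 102), (80, 114), (97, 87), (107, 96)]),
    ((93, 52), [(82, 55), (82, 65), (98, 37), (105, 56)]),
    ((93, 122), [(68, 125), (80, 114), (111, 109), (114, 130)]),
    ((97, 87), [(87, 82), (89, 100), (103, 73), (107, 96)]),
    ((98, 37), [(86, 28), (93, 52), (99, 18), (105, 56)]),
    ((99, 18), [(63, 0), (86, 28), (98, 37), (137, 30)]),
    ((103, 73), [(87, 82), (97, 87), (105, 56), (120, 69)]),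
    ((105, 56), [(93, 52), (98, 37), (103, 73), (120, 69)]),
    ((107, 96), [(89, 100), (97, 87), (111, 109), (122, 87)]),
    ((111, 109), [(93, 122), (107, 96), (114, 130), (122, 87)]),
    ((114, 130), [(85, 158), (93, 122), (111, 109), (148, 109)]),
    ((120, 69), [(103, 73), (105, 56), (122, 87), (138, 70)]),
    ((122, 87), [(107, 96), (111, 109), (120, 69), (138, 70)]),
    ((137, 30), [(63, 0), (99, 18), (138, 70), (148, 109)]),
    ((138, 70), [(120, 69), (122, 87), (137, 30), (148, 109)]),
    ((148, 109), [(85, 158), (114, 130), (137, 30), (138, 70)])])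
    (by decide +kernel)

theorem existsQuadFree_four_62 : ExistsQuadFree 4 62 :=
  GridDrawing.existsQuadFree_of_check (D := [
    ((0, 49), [(11, 127), (15, 87), (35, 29), (63, 0)]),
    ((11, 127), [(0, 49), (15, 87), (52, 135), (85, 158)]),
    ((15, 87), [(0, 49), (11, 127), (29, 78), (37, 89)]),
    ((29, 78), [(15, 87), (37, 63), (37, 89), (41, 71)]),
    ((35, 29), [(0, 49), (40, 44), (50, 37), (63, 0)]),
    ((37, 63), [(29, 78), (40, 44), (41, 71), (44, 53)]),
    ((37, 89), [(15, 87), (29, 78), (52, 99), (56, 85)]),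
    ((40, 44), [(35, 29), (37, 63), (44, 53), (50, 37)]),
    ((41, 71), [(29, 78), (37, 63), (50, 67), (52, 75)]),
    ((44, 53), [(37, 63), (40, 44), (51, 58), (53, 50)]),
    ((50, 37), [(35, 29), (40, 44), (58, 42), (68, 38)]),
    ((50, 67), [(41, 71), (51, 58), (52, 75), (57, 60)]),
    ((51, 58), [(44, 53), (50, 67), (53, 50), (57, 60)]),
    ((52, 75), [(41, 71), (50, 67), (56, 85), (62, 75)]),
    ((52, 99), [(37, 89), (56, 85), (57, 117), (64, 105)]),
    ((52, 135), [(11, 127), (57, 117), (71, 123), (85, 158)]),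
    ((53, 50), [(44, 53), (51, 58), (58, 42), (61, 49)]),
    ((56, 85), [(37, 89), (52, 75), (52, 99), (62, 75), (69, 88), (74, 80)]),
    ((57, 60), [(50, 67), (51, 58), (63, 55), (66, 61)]),
    ((57, 117), [(52, 99), (52, 135), (64, 105), (71, 123)]),
    ((58, 42), [(50, 37), (53, 50), (61, 49), (68, 38)]),
    ((61, 49), [(53, 50), (58, 42), (63, 55), (70, 49)]),
    ((62, 75), [(52, 75), (56, 85), (68, 67), (74, 70)]),
    ((63, 0), [(0, 49), (35, 29), (98, 23), (137, 30)]),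
    ((63, 55), [(57, 60), (61, 49), (66, 61), (70, 49)]),
    ((64, 105), [(52, 99), (57, 117), (73, 97), (77, 105)]),
    ((66, 61), [(57, 60), (63, 55), (68, 67), (74, 60)]),
    ((68, 38), [(50, 37), (58, 42), (77, 42), (86, 35)]),
    ((68, 67), [(62, 75), (66, 61), (74, 60), (74, 70)]),
    ((69, 88), [(56, 85), (73, 97), (74, 80), (83, 88)]),
    ((70, 49), [(61, 49), (63, 55), (77, 42), (78, 52)]),
    ((71, 123), [(52, 135), (57, 117), (82, 113), (93, 120)]),
    ((73, 97), [(64, 105), (69, 88), (77, 105), (83, 88)]),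
    ((74, 60), [(66, 61), (68, 67), (78, 52), (84, 58)]),
    ((74, 70), [(62, 75), (68, 67), (81, 73), (84, 65)]),
    ((74, 80), [(56, 85), (69, 88), (81, 73), (90, 74)]),
    ((77, 42), [(68, 38), (70, 49), (78, 52), (86, 35)]),
    ((77, 105), [(64, 105), (73, 97), (82, 113), (89, 102)]),
    ((78, 52), [(70, 49), (74, 60), (77, 42), (84, 58)]),
    ((81, 73), [(74, 70), (74, 80), (84, 65), (90, 74)]),
    ((82, 113), [(71, 123), (77, 105), (89, 102), (93, 120)]),
    ((83, 88), [(69, 88), (73, 97), (93, 91), (95, 79)]),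
    ((84, 58), [(74, 60), (78, 52), (84, 65), (95, 59)]),
    ((84, 65), [(74, 70), (81, 73), (84, 58), (95, 59)]),
    ((85, 158), [(11, 127), (52, 135), (112, 127), (148, 109)]),
    ((86, 35), [(68, 38), (77, 42), (98, 23), (98, 46)]),
    ((89, 102), [(77, 105), (82, 113), (93, 91), (102, 96)]),
    ((90, 74), [(74, 80), (81, 73), (95, 79), (107, 68)]),
    ((93, 91), [(83, 88), (89, 102), (95, 79), (102, 96)]),
    ((93, 120), [(71, 123), (82, 113), (107, 107), (112, 127)]),
    ((95, 59), [(84, 58), (84, 65), (98, 46), (107, 68)]),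
    ((95, 79), [(83, 88), (90, 74), (93, 91), (107, 68)]),
    ((98, 23), [(63, 0), (86, 35), (98, 46), (137, 30)]),
    ((98, 46), [(86, 35), (95, 59), (98, 23), (107, 68)]),
    ((102, 96), [(89, 102), (93, 91), (107, 107), (114, 85)]),
    ((107, 68), [(90, 74), (95, 59), (95, 79), (98, 46), (114, 85), (131, 71)]),
    ((107, 107), [(93, 120), (102, 96), (112, 127), (114, 85)]),
    ((112, 127), [(85, 158), (93, 120), (107, 107), (148, 109)]),
    ((114, 85), [(102, 96), (107, 68), (107, 107), (131, 71)]),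
    ((131, 71), [(107, 68), (114, 85), (137, 30), (148, 109)]),
    ((137, 30), [(63, 0), (98, 23), (131, 71), (148, 109)]),
    ((148, 109), [(85, 158), (112, 127), (131, 71), (137, 30)])])
    (by decide +kernel)

theorem existsQuadFree_four_63 : ExistsQuadFree 4 63 :=
  GridDrawing.existsQuadFree_of_check (D := [
    ((0, 60), [(14, 158), (23, 109), (48, 40), (79, 0)]),
    ((14, 158), [(0, 60), (23, 109), (67, 163), (107, 197)]),
    ((23, 109), [(0, 60), (14, 158), (46, 100), (51, 118)]),
    ((46, 100), [(23, 109), (51, 118), (56, 81), (61, 94)]),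
    ((48, 40), [(0, 60), (57, 60), (66, 52), (79, 0)]),
    ((51, 118), [(23, 109), (46, 100), (67, 138), (71, 122)]),
    ((56, 81), [(46, 100), (57, 60), (61, 94), (64, 70)]),
    ((57, 60), [(48, 40), (56, 81), (64, 70), (66, 52)]),
    ((61, 94), [(46, 100), (56, 81), (70, 90), (74, 99)]),
    ((64, 70), [(56, 81), (57, 60), (70, 74), (71, 67)]),
    ((66, 52), [(48, 40), (57, 60), (75, 59), (88, 56)]),
    ((67, 138), [(51, 118), (67, 163), (71, 122), (86, 144)]),
    ((67, 163), [(14, 158), (67, 138), (86, 144), (107, 197)]),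
    ((70, 74), [(64, 70), (71, 67), (73, 82), (75, 75)]),
    ((70, 90), [(61, 94), (73, 82), (74, 99), (77, 86)]),
    ((71, 67), [(64, 70), (70, 74), (75, 59), (78, 67)]),
    ((71, 122), [(51, 118), (67, 138), (79, 111), (87, 119)]),
    ((73, 82), [(70, 74), (70, 90), (75, 75), (77, 86)]),
    ((74, 99), [(61, 94), (70, 90), (79, 111), (86, 100)]),
    ((75, 59), [(66, 52), (71, 67), (78, 67), (88, 56)]),
    ((75, 75), [(70, 74), (73, 82), (80, 72), (81, 78)]),
    ((77, 86), [(70, 90), (73, 82), (83, 82), (86, 86)]),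
    ((78, 67), [(71, 67), (75, 59), (80, 72), (86, 70)]),
    ((79, 0), [(0, 60), (48, 40), (121, 33), (172, 37)]),
    ((79, 111), [(71, 122), (74, 99), (86, 100), (87, 119)]),
    ((80, 72), [(75, 75), (78, 67), (81, 78), (86, 70)]),
    ((81, 78), [(75, 75), (80, 72), (83, 82), (86, 77)]),
    ((83, 82), [(77, 86), (81, 78), (86, 77), (86, 86)]),
    ((86, 70), [(78, 67), (80, 72), (89, 73), (94, 69)]),
    ((86, 77), [(81, 78), (83, 82), (89, 73), (91, 78)]),
    ((86, 86), [(77, 86), (83, 82), (91, 92), (92, 84)]),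
    ((86, 100), [(74, 99), (79, 111), (91, 92), (100, 96)]),
    ((86, 144), [(67, 138), (67, 163), (97, 131), (112, 140)]),
    ((87, 119), [(71, 122), (79, 111), (97, 131), (103, 117)]),
    ((88, 56), [(66, 52), (75, 59), (97, 60), (107, 50)]),
    ((89, 73), [(86, 70), (86, 77), (91, 78), (94, 69)]),
    ((91, 78), [(86, 77), (89, 73), (92, 84), (98, 79)]),
    ((91, 92), [(86, 86), (86, 100), (92, 84), (100, 96)]),
    ((92, 84), [(86, 86), (91, 78), (91, 92), (98, 79)]),
    ((94, 69), [(86, 70), (89, 73), (97, 60), (99, 71)]),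
    ((97, 60), [(88, 56), (94, 69), (99, 71), (107, 50)]),
    ((97, 131), [(86, 144), (87, 119), (103, 117), (112, 140)]),
    ((98, 79), [(91, 78), (92, 84), (99, 71), (107, 79)]),
    ((99, 71), [(94, 69), (97, 60), (98, 79), (107, 79)]),
    ((100, 96), [(86, 100), (91, 92), (108, 104), (109, 89)]),
    ((103, 117), [(87, 119), (97, 131), (108, 104), (120, 113)]),
    ((107, 50), [(88, 56), (97, 60), (121, 33), (122, 60)]),
    ((107, 79), [(98, 79), (99, 71), (109, 89), (120, 77)]),
    ((107, 197), [(14, 158), (67, 163), (136, 153), (186, 136)]),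
    ((108, 104), [(100, 96), (103, 117), (109, 89), (120, 113)]),
    ((109, 89), [(100, 96), (107, 79), (108, 104), (120, 77)]),
    ((112, 140), [(86, 144), (97, 131), (128, 127), (136, 153)]),
    ((120, 77), [(107, 79), (109, 89), (122, 60), (137, 82)]),
    ((120, 113), [(103, 117), (108, 104), (128, 127), (138, 103)]),
    ((121, 33), [(79, 0), (107, 50), (122, 60), (172, 37)]),
    ((122, 60), [(107, 50), (120, 77), (121, 33), (137, 82)]),
    ((128, 127), [(112, 140), (120, 113), (136, 153), (138, 103)]),
    ((136, 153), [(107, 197), (112, 140), (128, 127), (186, 136)]),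
    ((137, 82), [(120, 77), (122, 60), (138, 103), (162, 89)]),
    ((138, 103), [(120, 113), (128, 127), (137, 82), (162, 89)]),
    ((162, 89), [(137, 82), (138, 103), (172, 37), (186, 136)]),
    ((172, 37), [(79, 0), (121, 33), (162, 89), (186, 136)]),
    ((186, 136), [(107, 197), (136, 153), (162, 89), (172, 37)])])
    (by decide +kernel)

theorem existsQuadFree_four_64 : ExistsQuadFree 4 64 :=
  GridDrawing.existsQuadFree_of_check (D := [
    ((0, 61), [(14, 160), (17, 108), (46, 36), (79, 0)]),
    ((14, 160), [(0, 61), (17, 108), (61, 171), (107, 198)]),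
    ((17, 108), [(0, 61), (14, 160), (39, 92), (40, 119)]),
    ((39, 92), [(17, 108), (40, 119), (50, 62), (57, 81)]),
    ((40, 119), [(17, 108), (39, 92), (56, 145), (60, 126)]),
    ((46, 36), [(0, 61), (50, 62), (70, 54), (79, 0)]),
    ((50, 62), [(39, 92), (46, 36), (57, 81), (70, 54)]),
    ((56, 145), [(40, 119), (60, 126), (61, 171), (77, 157)]),
    ((57, 81), [(39, 92), (50, 62), (71, 94), (77, 79)]),
    ((60, 126), [(40, 119), (56, 145), (71, 112), (79, 127)]),
    ((61, 171), [(14, 160), (56, 145), (77, 157), (107, 198)]),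
    ((70, 54), [(46, 36), (50, 62), (87, 64), (102, 52)]),
    ((71, 94), [(57, 81), (71, 112), (77, 79), (84, 102)]),
    ((71, 112), [(60, 126), (71, 94), (79, 127), (84, 102)]),
    ((77, 79), [(57, 81), (71, 94), (87, 64), (97, 76)]),
    ((77, 157), [(56, 145), (61, 171), (86, 146), (98, 155)]),
    ((79, 0), [(0, 61), (46, 36), (118, 30), (172, 38)]),
    ((79, 127), [(60, 126), (71, 112), (86, 146), (87, 137), (89, 126), (91, 117)]),
    ((84, 102), [(71, 94), (71, 112), (94, 106), (101, 97)]),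
    ((86, 146), [(77, 157), (79, 127), (87, 137), (98, 155)]),
    ((87, 64), [(70, 54), (77, 79), (97, 76), (102, 52)]),
    ((87, 137), [(79, 127), (86, 146), (97, 136), (102, 143)]),
    ((89, 126), [(79, 127), (91, 117), (96, 129), (98, 124)]),
    ((91, 117), [(79, 127), (89, 126), (94, 106), (101, 113)]),
    ((94, 106), [(84, 102), (91, 117), (101, 97), (101, 113)]),
    ((96, 129), [(89, 126), (97, 136), (98, 124), (104, 132)]),
    ((97, 76), [(77, 79), (87, 64), (108, 85), (123, 76)]),
    ((97, 136), [(87, 137), (96, 129), (102, 143), (104, 132)]),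
    ((98, 124), [(89, 126), (96, 129), (105, 118), (107, 124)]),
    ((98, 155), [(77, 157), (86, 146), (111, 152), (123, 157)]),
    ((101, 97), [(84, 102), (94, 106), (108, 85), (118, 98)]),
    ((101, 113), [(91, 117), (94, 106), (105, 118), (112, 114)]),
    ((102, 52), [(70, 54), (87, 64), (118, 30), (125, 60)]),
    ((102, 143), [(87, 137), (97, 136), (111, 152), (113, 141)]),
    ((104, 132), [(96, 129), (97, 136), (109, 129), (112, 134)]),
    ((105, 118), [(98, 124), (101, 113), (107, 124), (112, 114)]),
    ((107, 124), [(98, 124), (105, 118), (109, 129), (116, 125)]),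
    ((107, 198), [(14, 160), (61, 171), (143, 164), (186, 137)]),
    ((108, 85), [(97, 76), (101, 97), (118, 98), (123, 76)]),
    ((109, 129), [(104, 132), (107, 124), (112, 134), (116, 125)]),
    ((111, 152), [(98, 155), (102, 143), (113, 141), (123, 157)]),
    ((112, 114), [(101, 113), (105, 118), (119, 118), (123, 109)]),
    ((112, 134), [(104, 132), (109, 129), (113, 141), (121, 134)]),
    ((113, 141), [(102, 143), (111, 152), (112, 134), (121, 134)]),
    ((116, 125), [(107, 124), (109, 129), (119, 118), (123, 128)]),
    ((118, 30), [(79, 0), (102, 52), (125, 60), (172, 38)]),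
    ((118, 98), [(101, 97), (108, 85), (123, 109), (135, 105)]),
    ((119, 118), [(112, 114), (116, 125), (123, 109), (123, 128)]),
    ((121, 134), [(112, 134), (113, 141), (123, 128), (132, 132)]),
    ((123, 76), [(97, 76), (108, 85), (125, 60), (144, 80)]),
    ((123, 109), [(112, 114), (118, 98), (119, 118), (135, 105)]),
    ((123, 128), [(116, 125), (119, 118), (121, 134), (132, 132)]),
    ((123, 157), [(98, 155), (111, 152), (138, 145), (143, 164)]),
    ((125, 60), [(102, 52), (118, 30), (123, 76), (144, 80)]),
    ((132, 132), [(121, 134), (123, 128), (138, 145), (140, 121)]),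
    ((135, 105), [(118, 98), (123, 109), (140, 121), (151, 97)]),
    ((138, 145), [(123, 157), (132, 132), (140, 121), (143, 164)]),
    ((140, 121), [(132, 132), (135, 105), (138, 145), (151, 97)]),
    ((143, 164), [(107, 198), (123, 157), (138, 145), (186, 137)]),
    ((144, 80), [(123, 76), (125, 60), (151, 97), (170, 93)]),
    ((151, 97), [(135, 105), (140, 121), (144, 80), (170, 93)]),
    ((170, 93), [(144, 80), (151, 97), (172, 38), (186, 137)]),
    ((172, 38), [(79, 0), (118, 30), (170, 93), (186, 137)]),
    ((186, 137), [(107, 198), (143, 164), (170, 93), (172, 38)])])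
    (by decide +kernel)

theorem existsQuadFree_four_65 : ExistsQuadFree 4 65 :=
  GridDrawing.existsQuadFree_of_check (D := [
    ((0, 78), [(24, 118), (34, 46), (37, 172), (61, 0)]),
    ((24, 118), [(0, 78), (37, 172), (39, 99), (49, 118)]),
    ((34, 46), [(0, 78), (45, 68), (59, 50), (61, 0)]),
    ((37, 172), [(0, 78), (24, 118), (88, 172), (136, 186)]),
    ((39, 99), [(24, 118), (45, 68), (49, 118), (52, 85)]),
    ((45, 68), [(34, 46), (39, 99), (52, 85), (59, 50)]),
    ((49, 118), [(24, 118), (39, 99), (62, 110), (68, 131)]),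
    ((52, 85), [(39, 99), (45, 68), (65, 92), (72, 76)]),
    ((59, 50), [(34, 46), (45, 68), (77, 54), (88, 36)]),
    ((61, 0), [(0, 78), (34, 46), (109, 14), (159, 15)]),
    ((62, 110), [(49, 118), (65, 92), (68, 131), (77, 103)]),
    ((65, 92), [(52, 85), (62, 110), (72, 76), (77, 103)]),
    ((68, 131), [(49, 118), (62, 110), (84, 149), (87, 131)]),
    ((72, 76), [(52, 85), (65, 92), (77, 54), (87, 66)]),
    ((77, 54), [(59, 50), (72, 76), (87, 66), (88, 36)]),
    ((77, 103), [(62, 110), (65, 92), (88, 113), (92, 94)]),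
    ((84, 149), [(68, 131), (87, 131), (88, 172), (104, 153)]),
    ((87, 66), [(72, 76), (77, 54), (96, 77), (106, 61)]),
    ((87, 131), [(68, 131), (84, 149), (88, 113), (102, 120)]),
    ((88, 36), [(59, 50), (77, 54), (109, 14), (109, 39)]),
    ((88, 113), [(77, 103), (87, 131), (92, 94), (102, 120)]),
    ((88, 172), [(37, 172), (84, 149), (104, 153), (136, 186)]),
    ((92, 94), [(77, 103), (88, 113), (96, 77), (104, 90)]),
    ((96, 77), [(87, 66), (92, 94), (104, 90), (106, 61)]),
    ((102, 120), [(87, 131), (88, 113), (108, 101), (113, 111), (113, 137), (115, 126)]),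
    ((104, 90), [(92, 94), (96, 77), (108, 101), (119, 89)]),
    ((104, 153), [(84, 149), (88, 172), (113, 137), (132, 141)]),
    ((106, 61), [(87, 66), (96, 77), (109, 39), (127, 60)]),
    ((108, 101), [(102, 120), (104, 90), (113, 111), (119, 89)]),
    ((109, 14), [(61, 0), (88, 36), (109, 39), (159, 15)]),
    ((109, 39), [(88, 36), (106, 61), (109, 14), (127, 60)]),
    ((113, 111), [(102, 120), (108, 101), (121, 113), (125, 107)]),
    ((113, 137), [(102, 120), (104, 153), (115, 126), (132, 141)]),
    ((115, 126), [(102, 120), (113, 137), (124, 122), (131, 128)]),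
    ((119, 89), [(104, 90), (108, 101), (130, 87), (133, 74)]),
    ((121, 113), [(113, 111), (124, 122), (125, 107), (130, 118)]),
    ((124, 122), [(115, 126), (121, 113), (130, 118), (131, 128)]),
    ((125, 107), [(113, 111), (121, 113), (132, 98), (134, 107)]),
    ((127, 60), [(106, 61), (109, 39), (133, 74), (150, 67)]),
    ((130, 87), [(119, 89), (132, 98), (133, 74), (142, 96)]),
    ((130, 118), [(121, 113), (124, 122), (137, 114), (139, 120)]),
    ((131, 128), [(115, 126), (124, 122), (139, 127), (143, 135)]),
    ((132, 98), [(125, 107), (130, 87), (134, 107), (142, 96)]),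
    ((132, 141), [(104, 153), (113, 137), (143, 135), (161, 137)]),
    ((133, 74), [(119, 89), (127, 60), (130, 87), (150, 67)]),
    ((134, 107), [(125, 107), (132, 98), (137, 114), (143, 111)]),
    ((136, 186), [(37, 172), (88, 172), (161, 137), (197, 107)]),
    ((137, 114), [(130, 118), (134, 107), (139, 120), (143, 111)]),
    ((139, 120), [(130, 118), (137, 114), (139, 127), (147, 122)]),
    ((139, 127), [(131, 128), (139, 120), (143, 135), (147, 122)]),
    ((142, 96), [(130, 87), (132, 98), (148, 104), (154, 95)]),
    ((143, 111), [(134, 107), (137, 114), (148, 104), (149, 115)]),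
    ((143, 135), [(131, 128), (132, 141), (139, 127), (161, 137)]),
    ((147, 122), [(139, 120), (139, 127), (149, 115), (156, 124)]),
    ((148, 104), [(142, 96), (143, 111), (149, 115), (154, 95)]),
    ((149, 115), [(143, 111), (147, 122), (148, 104), (156, 124)]),
    ((150, 67), [(127, 60), (133, 74), (162, 82), (172, 61)]),
    ((154, 95), [(142, 96), (148, 104), (160, 110), (162, 82)]),
    ((156, 124), [(147, 122), (149, 115), (160, 110), (161, 137)]),
    ((159, 15), [(61, 0), (109, 14), (172, 61), (197, 107)]),
    ((160, 110), [(154, 95), (156, 124), (161, 137), (162, 82)]),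
    ((161, 137), [(132, 141), (136, 186), (143, 135), (156, 124), (160, 110), (197, 107)]),
    ((162, 82), [(150, 67), (154, 95), (160, 110), (172, 61)]),
    ((172, 61), [(150, 67), (159, 15), (162, 82), (197, 107)]),
    ((197, 107), [(136, 186), (159, 15), (161, 137), (172, 61)])])
    (by decide +kernel)

/-- Order 66 is the sum 30 + 36. -/
theorem existsQuadFree_four_67 : ExistsQuadFree 4 67 :=
  GridDrawing.existsQuadFree_of_check (D := [
    ((0, 36), [(9, 96), (11, 65), (27, 21), (48, 0)]),
    ((9, 96), [(0, 36), (11, 65), (39, 102), (64, 118)]),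
    ((11, 65), [(0, 36), (9, 96), (22, 58), (26, 67)]),
    ((22, 58), [(11, 65), (26, 67), (27, 46), (30, 53)]),
    ((26, 67), [(11, 65), (22, 58), (37, 76), (38, 67)]),
    ((27, 21), [(0, 36), (30, 33), (37, 26), (48, 0)]),
    ((27, 46), [(22, 58), (30, 33), (30, 53), (32, 40)]),
    ((30, 33), [(27, 21), (27, 46), (32, 40), (37, 26)]),
    ((30, 53), [(22, 58), (27, 46), (36, 49), (38, 56)]),
    ((32, 40), [(27, 46), (30, 33), (36, 44), (38, 39)]),
    ((36, 44), [(32, 40), (36, 49), (38, 39), (41, 46)]),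
    ((36, 49), [(30, 53), (36, 44), (38, 56), (41, 46)]),
    ((37, 26), [(27, 21), (30, 33), (44, 30), (50, 27)]),
    ((37, 76), [(26, 67), (38, 67), (43, 88), (49, 77)]),
    ((38, 39), [(32, 40), (36, 44), (42, 39), (43, 35)]),
    ((38, 56), [(30, 53), (36, 49), (43, 61), (47, 56)]),
    ((38, 67), [(26, 67), (37, 76), (43, 61), (49, 64)]),
    ((39, 102), [(9, 96), (43, 88), (53, 93), (64, 118)]),
    ((41, 46), [(36, 44), (36, 49), (44, 44), (47, 47)]),
    ((42, 39), [(38, 39), (43, 35), (44, 44), (47, 40)]),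
    ((43, 35), [(38, 39), (42, 39), (44, 30), (48, 34)]),
    ((43, 61), [(38, 56), (38, 67), (47, 56), (49, 64)]),
    ((43, 88), [(37, 76), (39, 102), (49, 77), (53, 93)]),
    ((44, 30), [(37, 26), (43, 35), (48, 34), (50, 27)]),
    ((44, 44), [(41, 46), (42, 39), (47, 40), (47, 47)]),
    ((47, 40), [(42, 39), (44, 44), (50, 37), (51, 41)]),
    ((47, 47), [(41, 46), (44, 44), (49, 51), (51, 45)]),
    ((47, 56), [(38, 56), (43, 61), (49, 51), (56, 55)]),
    ((48, 0), [(0, 36), (27, 21), (74, 16), (103, 22)]),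
    ((48, 34), [(43, 35), (44, 30), (50, 37), (54, 34)]),
    ((49, 51), [(47, 47), (47, 56), (51, 45), (56, 55)]),
    ((49, 64), [(38, 67), (43, 61), (54, 69), (61, 60)]),
    ((49, 77), [(37, 76), (43, 88), (54, 69), (59, 76)]),
    ((50, 27), [(37, 26), (44, 30), (58, 29), (64, 24)]),
    ((50, 37), [(47, 40), (48, 34), (51, 41), (54, 34)]),
    ((51, 41), [(47, 40), (50, 37), (51, 45), (56, 42)]),
    ((51, 45), [(47, 47), (49, 51), (51, 41), (56, 42)]),
    ((53, 93), [(39, 102), (43, 88), (62, 84), (70, 89)]),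
    ((54, 34), [(48, 34), (50, 37), (58, 29), (58, 38)]),
    ((54, 69), [(49, 64), (49, 77), (59, 76), (61, 60)]),
    ((56, 42), [(51, 41), (51, 45), (58, 38), (61, 42)]),
    ((56, 55), [(47, 56), (49, 51), (61, 60), (62, 50)]),
    ((58, 29), [(50, 27), (54, 34), (58, 38), (64, 24)]),
    ((58, 38), [(54, 34), (56, 42), (58, 29), (61, 42)]),
    ((59, 76), [(49, 77), (54, 69), (62, 84), (66, 75)]),
    ((61, 42), [(56, 42), (58, 38), (62, 50), (68, 41)]),
    ((61, 60), [(49, 64), (54, 69), (56, 55), (62, 50), (70, 65), (74, 56)]),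
    ((62, 50), [(56, 55), (61, 42), (61, 60), (68, 41)]),
    ((62, 84), [(53, 93), (59, 76), (66, 75), (70, 89)]),
    ((64, 24), [(50, 27), (58, 29), (72, 31), (74, 16)]),
    ((64, 118), [(9, 96), (39, 102), (84, 95), (112, 82)]),
    ((66, 75), [(59, 76), (62, 84), (70, 65), (77, 71)]),
    ((68, 41), [(61, 42), (62, 50), (72, 31), (76, 44)]),
    ((70, 65), [(61, 60), (66, 75), (74, 56), (77, 71)]),
    ((70, 89), [(53, 93), (62, 84), (80, 81), (84, 95)]),
    ((72, 31), [(64, 24), (68, 41), (74, 16), (76, 44)]),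
    ((74, 16), [(48, 0), (64, 24), (72, 31), (103, 22)]),
    ((74, 56), [(61, 60), (70, 65), (76, 44), (85, 55)]),
    ((76, 44), [(68, 41), (72, 31), (74, 56), (85, 55)]),
    ((77, 71), [(66, 75), (70, 65), (80, 81), (89, 65)]),
    ((80, 81), [(70, 89), (77, 71), (84, 95), (89, 65)]),
    ((84, 95), [(64, 118), (70, 89), (80, 81), (112, 82)]),
    ((85, 55), [(74, 56), (76, 44), (89, 65), (100, 53)]),
    ((89, 65), [(77, 71), (80, 81), (85, 55), (100, 53)]),
    ((100, 53), [(85, 55), (89, 65), (103, 22), (112, 82)]),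
    ((103, 22), [(48, 0), (74, 16), (100, 53), (112, 82)]),
    ((112, 82), [(64, 118), (84, 95), (100, 53), (103, 22)])])
    (by decide +kernel)

theorem existsQuadFree_four_68 : ExistsQuadFree 4 68 :=
  GridDrawing.existsQuadFree_of_check (D := [
    ((0, 49), [(12, 127), (13, 88), (34, 28), (63, 0)]),
    ((12, 127), [(0, 49), (13, 88), (50, 138), (84, 159)]),
    ((13, 88), [(0, 49), (12, 127), (24, 69), (27, 79), (34, 88), (35, 100)]),
    ((24, 69), [(13, 88), (27, 79), (33, 47), (33, 57)]),
    ((27, 79), [(13, 88), (24, 69), (36, 74), (39, 79)]),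
    ((33, 47), [(24, 69), (33, 57), (34, 28), (47, 35)]),
    ((33, 57), [(24, 69), (33, 47), (40, 58), (44, 49)]),
    ((34, 28), [(0, 49), (33, 47), (47, 35), (63, 0)]),
    ((34, 88), [(13, 88), (35, 100), (45, 83), (55, 86)]),
    ((35, 100), [(13, 88), (34, 88), (49, 118), (54, 104)]),
    ((36, 74), [(27, 79), (39, 79), (41, 66), (45, 68)]),
    ((39, 79), [(27, 79), (36, 74), (45, 83), (53, 77)]),
    ((40, 58), [(33, 57), (41, 66), (44, 49), (46, 59)]),
    ((41, 66), [(36, 74), (40, 58), (45, 68), (46, 59)]),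
    ((44, 49), [(33, 57), (40, 58), (53, 47), (54, 40)]),
    ((45, 68), [(36, 74), (41, 66), (52, 63), (55, 67)]),
    ((45, 83), [(34, 88), (39, 79), (53, 77), (55, 86)]),
    ((46, 59), [(40, 58), (41, 66), (52, 58), (54, 53)]),
    ((47, 35), [(33, 47), (34, 28), (54, 40), (66, 35)]),
    ((49, 118), [(35, 100), (50, 138), (54, 104), (68, 125)]),
    ((50, 138), [(12, 127), (49, 118), (68, 125), (84, 159)]),
    ((52, 58), [(46, 59), (52, 63), (54, 53), (58, 58)]),
    ((52, 63), [(45, 68), (52, 58), (55, 67), (58, 58)]),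
    ((53, 47), [(44, 49), (54, 40), (54, 53), (61, 48)]),
    ((53, 77), [(39, 79), (45, 83), (60, 71), (68, 74)]),
    ((54, 40), [(44, 49), (47, 35), (53, 47), (66, 35)]),
    ((54, 53), [(46, 59), (52, 58), (53, 47), (61, 48)]),
    ((54, 104), [(35, 100), (49, 118), (64, 92), (71, 103)]),
    ((55, 67), [(45, 68), (52, 63), (60, 71), (63, 63)]),
    ((55, 86), [(34, 88), (45, 83), (64, 92), (76, 80)]),
    ((58, 58), [(52, 58), (52, 63), (64, 51), (65, 57)]),
    ((60, 71), [(53, 77), (55, 67), (63, 63), (68, 74)]),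
    ((61, 48), [(53, 47), (54, 53), (64, 51), (69, 46)]),
    ((63, 0), [(0, 49), (34, 28), (99, 20), (137, 30)]),
    ((63, 63), [(55, 67), (60, 71), (65, 57), (72, 57)]),
    ((64, 51), [(58, 58), (61, 48), (65, 57), (69, 46)]),
    ((64, 92), [(54, 104), (55, 86), (71, 103), (76, 80)]),
    ((65, 57), [(58, 58), (63, 63), (64, 51), (72, 57)]),
    ((66, 35), [(47, 35), (54, 40), (76, 38), (85, 30)]),
    ((68, 74), [(53, 77), (60, 71), (76, 80), (80, 66)]),
    ((68, 125), [(49, 118), (50, 138), (80, 114), (92, 121)]),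
    ((69, 46), [(61, 48), (64, 51), (75, 48), (76, 38)]),
    ((71, 103), [(54, 104), (64, 92), (80, 114), (86, 100)]),
    ((72, 57), [(63, 63), (65, 57), (75, 48), (79, 56)]),
    ((75, 48), [(69, 46), (72, 57), (76, 38), (79, 56)]),
    ((76, 38), [(66, 35), (69, 46), (75, 48), (85, 30)]),
    ((76, 80), [(55, 86), (64, 92), (68, 74), (80, 66), (91, 88), (96, 74)]),
    ((79, 56), [(72, 57), (75, 48), (80, 66), (90, 54)]),
    ((80, 66), [(68, 74), (76, 80), (79, 56), (90, 54)]),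
    ((80, 114), [(68, 125), (71, 103), (86, 100), (92, 121)]),
    ((84, 159), [(12, 127), (50, 138), (113, 129), (148, 108)]),
    ((85, 30), [(66, 35), (76, 38), (96, 39), (99, 20)]),
    ((86, 100), [(71, 103), (80, 114), (91, 88), (101, 94)]),
    ((90, 54), [(79, 56), (80, 66), (96, 39), (101, 58)]),
    ((91, 88), [(76, 80), (86, 100), (96, 74), (101, 94)]),
    ((92, 121), [(68, 125), (80, 114), (109, 108), (113, 129)]),
    ((96, 39), [(85, 30), (90, 54), (99, 20), (101, 58)]),
    ((96, 74), [(76, 80), (91, 88), (101, 58), (115, 72)]),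
    ((99, 20), [(63, 0), (85, 30), (96, 39), (137, 30)]),
    ((101, 58), [(90, 54), (96, 39), (96, 74), (115, 72)]),
    ((101, 94), [(86, 100), (91, 88), (109, 108), (118, 86)]),
    ((109, 108), [(92, 121), (101, 94), (113, 129), (118, 86)]),
    ((113, 129), [(84, 159), (92, 121), (109, 108), (148, 108)]),
    ((115, 72), [(96, 74), (101, 58), (118, 86), (135, 70)]),
    ((118, 86), [(101, 94), (109, 108), (115, 72), (135, 70)]),
    ((135, 70), [(115, 72), (118, 86), (137, 30), (148, 108)]),
    ((137, 30), [(63, 0), (99, 20), (135, 70), (148, 108)]),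
    ((148, 108), [(84, 159), (113, 129), (135, 70), (137, 30)])])
    (by decide +kernel)

/-- Order 69 is the sum 30 + 39. -/
theorem existsQuadFree_four_70 : ExistsQuadFree 4 70 :=
  GridDrawing.existsQuadFree_of_check (D := [
    ((0, 49), [(11, 88), (11, 128), (34, 27), (63, 0)]),
    ((11, 88), [(0, 49), (11, 128), (25, 78), (31, 91)]),
    ((11, 128), [(0, 49), (11, 88), (50, 137), (85, 158)]),
    ((25, 78), [(11, 88), (31, 91), (33, 61), (36, 72)]),
    ((31, 91), [(11, 88), (25, 78), (47, 90), (47, 103)]),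
    ((33, 61), [(25, 78), (36, 72), (37, 43), (39, 52)]),
    ((34, 27), [(0, 49), (37, 43), (49, 33), (63, 0)]),
    ((36, 72), [(25, 78), (33, 61), (45, 67), (49, 73)]),
    ((37, 43), [(33, 61), (34, 27), (39, 52), (49, 33)]),
    ((39, 52), [(33, 61), (37, 43), (46, 58), (49, 51)]),
    ((45, 67), [(36, 72), (46, 58), (49, 73), (52, 61)]),
    ((46, 58), [(39, 52), (45, 67), (49, 51), (52, 61)]),
    ((47, 90), [(31, 91), (47, 103), (55, 81), (64, 85)]),
    ((47, 103), [(31, 91), (47, 90), (55, 120), (62, 107)]),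
    ((49, 33), [(34, 27), (37, 43), (58, 37), (69, 34)]),
    ((49, 51), [(39, 52), (46, 58), (56, 45), (56, 51)]),
    ((49, 73), [(36, 72), (45, 67), (55, 81), (62, 72)]),
    ((50, 137), [(11, 128), (55, 120), (70, 126), (85, 158)]),
    ((52, 61), [(45, 67), (46, 58), (58, 57), (62, 61)]),
    ((55, 81), [(47, 90), (49, 73), (62, 72), (64, 85)]),
    ((55, 120), [(47, 103), (50, 137), (62, 107), (70, 126)]),
    ((56, 45), [(49, 51), (56, 51), (58, 37), (64, 42)]),
    ((56, 51), [(49, 51), (56, 45), (58, 57), (64, 52)]),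
    ((58, 37), [(49, 33), (56, 45), (64, 42), (69, 34)]),
    ((58, 57), [(52, 61), (56, 51), (62, 61), (64, 52)]),
    ((62, 61), [(52, 61), (58, 57), (68, 66), (71, 59)]),
    ((62, 72), [(49, 73), (55, 81), (68, 66), (76, 68)]),
    ((62, 107), [(47, 103), (55, 120), (74, 98), (77, 107)]),
    ((63, 0), [(0, 49), (34, 27), (99, 20), (137, 30)]),
    ((64, 42), [(56, 45), (58, 37), (68, 47), (74, 43)]),
    ((64, 52), [(56, 51), (58, 57), (68, 47), (71, 53)]),
    ((64, 85), [(47, 90), (55, 81), (75, 88), (80, 79)]),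
    ((68, 47), [(64, 42), (64, 52), (71, 53), (74, 43)]),
    ((68, 66), [(62, 61), (62, 72), (71, 59), (76, 68)]),
    ((69, 34), [(49, 33), (58, 37), (80, 37), (88, 32)]),
    ((70, 126), [(50, 137), (55, 120), (82, 116), (94, 122)]),
    ((71, 53), [(64, 52), (68, 47), (71, 59), (79, 54)]),
    ((71, 59), [(62, 61), (68, 66), (71, 53), (79, 54)]),
    ((74, 43), [(64, 42), (68, 47), (80, 37), (82, 47)]),
    ((74, 98), [(62, 107), (75, 88), (77, 107), (87, 88)]),
    ((75, 88), [(64, 85), (74, 98), (80, 79), (87, 88)]),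
    ((76, 68), [(62, 72), (68, 66), (86, 71), (89, 62)]),
    ((77, 107), [(62, 107), (74, 98), (82, 116), (91, 103)]),
    ((79, 54), [(71, 53), (71, 59), (82, 47), (89, 55)]),
    ((80, 37), [(69, 34), (74, 43), (82, 47), (88, 32)]),
    ((80, 79), [(64, 85), (75, 88), (86, 71), (97, 72)]),
    ((82, 47), [(74, 43), (79, 54), (80, 37), (89, 55)]),
    ((82, 116), [(70, 126), (77, 107), (91, 103), (94, 122)]),
    ((85, 158), [(11, 128), (50, 137), (113, 129), (148, 109)]),
    ((86, 71), [(76, 68), (80, 79), (89, 62), (97, 72)]),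
    ((87, 88), [(74, 98), (75, 88), (97, 91), (101, 78)]),
    ((88, 32), [(69, 34), (80, 37), (99, 20), (102, 43)]),
    ((89, 55), [(79, 54), (82, 47), (89, 62), (101, 57)]),
    ((89, 62), [(76, 68), (86, 71), (89, 55), (101, 57)]),
    ((91, 103), [(77, 107), (82, 116), (97, 91), (106, 96)]),
    ((94, 122), [(70, 126), (82, 116), (110, 108), (113, 129)]),
    ((97, 72), [(80, 79), (86, 71), (101, 78), (113, 66)]),
    ((97, 91), [(87, 88), (91, 103), (101, 78), (106, 96)]),
    ((99, 20), [(63, 0), (88, 32), (102, 43), (137, 30)]),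
    ((101, 57), [(89, 55), (89, 62), (102, 43), (113, 66)]),
    ((101, 78), [(87, 88), (97, 72), (97, 91), (113, 66)]),
    ((102, 43), [(88, 32), (99, 20), (101, 57), (113, 66)]),
    ((106, 96), [(91, 103), (97, 91), (110, 108), (118, 85)]),
    ((110, 108), [(94, 122), (106, 96), (113, 129), (118, 85)]),
    ((113, 66), [(97, 72), (101, 57), (101, 78), (102, 43), (118, 85), (135, 70)]),
    ((113, 129), [(85, 158), (94, 122), (110, 108), (148, 109)]),
    ((118, 85), [(106, 96), (110, 108), (113, 66), (135, 70)]),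
    ((135, 70), [(113, 66), (118, 85), (137, 30), (148, 109)]),
    ((137, 30), [(63, 0), (99, 20), (135, 70), (148, 109)]),
    ((148, 109), [(85, 158), (113, 129), (135, 70), (137, 30)])])
    (by decide +kernel)

theorem existsQuadFree_four_71 : ExistsQuadFree 4 71 :=
  GridDrawing.existsQuadFree_of_check (D := [
    ((0, 49), [(11, 128), (15, 88), (35, 29), (63, 0)]),
    ((11, 128), [(0, 49), (15, 88), (51, 133), (85, 158)]),
    ((15, 88), [(0, 49), (11, 128), (30, 79), (37, 93)]),
    ((30, 79), [(15, 88), (36, 62), (37, 93), (39, 72)]),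
    ((35, 29), [(0, 49), (39, 44), (48, 36), (63, 0)]),
    ((36, 62), [(30, 79), (39, 44), (39, 72), (42, 53)]),
    ((37, 93), [(15, 88), (30, 79), (53, 92), (55, 108)]),
    ((39, 44), [(35, 29), (36, 62), (42, 53), (48, 36)]),
    ((39, 72), [(30, 79), (36, 62), (47, 66), (50, 73)]),
    ((42, 53), [(36, 62), (39, 44), (48, 57), (51, 50)]),
    ((47, 66), [(39, 72), (48, 57), (50, 73), (53, 60)]),
    ((48, 36), [(35, 29), (39, 44), (56, 42), (66, 38)]),
    ((48, 57), [(42, 53), (47, 66), (51, 50), (53, 60)]),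
    ((50, 73), [(39, 72), (47, 66), (56, 80), (58, 70)]),
    ((51, 50), [(42, 53), (48, 57), (56, 42), (58, 49)]),
    ((51, 133), [(11, 128), (55, 108), (64, 121), (85, 158)]),
    ((53, 60), [(47, 66), (48, 57), (60, 55), (60, 62)]),
    ((53, 92), [(37, 93), (55, 108), (56, 80), (66, 82)]),
    ((55, 108), [(37, 93), (51, 133), (53, 92), (64, 121), (68, 102), (73, 93)]),
    ((56, 42), [(48, 36), (51, 50), (58, 49), (66, 38)]),
    ((56, 80), [(50, 73), (53, 92), (58, 70), (66, 82)]),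
    ((58, 49), [(51, 50), (56, 42), (60, 55), (66, 49)]),
    ((58, 70), [(50, 73), (56, 80), (60, 62), (67, 62)]),
    ((60, 55), [(53, 60), (58, 49), (60, 62), (66, 49)]),
    ((60, 62), [(53, 60), (58, 70), (60, 55), (67, 62)]),
    ((63, 0), [(0, 49), (35, 29), (97, 23), (137, 30)]),
    ((64, 121), [(51, 133), (55, 108), (74, 115), (82, 119)]),
    ((66, 38), [(48, 36), (56, 42), (74, 43), (83, 34)]),
    ((66, 49), [(58, 49), (60, 55), (71, 53), (74, 43)]),
    ((66, 82), [(53, 92), (56, 80), (77, 70), (78, 81)]),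
    ((67, 62), [(58, 70), (60, 62), (71, 53), (76, 61)]),
    ((68, 102), [(55, 108), (73, 93), (75, 106), (79, 99)]),
    ((71, 53), [(66, 49), (67, 62), (74, 43), (76, 61)]),
    ((73, 93), [(55, 108), (68, 102), (78, 81), (92, 80)]),
    ((74, 43), [(66, 38), (66, 49), (71, 53), (83, 34)]),
    ((74, 115), [(64, 121), (75, 106), (81, 109), (82, 119)]),
    ((75, 106), [(68, 102), (74, 115), (79, 99), (81, 109)]),
    ((76, 61), [(67, 62), (71, 53), (77, 70), (86, 58)]),
    ((77, 70), [(66, 82), (76, 61), (78, 81), (86, 58)]),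
    ((78, 81), [(66, 82), (73, 93), (77, 70), (92, 80)]),
    ((79, 99), [(68, 102), (75, 106), (87, 97), (89, 90)]),
    ((81, 109), [(74, 115), (75, 106), (88, 104), (89, 110)]),
    ((82, 119), [(64, 121), (74, 115), (92, 116), (99, 122)]),
    ((83, 34), [(66, 38), (74, 43), (92, 43), (97, 23)]),
    ((85, 158), [(11, 128), (51, 133), (113, 129), (148, 109)]),
    ((86, 58), [(76, 61), (77, 70), (92, 43), (97, 63)]),
    ((87, 97), [(79, 99), (88, 104), (89, 90), (94, 99)]),
    ((88, 104), [(81, 109), (87, 97), (89, 110), (94, 99)]),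
    ((89, 90), [(79, 99), (87, 97), (92, 80), (98, 87)]),
    ((89, 110), [(81, 109), (88, 104), (92, 116), (97, 109)]),
    ((92, 43), [(83, 34), (86, 58), (97, 23), (97, 63)]),
    ((92, 80), [(73, 93), (78, 81), (89, 90), (97, 63), (98, 87), (111, 73)]),
    ((92, 116), [(82, 119), (89, 110), (97, 109), (99, 122)]),
    ((94, 99), [(87, 97), (88, 104), (100, 102), (101, 94)]),
    ((97, 23), [(63, 0), (83, 34), (92, 43), (137, 30)]),
    ((97, 63), [(86, 58), (92, 43), (92, 80), (111, 73)]),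
    ((97, 109), [(89, 110), (92, 116), (100, 102), (105, 106)]),
    ((98, 87), [(89, 90), (92, 80), (101, 94), (109, 89)]),
    ((99, 122), [(82, 119), (92, 116), (109, 115), (113, 129)]),
    ((100, 102), [(94, 99), (97, 109), (101, 94), (105, 106)]),
    ((101, 94), [(94, 99), (98, 87), (100, 102), (109, 89)]),
    ((105, 106), [(97, 109), (100, 102), (109, 115), (112, 98)]),
    ((109, 89), [(98, 87), (101, 94), (112, 98), (119, 82)]),
    ((109, 115), [(99, 122), (105, 106), (112, 98), (113, 129)]),
    ((111, 73), [(92, 80), (97, 63), (119, 82), (133, 71)]),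
    ((112, 98), [(105, 106), (109, 89), (109, 115), (119, 82)]),
    ((113, 129), [(85, 158), (99, 122), (109, 115), (148, 109)]),
    ((119, 82), [(109, 89), (111, 73), (112, 98), (133, 71)]),
    ((133, 71), [(111, 73), (119, 82), (137, 30), (148, 109)]),
    ((137, 30), [(63, 0), (97, 23), (133, 71), (148, 109)]),
    ((148, 109), [(85, 158), (113, 129), (133, 71), (137, 30)])])
    (by decide +kernel)

/-- Order 72 is the sum 36 + 36; order 73 completes the thirty consecutive orders that start at 44.
-/
theorem existsQuadFree_four_73 : ExistsQuadFree 4 73 :=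
  GridDrawing.existsQuadFree_of_check (D := [
    ((0, 78), [(25, 122), (34, 40), (37, 172), (61, 0)]),
    ((25, 122), [(0, 78), (37, 172), (40, 109), (56, 123)]),
    ((34, 40), [(0, 78), (40, 60), (53, 42), (61, 0)]),
    ((37, 172), [(0, 78), (25, 122), (87, 171), (137, 185)]),
    ((40, 60), [(34, 40), (41, 85), (43, 71), (53, 42)]),
    ((40, 109), [(25, 122), (41, 85), (46, 98), (56, 123)]),
    ((41, 85), [(40, 60), (40, 109), (43, 71), (46, 98)]),
    ((43, 71), [(40, 60), (41, 85), (50, 74), (51, 63)]),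
    ((46, 98), [(40, 109), (41, 85), (54, 91), (58, 98)]),
    ((50, 74), [(43, 71), (51, 63), (54, 83), (55, 74)]),
    ((51, 63), [(43, 71), (50, 74), (58, 61), (59, 54)]),
    ((53, 42), [(34, 40), (40, 60), (64, 43), (76, 35)]),
    ((54, 83), [(50, 74), (54, 91), (55, 74), (59, 83)]),
    ((54, 91), [(46, 98), (54, 83), (58, 98), (59, 83)]),
    ((55, 74), [(50, 74), (54, 83), (59, 67), (60, 72)]),
    ((56, 123), [(25, 122), (40, 109), (64, 107), (75, 104), (79, 145), (80, 125)]),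
    ((58, 61), [(51, 63), (59, 54), (59, 67), (63, 61)]),
    ((58, 98), [(46, 98), (54, 91), (64, 107), (70, 91)]),
    ((59, 54), [(51, 63), (58, 61), (64, 43), (67, 51)]),
    ((59, 67), [(55, 74), (58, 61), (60, 72), (63, 61)]),
    ((59, 83), [(54, 83), (54, 91), (63, 77), (67, 78)]),
    ((60, 72), [(55, 74), (59, 67), (63, 77), (66, 69)]),
    ((61, 0), [(0, 78), (34, 40), (111, 12), (160, 13)]),
    ((63, 61), [(58, 61), (59, 67), (68, 63), (69, 56)]),
    ((63, 77), [(59, 83), (60, 72), (66, 69), (67, 78)]),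
    ((64, 43), [(53, 42), (59, 54), (67, 51), (76, 35)]),
    ((64, 107), [(56, 123), (58, 98), (70, 91), (75, 104)]),
    ((66, 69), [(60, 72), (63, 77), (68, 63), (72, 65)]),
    ((67, 51), [(59, 54), (64, 43), (69, 56), (75, 52)]),
    ((67, 78), [(59, 83), (63, 77), (73, 80), (74, 70)]),
    ((68, 63), [(63, 61), (66, 69), (69, 56), (72, 65)]),
    ((69, 56), [(63, 61), (67, 51), (68, 63), (75, 52)]),
    ((70, 91), [(58, 98), (64, 107), (73, 80), (81, 75)]),
    ((72, 65), [(66, 69), (68, 63), (74, 70), (77, 59)]),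
    ((73, 80), [(67, 78), (70, 91), (74, 70), (81, 75)]),
    ((74, 70), [(67, 78), (72, 65), (73, 80), (77, 59)]),
    ((75, 52), [(67, 51), (69, 56), (77, 59), (83, 50)]),
    ((75, 104), [(56, 123), (64, 107), (92, 82), (94, 97)]),
    ((76, 35), [(53, 42), (64, 43), (89, 40), (97, 27)]),
    ((77, 59), [(72, 65), (74, 70), (75, 52), (83, 50)]),
    ((79, 145), [(56, 123), (80, 125), (87, 171), (106, 150)]),
    ((80, 125), [(56, 123), (79, 145), (96, 110), (103, 122)]),
    ((81, 75), [(70, 91), (73, 80), (87, 58), (94, 68)]),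
    ((83, 50), [(75, 52), (77, 59), (87, 58), (89, 40)]),
    ((87, 58), [(81, 75), (83, 50), (89, 40), (94, 68)]),
    ((87, 171), [(37, 172), (79, 145), (106, 150), (137, 185)]),
    ((89, 40), [(76, 35), (83, 50), (87, 58), (97, 27)]),
    ((92, 82), [(75, 104), (94, 68), (94, 97), (107, 59)]),
    ((94, 68), [(81, 75), (87, 58), (92, 82), (107, 59)]),
    ((94, 97), [(75, 104), (92, 82), (96, 110), (112, 93)]),
    ((96, 110), [(80, 125), (94, 97), (103, 122), (112, 93)]),
    ((97, 27), [(76, 35), (89, 40), (111, 12), (113, 36)]),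
    ((103, 122), [(80, 125), (96, 110), (117, 132), (124, 114)]),
    ((106, 150), [(79, 145), (87, 171), (117, 132), (136, 139)]),
    ((107, 59), [(92, 82), (94, 68), (113, 36), (127, 56)]),
    ((111, 12), [(61, 0), (97, 27), (113, 36), (160, 13)]),
    ((112, 93), [(94, 97), (96, 110), (128, 96), (130, 77)]),
    ((113, 36), [(97, 27), (107, 59), (111, 12), (127, 56)]),
    ((117, 132), [(103, 122), (106, 150), (124, 114), (136, 139)]),
    ((124, 114), [(103, 122), (117, 132), (128, 96), (144, 102)]),
    ((127, 56), [(107, 59), (113, 36), (130, 77), (150, 67)]),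
    ((128, 96), [(112, 93), (124, 114), (130, 77), (144, 102)]),
    ((130, 77), [(112, 93), (127, 56), (128, 96), (150, 67)]),
    ((136, 139), [(106, 150), (117, 132), (154, 117), (163, 142)]),
    ((137, 185), [(37, 172), (87, 171), (163, 142), (198, 106)]),
    ((144, 102), [(124, 114), (128, 96), (154, 117), (159, 87)]),
    ((150, 67), [(127, 56), (130, 77), (159, 87), (173, 61)]),
    ((154, 117), [(136, 139), (144, 102), (159, 87), (163, 142)]),
    ((159, 87), [(144, 102), (150, 67), (154, 117), (173, 61)]),
    ((160, 13), [(61, 0), (111, 12), (173, 61), (198, 106)]),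
    ((163, 142), [(136, 139), (137, 185), (154, 117), (198, 106)]),
    ((173, 61), [(150, 67), (159, 87), (160, 13), (198, 106)]),
    ((198, 106), [(137, 185), (160, 13), (163, 142), (173, 61)])])
    (by decide +kernel)

/-! ### All large orders, and the two bounds -/

/-- Ten consecutive orders and a block of order 10 reach every larger order. -/
theorem existsQuadFree_three {N : ℕ} (hN : 10 ≤ N) : ExistsQuadFree 3 N := by
  induction N using Nat.strong_induction_on with
  | _ N ih =>
    rcases lt_or_ge N 20 with h | h
    · interval_cases N
      exacts [existsQuadFree_three_10, existsQuadFree_three_11, existsQuadFree_three_12,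
        existsQuadFree_three_13, existsQuadFree_three_14, existsQuadFree_three_15,
        existsQuadFree_three_16, existsQuadFree_three_17, existsQuadFree_three_18,
        existsQuadFree_three_19]
    · have := (ih (N - 10) (by omega) (by omega)).add existsQuadFree_three_10
      rwa [Nat.sub_add_cancel hN] at this

/-- The window has length 30, the order of the smallest block, so for `N ≥ 74` the order `N - 30` is
still at least 44. -/
theorem existsQuadFree_four {N : ℕ} (hN : 44 ≤ N) : ExistsQuadFree 4 N := by
  induction N using Nat.strong_induction_on with
  | _ N ih =>
    rcases lt_or_ge N 74 with h | h
    · interval_cases N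
      exacts [existsQuadFree_four_44, existsQuadFree_four_45, existsQuadFree_four_46,
        existsQuadFree_four_47, existsQuadFree_four_48, existsQuadFree_four_49,
        existsQuadFree_four_50, existsQuadFree_four_51, existsQuadFree_four_52,
        existsQuadFree_four_53, existsQuadFree_four_54, existsQuadFree_four_55,
        existsQuadFree_four_56, existsQuadFree_four_57, existsQuadFree_four_58,
        existsQuadFree_four_59, existsQuadFree_four_30.add existsQuadFree_four_30,
        existsQuadFree_four_61, existsQuadFree_four_62, existsQuadFree_four_63,
        existsQuadFree_four_64, existsQuadFree_four_65,
        existsQuadFree_four_30.add existsQuadFree_four_36, existsQuadFree_four_67,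
        existsQuadFree_four_68, existsQuadFree_four_30.add existsQuadFree_four_39,
        existsQuadFree_four_70, existsQuadFree_four_71,
        existsQuadFree_four_36.add existsQuadFree_four_36, existsQuadFree_four_73]
    · have := (ih (N - 30) (by omega) (by omega)).add existsQuadFree_four_30
      rwa [Nat.sub_add_cancel (by omega)] at this

theorem mainTheorem5 (n : ℕ) :
    ((7 ≤ n ∧ n ≤ 25) ∨ n ∈ ({27, 28, 29, 30, 31, 33, 34, 36, 37, 39} : Set ℕ) →
      n + 4 ≤ planarRamsey (SimpleGraph.cycleGraph 4) (wheelGraph n)) ∧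
    (n ∈ ({26, 32, 35, 38} : Set ℕ) ∨ 40 ≤ n →
      n + 5 ≤ planarRamsey (SimpleGraph.cycleGraph 4) (wheelGraph n)) := by
  simp only [Set.mem_insert_iff, Set.mem_singleton_iff]
  refine ⟨fun h => ?_, fun h => ?_⟩
  -- Every listed `n` is at least 7, so `n + 3 ≥ 10`; the strict bound `n + 3 < PR` is the claim.
  · exact (existsQuadFree_three (N := n + 3) (by omega)).lt_planarRamsey
  · refine (show ExistsQuadFree 4 (n + 4) from ?_).lt_planarRamsey
    -- The four isolated values of `n` correspond to the orders 30, 36, 39 and 42, and `n ≥ 40` to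
    -- orders from 44 on.
    rcases h with (rfl | rfl | rfl | rfl) | h
    exacts [existsQuadFree_four_30, existsQuadFree_four_36, existsQuadFree_four_39,
      existsQuadFree_four_42, existsQuadFree_four (by omega)]
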